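/- Let $d\ge d_\star\ge 2$ be integers. Arrange $2^d$ cards on the vertices of the hypercube $\{0,1\}^d$, one on each vertex. For $j=1,\dots,d$ let $K_j$ be the transition kernel, on the set of all arrangements, in which for each edge of the cube in direction $j$, independently with probability $\tfrac12$, the two cards at its endpoints are interchanged. Put $K_\star=K_1K_2\cdots K_{d_\star}$. The $d_\star$-truncated zigzag shuffle is the Markov chain $\{Z_n: n\ge 0\}$ with transition kernel $K_\star K_\star^{t}$, started from an arbitrary fixed arrangement $Z_0$; its state space $V$ is the set of arrangements reachable from $Z_0$. For a set $B$ of cards let $X(B)$ be the set of vertices occupied by the cards of $B$ in the arrangement $X$, and let $$N(B)=\bigl|\{X(B): X\in V\}\bigr|$$ be the number of sets of positions that $B$ can occupy. There is a universal constant $c$ (a positive integer) such that the following holds for all integers $d\ge d_\star\ge2$, all starting arrangements $Z_0$ and all sets of cards $B$. First, $$N(B)=\prod_{Q}\binom{2^{d_\star}}{|Z_0(B)\cap Q|},$$ where $Q$ runs over the $2^{d-d_\star}$ subcubes of dimension $d_\star$ obtained by prescribing the coordinates $d_\star+1,\dots,d$; in particular $N(B)=\binom{2^d}{|B|}$ if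 $d_\star=d$. Second, for every real $k\ge 1$ for which $l=k\,c\,d\,(d_\star-1)^4$ is an integer (in particular for every integer $k\ge1$), $$\max_{B'}\,N(B)\,\mathbf P\bigl(Z_l(B)=B'\bigr)\le \exp(\exp(-k)),$$ where the maximum is over all sets $B'$ of vertices. -/

import Mathlib

namespace ThorpShuffle

/-- The vertices of the `d`-dimensional unit hypercube (`false` is `0`, `true` is `1`).
Coordinate `j + 1` of the usual numbering is coordinate `j : Fin d`. -/
abbrev Cube (d : ℕ) : Type := Fin d → Bool

/-- An arrangement of a deck of `2 ^ d` cards on the vertices of the hypercube: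
`X i` is the position of card `i`. -/
abbrev Arrangement (d : ℕ) : Type := Fin (2 ^ d) ≃ Cube d

/-- An edge of the hypercube in direction `j`, represented by its endpoint with `j`-th
coordinate `0`. -/
abbrev Edge {d : ℕ} (j : Fin d) : Type := {x : Cube d // x j = false}

/-- The edge in direction `j` incident to the vertex `x`. -/
def edgeAt {d : ℕ} (j : Fin d) (x : Cube d) : Edge j :=
  ⟨Function.update x j false, Function.update_self j false x⟩

/-- The new position of the card at `x`, when precisely those edges `e` in direction `j` with
`coin e = true` have the cards at their endpoints interchanged. -/
def move {d : ℕ} (j : Fin d) (coin : Edge j → Bool) (x : Cube d) : Cube d :=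
  if coin (edgeAt j x) = true then Function.update x j (!x j) else x

/-- The transition kernel in which every edge in direction `j` rings: for each of these edges an
independent fair coin decides whether the cards at its endpoints are interchanged. The entry at
`(X, Y)` is the proportion of the coin assignments that turn `X` into `Y`. -/
noncomputable def ringKernel {d : ℕ} (j : Fin d) :
    Matrix (Arrangement d) (Arrangement d) ℝ :=
  Matrix.of fun X Y =>
    (Nat.card {coin : Edge j → Bool // ∀ i, Y i = move j coin (X i)} : ℝ) /
      (Nat.card (Edge j → Bool) : ℝ)

/-- The kernel of the `dstar`-truncated Thorp shuffle: the product, in increasing order of the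
direction, of the kernels of the first `dstar` directions. -/
noncomputable def truncatedThorpKernel (d dstar : ℕ) :
    Matrix (Arrangement d) (Arrangement d) ℝ :=
  (((List.finRange d).filter fun j : Fin d => (j : ℕ) < dstar).map ringKernel).prod

/-- The kernel of the `dstar`-truncated zigzag shuffle: a truncated Thorp shuffle followed by a
time-reversed one. -/
noncomputable def truncatedZigzagKernel (d dstar : ℕ) :
    Matrix (Arrangement d) (Arrangement d) ℝ :=
  truncatedThorpKernel d dstar * (truncatedThorpKernel d dstar).transpose

/-- The state space of the `dstar`-truncated zigzag shuffle with starting state `X₀`: the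
arrangements that are reachable from `X₀`. -/
def stateSpace {d : ℕ} (dstar : ℕ) (X₀ : Arrangement d) : Set (Arrangement d) :=
  {X | ∃ n : ℕ, 0 < (truncatedZigzagKernel d dstar ^ n) X₀ X}

/-- The set of positions of the cards in `B`. -/
def positions {d : ℕ} (X : Arrangement d) (B : Finset (Fin (2 ^ d))) : Finset (Cube d) :=
  B.map X.toEmbedding

/-- The sets of positions that the set of cards `B` occupies in some state of the chain. -/
def reachablePositions {d : ℕ} (dstar : ℕ) (X₀ : Arrangement d) (B : Finset (Fin (2 ^ d))) :
    Set (Finset (Cube d)) :=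
  {B' | ∃ X ∈ stateSpace dstar X₀, positions X B = B'}

/-- `P(Z_l(B) = B')`, where `(Z_n)` is the `dstar`-truncated zigzag shuffle with `Z_0 = X₀`. -/
noncomputable def hitProb {d : ℕ} (dstar : ℕ) (X₀ : Arrangement d) (l : ℕ)
    (B : Finset (Fin (2 ^ d))) (B' : Finset (Cube d)) : ℝ :=
  ∑ X : Arrangement d with positions X B = B', (truncatedZigzagKernel d dstar ^ l) X₀ X

/-- The subcubes of dimension `dstar` in which the shuffle takes place are obtained by
prescribing the coordinates from `dstar + 1` to `d`; they are indexed by these prescriptions.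
This is the number of cards of `B` in the subcube `Q`, in the arrangement `X`. -/
def cardsIn {d : ℕ} (dstar : ℕ) (X : Arrangement d) (B : Finset (Fin (2 ^ d)))
    (Q : {j : Fin d // dstar ≤ (j : ℕ)} → Bool) : ℕ :=
  {x ∈ positions X B | ∀ j : {j : Fin d // dstar ≤ (j : ℕ)}, x j = Q j}.card

end ThorpShuffle

/-! Only the set of occupied vertices matters. It is itself a Markov chain on the configurations
with prescribed numbers of cards in the subcubes, and its operator is `T* T`, where `T` is the
product of the edge averages (`shuffleOp`). With `m` active directions the key fact is
hypercontractivity (`hypercontractive_shuffleOp`): on each such class `T` has norm at most one from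
`L^p` to `L^2`, on nonnegative functions, with `p = 2 / (1 + a)` and `a` at least a constant times
`m⁻⁴`.

Let `N` be the size of the class and `f` a probability vector on it. Hypercontractivity and
interpolation between `L¹` and `L²` show that one zigzag step turns `q = N ∑ f²` into at most `q ^
(1 - a)` (`card_mul_sum_sq_le`). A point mass has `q = N ≤ 2 ^ 2 ^ d`, so `log q` decays like `exp
(d - a n)` after `n` steps. Self-adjointness converts the `L²` bound at half time into a pointwise
bound (`iterate_zigzagOp_single_le`). As that bound tends to 1, every configuration of the class is
reached, and `N(B)` is the size of the class.

Hypercontractivity is proved by induction on the dimension. A cube of dimension `n + 1` consists of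
two halves of `D = 2 ^ n` vertices, joined in pairs by one direction; `T` averages over the swaps of
the pairs and then acts separately in the halves. Given the number `w` of cards in the first half,
Minkowski's inequality tensorises the induction hypothesis. What is left is a channel between two
integers: the number `j` of full pairs and `w`, where `w - j` is binomial with `b - 2 j` fair
trials. Passing from functions of `j` to functions of `w` by conditional expectation must improve
integrability a little (`sum_halfProb_mul_halfAvg_rpow_le`), and this costs a factor `1 - ε` in the
exponent `a`, where `ε` is the contraction coefficient in `Contracts`, an entropy inequality.

For small `D` some `ε < 1` exists because all laws of `w` share an atom at `b / 2`. For large `n`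
one gets `ε = 3 / n` with `D = 2 ^ (n - 1)` (`sum_halfProb_mul_phi_halfAvg_le_of_large`): the test
function is cut by size; the bounded part is contracted by the spectral gap, since the nontrivial
eigenvalues of the channel are at most `1 / D` (`pairAvg_eigenvalue`), and the large part by a
chi-square bound on the law of `w` given `j` (`chiSq_le`), whose exceptional values of `j` have tiny
probability. The product of the factors `1 - 3 / n` is of order `n⁻³`; an exponent sequence of order
`n⁻⁴` (`exists_exponents`) leaves room for all constraints. -/

namespace ThorpShuffle
open Finset

/-! ### Elementary inequalities between the power divergences and the entropy function. -/

/-- The divergence function of order `1 + a`. -/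
noncomputable def phi (a x : ℝ) : ℝ := (x ^ (1 + a) - 1 - (1 + a) * (x - 1)) / a

/-- The entropy function `x log x - x + 1`. -/
noncomputable def phiZero (x : ℝ) : ℝ := x * Real.log x - x + 1

theorem rpow_one_add_eq {x : ℝ} (hx : 0 < x) (a : ℝ) :
    x ^ (1 + a) = x * Real.exp (a * Real.log x) := by
  rw [Real.rpow_add hx, Real.rpow_one, Real.rpow_def_of_pos hx, mul_comm a]

theorem phi_eq {a : ℝ} (ha : 0 < a) (x : ℝ) : a * phi a x = x ^ (1 + a) - 1 - (1 + a) * (x - 1) := by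
  unfold phi; field_simp

/-- With `x ^ a = exp (a log x)` this is `1 + t ≤ exp t`; `phiZero` is the limit of `phi a` as `a →
0`. -/
theorem phiZero_le_phi {a x : ℝ} (ha : 0 < a) (hx : 0 ≤ x) : phiZero x ≤ phi a x := by
  unfold phi phiZero
  rw [le_div_iff₀ ha]
  rcases hx.eq_or_lt with rfl | hx
  · rw [Real.zero_rpow (by linarith)]; simp
  · rw [rpow_one_add_eq hx]
    have := Real.add_one_le_exp (a * Real.log x)
    nlinarith

theorem phi_le_sq {a x : ℝ} (ha : 0 < a) (ha1 : a ≤ 1) (hx : 0 ≤ x) : phi a x ≤ (x - 1) ^ 2 := by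
  unfold phi
  rw [div_le_iff₀ ha]
  rcases hx.eq_or_lt with rfl | hx
  · rw [Real.zero_rpow (by linarith)]; linarith
  · rw [Real.rpow_add hx, Real.rpow_one]
    have := rpow_one_add_le_one_add_mul_self (s := x - 1) (by linarith) ha.le ha1
    rw [add_sub_cancel] at this
    nlinarith

theorem phi_one (a : ℝ) : phi a 1 = 0 := by simp [phi]

theorem convexOn_phi {a : ℝ} (ha : 0 < a) : ConvexOn ℝ (Set.Ici 0) (phi a) := by
  have h1 : ConvexOn ℝ (Set.Ici (0 : ℝ)) fun x : ℝ => x ^ (1 + a) := convexOn_rpow (by linarith)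
  refine ⟨convex_Ici 0, fun x hx y hy s t hs ht hst => ?_⟩
  have h := h1.2 hx hy hs ht hst
  simp only [smul_eq_mul, phi] at h ⊢
  rw [← mul_div_assoc, ← mul_div_assoc, ← add_div, div_le_div_iff_of_pos_right ha]
  obtain rfl : t = 1 - s := by linarith
  nlinarith

/-- The sign pattern puts the minimum at 1. The divergences and the entropy function all vanish to
second order there, so every comparison between them reduces to this. -/
theorem nonneg_of_deriv_sign {f f' : ℝ → ℝ} {X : ℝ} (hX : 1 ≤ X)
    (hc : ContinuousOn f (Set.Icc 0 X)) (hd : ∀ x, 0 < x → HasDerivAt f (f' x) x)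
    (h1 : 0 ≤ f 1) (hneg : ∀ x, 0 < x → x < 1 → f' x ≤ 0)
    (hpos : ∀ x, 1 < x → x < X → 0 ≤ f' x) {x : ℝ} (hx0 : 0 ≤ x) (hxX : x ≤ X) : 0 ≤ f x := by
  rcases le_total x 1 with h | h
  · have hanti : AntitoneOn f (Set.Icc 0 1) := by
      apply antitoneOn_of_deriv_nonpos (convex_Icc 0 1) (hc.mono (Set.Icc_subset_Icc_right hX))
      · intro y hy
        rw [interior_Icc] at hy
        exact (hd y hy.1).differentiableAt.differentiableWithinAt
      · intro y hy
        rw [interior_Icc] at hy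
        rw [(hd y hy.1).deriv]; exact hneg y hy.1 hy.2
    exact h1.trans (hanti ⟨hx0, h⟩ ⟨zero_le_one, le_rfl⟩ h)
  · have hmono : MonotoneOn f (Set.Icc 1 X) := by
      apply monotoneOn_of_deriv_nonneg (convex_Icc 1 X) (hc.mono (Set.Icc_subset_Icc_left zero_le_one))
      · intro y hy
        rw [interior_Icc] at hy
        exact (hd y (by linarith [hy.1])).differentiableAt.differentiableWithinAt
      · intro y hy
        rw [interior_Icc] at hy
        rw [(hd y (by linarith [hy.1])).deriv]; exact hpos y hy.1 hy.2
    exact h1.trans (hmono ⟨le_rfl, hX⟩ ⟨h, hxX⟩ h)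

theorem hasDerivAt_phiZero {x : ℝ} (hx : 0 < x) : HasDerivAt phiZero (Real.log x) x := by
  have := ((Real.hasDerivAt_mul_log hx.ne').sub (hasDerivAt_id x)).add_const 1
  exact this.congr_deriv (by ring)

theorem continuous_phiZero : Continuous phiZero :=
  (Real.continuous_mul_log.sub continuous_id).add continuous_const

theorem phiZero_nonneg {x : ℝ} (hx : 0 ≤ x) : 0 ≤ phiZero x := by
  refine nonneg_of_deriv_sign (f' := Real.log) (X := max 1 x) (le_max_left _ _)
    continuous_phiZero.continuousOn (fun x hx => hasDerivAt_phiZero hx) (by simp [phiZero]) ?_ ?_ hx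
    (le_max_right _ _)
  · exact fun x h0 h1 => Real.log_nonpos h0.le h1.le
  · exact fun x h1 _ => Real.log_nonneg h1.le

/-- On `[1, K]` one has `log x ≥ 1 - 1 / x ≥ (x - 1) / K`. This lets a variance bound control the
part of a density below the level `K`. -/
theorem sq_le_phiZero {K x : ℝ} (hK : 1 ≤ K) (hx : 0 ≤ x) (hxK : x ≤ K) :
    (x - 1) ^ 2 ≤ 2 * K * phiZero x := by
  have hK0 : 0 < K := by linarith
  suffices h : 0 ≤ 2 * K * phiZero x - (x - 1) ^ 2 by linarith
  refine nonneg_of_deriv_sign (f := fun x => 2 * K * phiZero x - (x - 1) ^ 2)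
    (f' := fun x => 2 * K * Real.log x - 2 * (x - 1)) hK
    (by have := continuous_phiZero; fun_prop) (fun x hx => ?_) (by simp [phiZero]) ?_ ?_ hx hxK
  · exact (((hasDerivAt_phiZero hx).const_mul (2 * K)).sub
      (((hasDerivAt_id x).sub_const 1).pow 2)).congr_deriv (by simp)
  · intro x h0 h1
    have := Real.log_le_sub_one_of_pos h0
    nlinarith
  · intro x h1 h2
    have := Real.one_sub_inv_le_log_of_pos (by linarith : (0 : ℝ) < x)
    have h3 : x * (1 - x⁻¹) = x - 1 := by field_simp
    have h4 : 0 ≤ Real.log x := Real.log_nonneg h1.le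
    nlinarith

/-- The loss is `X ^ a`, which tends to 1 as `a → 0`; for a fixed number of pairs a density is
bounded by some `X`, and the loss becomes negligible. -/
theorem phi_le_mul_phiZero {a X x : ℝ} (ha : 0 < a) (hX : 1 ≤ X) (hx : 0 ≤ x) (hxX : x ≤ X) :
    phi a x ≤ (1 + a) * X ^ a * phiZero x := by
  have hXa : 1 ≤ X ^ a := Real.one_le_rpow hX ha.le
  suffices h : 0 ≤ a * (1 + a) * X ^ a * phiZero x - (x ^ (1 + a) - 1 - (1 + a) * (x - 1)) by
    unfold phi; rw [div_le_iff₀ ha]; linarith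
  refine nonneg_of_deriv_sign
    (f := fun x => a * (1 + a) * X ^ a * phiZero x - (x ^ (1 + a) - 1 - (1 + a) * (x - 1)))
    (f' := fun x => a * (1 + a) * X ^ a * Real.log x - ((1 + a) * x ^ a - (1 + a))) hX
    ?_ (fun x hx => ?_) (by simp [phiZero]) ?_ ?_ hx hxX
  · have := continuous_phiZero
    have h2 : Continuous fun x : ℝ => x ^ (1 + a) := Real.continuous_rpow_const (by linarith)
    fun_prop
  · have h1 := Real.hasDerivAt_rpow_const (x := x) (p := 1 + a) (Or.inl hx.ne')
    rw [add_sub_cancel_left] at h1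
    have h2 := ((h1.sub_const 1).sub (((hasDerivAt_id x).sub_const 1).const_mul (1 + a)))
    exact (((hasDerivAt_phiZero hx).const_mul (a * (1 + a) * X ^ a)).sub h2).congr_deriv (by ring)
  · intro x h0 h1
    have hl : Real.log x ≤ 0 := Real.log_nonpos h0.le h1.le
    have h2 : a * Real.log x + 1 ≤ x ^ a := by
      rw [Real.rpow_def_of_pos h0, mul_comm (Real.log x)]; exact Real.add_one_le_exp _
    have h3 : a * (1 + a) * Real.log x * (X ^ a - 1) ≤ 0 :=
      mul_nonpos_of_nonpos_of_nonneg (mul_nonpos_of_nonneg_of_nonpos (by positivity) hl) (by linarith)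
    nlinarith
  · intro x h1 h2
    have h0 : 0 < x := by linarith
    have hl : 0 ≤ Real.log x := Real.log_nonneg h1.le
    have h3 : x ^ a ≤ X ^ a := Real.rpow_le_rpow h0.le h2.le ha.le
    have h4 : x ^ a - 1 ≤ a * Real.log x * x ^ a := by
      have h5 := Real.add_one_le_exp (-(a * Real.log x))
      have h6 : x ^ a = Real.exp (a * Real.log x) := by
        rw [Real.rpow_def_of_pos h0, mul_comm (Real.log x)]
      have h7 : x ^ a * Real.exp (-(a * Real.log x)) = 1 := by
        rw [h6, ← Real.exp_add]; simp
      have h8 : 0 < x ^ a := by positivity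
      nlinarith
    have h5 : a * Real.log x * x ^ a ≤ a * Real.log x * X ^ a :=
      mul_le_mul_of_nonneg_left h3 (by positivity)
    nlinarith

end ThorpShuffle

/-! ### The joint law of the number of full pairs and the number of cards in the first half. -/

namespace ThorpShuffle
open Finset

/-- Probability that `w` of the cards are in the first half, when the `b` cards occupy `j` pairs
completely and every other card goes to either endpoint of its pair with probability `1 / 2`. -/
noncomputable def condProb (b j w : ℕ) : ℝ :=
  if j ≤ w then ((b - 2 * j).choose (w - j) : ℝ) / 2 ^ (b - 2 * j) else 0

/-- Probability that a uniformly random `b`-subset of `D` pairs contains exactly `j` pairs. -/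
noncomputable def pairProb (D b j : ℕ) : ℝ :=
  (D.choose (b - j) * (b - j).choose j * 2 ^ (b - 2 * j) : ℝ) / (2 * D).choose b

/-- Probability that a uniformly random `b`-subset of two halves of size `D` has `w` elements in
the first half. -/
noncomputable def halfProb (D b w : ℕ) : ℝ :=
  (D.choose w * D.choose (b - w) : ℝ) / (2 * D).choose b

theorem condProb_nonneg (b j w : ℕ) : 0 ≤ condProb b j w := by
  unfold condProb; split_ifs <;> positivity

theorem pairProb_nonneg (D b j : ℕ) : 0 ≤ pairProb D b j := by unfold pairProb; positivity

theorem halfProb_nonneg (D b w : ℕ) : 0 ≤ halfProb D b w := by unfold halfProb; positivity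

theorem choose_two_mul_pos {D b : ℕ} (hb : b ≤ D) : (0 : ℝ) < (2 * D).choose b := by
  exact_mod_cast Nat.choose_pos (by omega)

theorem pairProb_pos {D b j : ℕ} (hb : b ≤ D) (hj : 2 * j ≤ b) : 0 < pairProb D b j := by
  have h1 : 0 < D.choose (b - j) := Nat.choose_pos (by omega)
  have h2 : 0 < (b - j).choose j := Nat.choose_pos (by omega)
  have h3 := choose_two_mul_pos hb
  unfold pairProb; positivity

theorem halfProb_pos {D b w : ℕ} (hb : b ≤ D) (hw : w ≤ b) : 0 < halfProb D b w := by
  have h1 : 0 < D.choose w := Nat.choose_pos (by omega)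
  have h2 : 0 < D.choose (b - w) := Nat.choose_pos (by omega)
  have h3 := choose_two_mul_pos hb
  unfold halfProb; positivity

theorem sum_condProb_mul {b j : ℕ} (hj : 2 * j ≤ b) (f : ℕ → ℝ) :
    ∑ w ∈ range (b + 1), condProb b j w * f w =
      ∑ i ∈ range (b - 2 * j + 1), ((b - 2 * j).choose i : ℝ) / 2 ^ (b - 2 * j) * f (j + i) := by
  symm
  refine sum_bij_ne_zero (fun i _ _ => j + i) ?_ ?_ ?_ ?_
  · intro i hi _
    rw [mem_range] at hi ⊢; omega
  · intro i _ _ i' _ _ h; omega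
  · intro w hw h
    rw [mem_range] at hw
    have hjw : j ≤ w := by
      by_contra h'
      simp [condProb, h'] at h
    have hwi : w - j ≤ b - 2 * j := by
      by_contra h'
      simp [condProb, Nat.choose_eq_zero_of_lt (not_le.1 h')] at h
    refine ⟨w - j, mem_range.2 (by omega), ?_, by omega⟩
    simpa [condProb, hjw] using h
  · intro i _ _
    simp [condProb]

theorem sum_condProb {b j : ℕ} (hj : 2 * j ≤ b) : ∑ w ∈ range (b + 1), condProb b j w = 1 := by
  have h := sum_condProb_mul hj fun _ => 1
  simp only [mul_one] at h
  rw [h, ← sum_div, div_eq_one_iff_eq (by positivity)]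
  exact_mod_cast Nat.sum_range_choose _

/-- Both sides count the ways to divide the `D` pairs into `j` full ones, `w - j` occupied only in
the first half, `b - w - j` occupied only in the second half, and empty ones. -/
theorem choose_mul_choose_mul_choose {D b w j : ℕ} (hj : j ≤ w) (hjw : j ≤ b - w) (hw : w ≤ b) :
    D.choose (b - j) * (b - j).choose j * (b - 2 * j).choose (w - j) =
      D.choose w * (w.choose j * (D - w).choose (b - w - j)) := by
  rcases le_or_gt (b - j) D with h | h
  · have h1 := Nat.choose_mul (n := D) (k := b - j) (s := w) (by omega)
    have h2 := Nat.choose_mul (n := b - j) (k := w) (s := j) hj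
    have e1 : b - j - w = b - w - j := by omega
    have e2 : b - j - j = b - 2 * j := by omega
    rw [e1] at h1
    rw [e2] at h2
    calc _ = D.choose (b - j) * ((b - j).choose j * (b - 2 * j).choose (w - j)) := by ring
      _ = D.choose (b - j) * (b - j).choose w * w.choose j := by rw [← h2]; ring
      _ = _ := by rw [h1]; ring
  · rcases le_or_gt w D with h' | h'
    · rw [Nat.choose_eq_zero_of_lt h, Nat.choose_eq_zero_of_lt (by omega : D - w < b - w - j)]
      simp
    · rw [Nat.choose_eq_zero_of_lt h, Nat.choose_eq_zero_of_lt h']; simp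

theorem pairProb_mul_condProb {D b w j : ℕ} (hj : j ≤ w) (hjw : j ≤ b - w) (hw : w ≤ b) :
    pairProb D b j * condProb b j w =
      (D.choose w * (w.choose j * (D - w).choose (b - w - j)) : ℝ) / (2 * D).choose b := by
  have h : (D.choose (b - j) * (b - j).choose j * (b - 2 * j).choose (w - j) : ℝ) =
      D.choose w * (w.choose j * (D - w).choose (b - w - j)) := by
    exact_mod_cast choose_mul_choose_mul_choose hj hjw hw
  rw [← h, pairProb, condProb, if_pos hj]
  field_simp

theorem condProb_eq_zero {b w j : ℕ} (hj : 2 * j ≤ b) (hw : w ≤ b) (h : ¬(j ≤ w ∧ j ≤ b - w)) :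
    condProb b j w = 0 := by
  unfold condProb
  split_ifs with h'
  · rw [Nat.choose_eq_zero_of_lt (by omega)]; simp
  · rfl

/-- The joint distribution of the number of full pairs and the size of the first half, tested
against a binomial coefficient of the number of full pairs. -/
theorem sum_pairProb_mul_condProb_mul_choose {D b w : ℕ} (hb : b ≤ D) (hw : w ≤ b) (k : ℕ)
    (hk : k ≤ D) :
    ∑ j ∈ range (b / 2 + 1), pairProb D b j * condProb b j w * (j.choose k : ℝ) =
      halfProb D b w * ((w.choose k * (b - w).choose k : ℝ) / D.choose k) := by
  have hDk : (D.choose k : ℝ) ≠ 0 := by exact_mod_cast (Nat.choose_pos hk).ne'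
  -- Given `w`, the number of full pairs is hypergeometric. Its binomial moments follow from `C(w,
  -- j) C(j, k) = C(w, k) C(w - k, j - k)` and Vandermonde's identity.
  have key : ∑ j ∈ range (b - w + 1), w.choose j * (D - w).choose (b - w - j) * j.choose k =
      if k ≤ b - w then w.choose k * (D - k).choose (b - w - k) else 0 := by
    split_ifs with h
    · rcases le_or_gt k w with hkw | hkw
      · have e : D - k = (w - k) + (D - w) := by omega
        rw [e, Nat.add_choose_eq, Nat.sum_antidiagonal_eq_sum_range_succ
          (fun i j => (w - k).choose i * (D - w).choose j), mul_sum]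
        rw [show b - w + 1 = k + (b - w - k + 1) by omega, sum_range_add]
        have h0 : ∑ x ∈ range k, w.choose x * (D - w).choose (b - w - x) * x.choose k = 0 :=
          sum_eq_zero fun x hx => by rw [Nat.choose_eq_zero_of_lt (mem_range.1 hx), mul_zero]
        rw [h0, zero_add]
        refine sum_congr rfl fun i _ => ?_
        have h1 := Nat.choose_mul (n := w) (k := k + i) (s := k) (by omega)
        rw [add_tsub_cancel_left] at h1
        rw [show b - w - (k + i) = b - w - k - i by omega]
        calc _ = w.choose (k + i) * (k + i).choose k * (D - w).choose (b - w - k - i) := by ring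
          _ = _ := by rw [h1]; ring
      · rw [Nat.choose_eq_zero_of_lt hkw, zero_mul]
        refine sum_eq_zero fun x _ => ?_
        rcases le_or_gt k x with hx | hx
        · rw [Nat.choose_eq_zero_of_lt (lt_of_lt_of_le hkw hx)]; simp
        · rw [Nat.choose_eq_zero_of_lt hx, mul_zero]
    · refine sum_eq_zero fun x hx => ?_
      rw [mem_range] at hx
      rw [Nat.choose_eq_zero_of_lt (by omega : x < k), mul_zero]
  have h1 : ∑ j ∈ range (b / 2 + 1), pairProb D b j * condProb b j w * (j.choose k : ℝ) =
      ∑ j ∈ range (b - w + 1), (D.choose w : ℝ) / (2 * D).choose b *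
        (w.choose j * (D - w).choose (b - w - j) * j.choose k) := by
    refine sum_bij_ne_zero (fun i _ _ => i) ?_ ?_ ?_ ?_
    · intro j hj h
      rw [mem_range] at hj ⊢
      by_contra h'
      exact h (by rw [condProb_eq_zero (by omega) hw (by omega)]; simp)
    · intro _ _ _ _ _ _ h; exact h
    · intro j hj h
      rw [mem_range] at hj
      have hjw : j ≤ w := by
        by_contra h'
        exact h (by rw [Nat.choose_eq_zero_of_lt (not_le.1 h')]; simp)
      refine ⟨j, mem_range.2 (by omega), ?_, rfl⟩
      rw [pairProb_mul_condProb hjw (by omega) hw]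
      convert h using 1; ring
    · intro j hj h
      rw [mem_range] at hj
      have hc : j ≤ w ∧ j ≤ b - w := by
        by_contra h'
        exact h (by rw [condProb_eq_zero (by omega) hw h']; simp)
      rw [pairProb_mul_condProb hc.1 hc.2 hw]; ring
  rw [h1, ← mul_sum]
  have key' : ∑ j ∈ range (b - w + 1),
      ((w.choose j : ℝ) * (D - w).choose (b - w - j) * j.choose k) =
      if k ≤ b - w then (w.choose k : ℝ) * (D - k).choose (b - w - k) else 0 := by
    exact_mod_cast key
  rw [key', halfProb]
  split_ifs with h
  · have h2 := Nat.choose_mul (n := D) (k := b - w) (s := k) h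
    have h3 : (D.choose (b - w) * (b - w).choose k : ℝ) = D.choose k * (D - k).choose (b - w - k) := by
      exact_mod_cast h2
    field_simp
    linear_combination (-(D.choose w * w.choose k : ℝ) / (2 * D).choose b) * h3
  · rw [Nat.choose_eq_zero_of_lt (not_le.1 h)]; simp

theorem sum_pairProb_mul_condProb {D b w : ℕ} (hb : b ≤ D) (hw : w ≤ b) :
    ∑ j ∈ range (b / 2 + 1), pairProb D b j * condProb b j w = halfProb D b w := by
  simpa using sum_pairProb_mul_condProb_mul_choose hb hw 0 (Nat.zero_le _)

theorem sum_halfProb {D b : ℕ} (hb : b ≤ D) : ∑ w ∈ range (b + 1), halfProb D b w = 1 := by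
  unfold halfProb
  rw [← sum_div, div_eq_one_iff_eq (choose_two_mul_pos hb).ne']
  have h := Nat.add_choose_eq D D b
  rw [← two_mul, Nat.sum_antidiagonal_eq_sum_range_succ (fun i j => D.choose i * D.choose j)] at h
  rw [h]; push_cast; rfl

theorem sum_pairProb {D b : ℕ} (hb : b ≤ D) : ∑ j ∈ range (b / 2 + 1), pairProb D b j = 1 := by
  rw [← sum_halfProb hb]
  calc _ = ∑ j ∈ range (b / 2 + 1), ∑ w ∈ range (b + 1), pairProb D b j * condProb b j w := by
        refine sum_congr rfl fun j hj => ?_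
        rw [mem_range] at hj
        rw [← mul_sum, sum_condProb (by omega), mul_one]
    _ = _ := by
        rw [sum_comm]
        exact sum_congr rfl fun w hw =>
          sum_pairProb_mul_condProb hb (by rw [mem_range] at hw; omega)

end ThorpShuffle

/-! ### Central binomial coefficients and the chi-square bound for the law of the first half. -/

namespace ThorpShuffle
open Finset

/-- The normalised central binomial coefficient. -/
noncomputable def centralProb (r : ℕ) : ℝ := r.centralBinom / 4 ^ r

theorem centralProb_pos (r : ℕ) : 0 < centralProb r := by
  have := Nat.centralBinom_pos r
  unfold centralProb; positivity

theorem centralProb_zero : centralProb 0 = 1 := by simp [centralProb]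

theorem centralProb_succ (r : ℕ) : (2 * r + 2) * centralProb (r + 1) = (2 * r + 1) * centralProb r := by
  have h : ((r + 1 : ℕ) * (r + 1).centralBinom : ℝ) = 2 * (2 * r + 1) * r.centralBinom := by
    exact_mod_cast Nat.succ_mul_centralBinom_succ r
  unfold centralProb
  push_cast at h
  rw [pow_succ]
  field_simp
  linear_combination 2 * h

theorem centralProb_succ_le (r : ℕ) : centralProb (r + 1) ≤ centralProb r := by
  have h := centralProb_succ r
  have h1 := centralProb_pos r
  have h2 := centralProb_pos (r + 1)
  have h3 : (0 : ℝ) ≤ r := by positivity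
  nlinarith

theorem centralProb_antitone : Antitone centralProb := antitone_nat_of_succ_le centralProb_succ_le

theorem centralProb_le_one (r : ℕ) : centralProb r ≤ 1 :=
  centralProb_zero ▸ centralProb_antitone (Nat.zero_le r)

theorem centralProb_le_two_mul (r : ℕ) : centralProb r ≤ 2 * centralProb (r + 1) := by
  have h := centralProb_succ r
  have h1 := centralProb_pos r
  have h2 := centralProb_pos (r + 1)
  have h3 : (0 : ℝ) ≤ r := by positivity
  nlinarith

theorem centralProb_le_two_pow_mul (r j : ℕ) : centralProb r ≤ 2 ^ j * centralProb (r + j) := by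
  induction j with
  | zero => simp
  | succ j ih =>
    have := centralProb_le_two_mul (r + j)
    have h2 : (0 : ℝ) < 2 ^ j := by positivity
    rw [pow_succ, ← add_assoc]
    nlinarith

/-- A sharp form of the decay `r ^ (-1/2)`: if the central probability at a smaller index is at
least twice that at a larger one, the indices differ by a factor of at least 4. -/
theorem centralProb_sq_mul_monotone : Monotone fun r : ℕ => centralProb r ^ 2 * r := by
  refine monotone_nat_of_le_succ fun r => ?_
  have h := centralProb_succ r
  have h1 := centralProb_pos r
  have h3 : (0 : ℝ) ≤ r := by positivity
  have h4 : centralProb (r + 1) = (2 * r + 1) / (2 * r + 2) * centralProb r := by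
    field_simp; linarith
  push_cast
  rw [h4, mul_pow, div_pow]
  have h5 : (r : ℝ) ≤ (2 * r + 1) ^ 2 / (2 * r + 2) ^ 2 * (r + 1) := by
    rw [div_mul_eq_mul_div, le_div_iff₀ (by positivity)]
    nlinarith
  nlinarith [sq_nonneg (centralProb r), mul_le_mul_of_nonneg_left h5 (sq_nonneg (centralProb r))]

theorem one_le_mul_centralProb (r : ℕ) : 1 ≤ (2 * r + 1) * centralProb r := by
  induction r with
  | zero => simp [centralProb_zero]
  | succ r ih =>
    have h := centralProb_succ r
    have h2 := centralProb_pos (r + 1)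
    push_cast
    nlinarith

/-- `(2 x + 1)` times the normalised central binomial coefficient. -/
noncomputable def growth (x : ℕ) : ℝ := (2 * x + 1) * centralProb x

theorem growth_pos (x : ℕ) : 0 < growth x := by
  have := centralProb_pos x
  unfold growth; positivity

theorem one_le_growth (x : ℕ) : 1 ≤ growth x := one_le_mul_centralProb x

theorem growth_le (x : ℕ) : growth x ≤ 2 * x + 1 := by
  have := centralProb_le_one x
  have h3 : (0 : ℝ) ≤ x := by positivity
  unfold growth; nlinarith

theorem growth_succ (x : ℕ) : (2 * x + 2) * growth (x + 1) = (2 * x + 3) * growth x := by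
  have h := centralProb_succ x
  unfold growth; push_cast
  linear_combination (2 * x + 3 : ℝ) * h

/-- `growth` increases like a square root, and `growth x ^ 2 / x` is decreasing because `(2x + 3)² x
≤ (2x + 2)² (x + 1)`. -/
theorem growth_sq_mul_le (c a : ℕ) (hc : 1 ≤ c) :
    growth (c + a) ^ 2 * c ≤ growth c ^ 2 * (c + a : ℕ) := by
  induction a with
  | zero => simp
  | succ a ih =>
    have h := growth_succ (c + a)
    have h1 := growth_pos (c + a)
    set x := c + a with hx
    have hx1 : (1 : ℝ) ≤ x := by exact_mod_cast (by omega : 1 ≤ x)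
    have hc1 : (0 : ℝ) < c := by exact_mod_cast hc
    have h4 : growth (x + 1) = (2 * x + 3) / (2 * x + 2) * growth x := by
      field_simp; linarith
    rw [← add_assoc, ← hx, h4, mul_pow, div_pow]
    have h5 : ((2 * x + 3) ^ 2 / (2 * x + 2) ^ 2 : ℝ) * x ≤ x + 1 := by
      rw [div_mul_eq_mul_div, div_le_iff₀ (by positivity)]
      nlinarith
    have h6 : ((2 * x + 3) ^ 2 / (2 * x + 2) ^ 2 : ℝ) * x * (growth x ^ 2 * c) ≤
        (x + 1) * (growth c ^ 2 * x) := by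
      apply mul_le_mul h5 ih (by positivity) (by positivity)
    push_cast
    have h7 : (0 : ℝ) < x := by linarith
    refine le_of_mul_le_mul_left ?_ h7
    linarith

theorem growth_le_two_mul {c a : ℕ} (hc : 1 ≤ c) (h : c + a ≤ 4 * c) :
    growth (c + a) ≤ 2 * growth c := by
  have h1 := growth_sq_mul_le c a hc
  have hc1 : (0 : ℝ) < c := by exact_mod_cast hc
  have h2 : ((c + a : ℕ) : ℝ) ≤ 4 * c := by exact_mod_cast h
  have h3 := growth_pos c
  have h4 : growth (c + a) ^ 2 * c ≤ (2 * growth c) ^ 2 * c := by nlinarith [sq_nonneg (growth c)]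
  exact (sq_le_sq₀ (growth_pos _).le (by positivity)).1 (le_of_mul_le_mul_right h4 hc1)

theorem growth_le_mul (c a : ℕ) : growth (c + a) ≤ (2 * (c + a : ℕ) + 1) * growth c := by
  have h1 := growth_le (c + a)
  have h2 := one_le_growth c
  nlinarith [growth_pos (c + a)]

theorem growth_eq_factorial (x : ℕ) :
    growth x = (2 * x + 1).factorial / (x.factorial ^ 2 * 4 ^ x : ℝ) := by
  have h1 : (x.centralBinom : ℝ) = (2 * x).factorial / (x.factorial * x.factorial) := by
    rw [Nat.centralBinom_eq_two_mul_choose, Nat.cast_choose ℝ (by omega)]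
    congr 3; congr 1; omega
  rw [growth, centralProb, h1, Nat.factorial_succ]
  push_cast
  field_simp

/-- The largest atom of the symmetric binomial distribution with `m` trials. -/
noncomputable def midProb (m : ℕ) : ℝ := (m.choose (m / 2) : ℝ) / 2 ^ m

theorem midProb_eq (m : ℕ) : midProb m = centralProb ((m + 1) / 2) := by
  obtain ⟨a, rfl | rfl⟩ := m.even_or_odd'
  · rw [show (2 * a + 1) / 2 = a by omega, midProb, show 2 * a / 2 = a by omega, centralProb,
      Nat.centralBinom_eq_two_mul_choose, pow_mul]
    norm_num
  · rw [show (2 * a + 1 + 1) / 2 = a + 1 by omega, midProb, show (2 * a + 1) / 2 = a by omega,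
      centralProb, Nat.centralBinom_eq_two_mul_choose]
    have h : (2 * (a + 1)).choose (a + 1) = 2 * (2 * a + 1).choose a := by
      have h1 := Nat.choose_symm_half a
      rw [show 2 * (a + 1) = (2 * a + 1) + 1 by ring, Nat.choose_succ_succ', h1]; ring
    rw [h, pow_succ, pow_mul, pow_succ]
    push_cast
    field_simp
    ring

theorem midProb_pos (m : ℕ) : 0 < midProb m := midProb_eq m ▸ centralProb_pos _

/-- Compare coefficients in the square of the power series `(1 - X)⁻¹ ^ (c + 1)`. -/
theorem sum_range_add_choose_mul (c m : ℕ) :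
    ∑ i ∈ range (m + 1), (c + i).choose c * (c + (m - i)).choose c = (2 * c + 1 + m).choose (2 * c + 1) := by
  have h1 := PowerSeries.mk_one_pow_eq_mk_choose_add ℤ c
  have h2 := PowerSeries.mk_one_pow_eq_mk_choose_add ℤ (2 * c + 1)
  have h3 : (PowerSeries.mk 1 : PowerSeries ℤ) ^ (2 * c + 1 + 1) =
      PowerSeries.mk 1 ^ (c + 1) * PowerSeries.mk 1 ^ (c + 1) := by ring
  rw [h1, h2] at h3
  have h4 := congrArg (PowerSeries.coeff m) h3
  rw [PowerSeries.coeff_mul] at h4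
  simp only [PowerSeries.coeff_mk] at h4
  rw [Nat.sum_antidiagonal_eq_sum_range_succ
    (fun i j => (((c + i).choose c : ℕ) : ℤ) * (((c + j).choose c : ℕ) : ℤ))] at h4
  exact_mod_cast h4.symm

theorem mul_le_mul_mid_of_logConcave {f : ℕ → ℝ}
    (hf : ∀ i k, i ≤ k → f i * f (k + 1) ≤ f (i + 1) * f k) {m i : ℕ} (hi : i ≤ m) :
    f i * f (m - i) ≤ f (m / 2) * f (m - m / 2) := by
  have key : ∀ t, t ≤ m / 2 → f (m / 2 - t) * f (m - (m / 2 - t)) ≤ f (m / 2) * f (m - m / 2) := by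
    intro t
    induction t with
    | zero => intro _; rfl
    | succ t ih =>
      intro ht
      refine le_trans ?_ (ih (by omega))
      have := hf (m / 2 - (t + 1)) (m - (m / 2 - t)) (by omega)
      rwa [show m - (m / 2 - t) + 1 = m - (m / 2 - (t + 1)) by omega,
        show m / 2 - (t + 1) + 1 = m / 2 - t by omega] at this
  rcases le_or_gt i (m / 2) with h | h
  · have := key (m / 2 - i) (by omega)
    rwa [show m / 2 - (m / 2 - i) = i by omega] at this
  · have := key (m / 2 - (m - i)) (by omega)
    rw [show m / 2 - (m / 2 - (m - i)) = m - i by omega, show m - (m - i) = i by omega] at this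
    linarith

/-- The ratio of consecutive terms is `1 + j z / ((i + 1) (i + 1 + j + z))`, which decreases in `i`.
-/
theorem factorial_ratio_logConcave (j z : ℕ) (i k : ℕ) (hik : i ≤ k) :
    let f : ℕ → ℝ := fun i => ((i + j).factorial * (i + z).factorial : ℝ) /
      (i.factorial * (i + (j + z)).factorial)
    f i * f (k + 1) ≤ f (i + 1) * f k := by
  intro f
  have hpos : ∀ i, 0 < f i := fun i => by positivity
  have hs : ∀ i : ℕ, f (i + 1) = f i * (1 + (j * z : ℝ) / ((i + 1) * (i + 1 + (j + z)))) := by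
    intro i
    simp only [f]
    rw [show i + 1 + j = (i + j) + 1 by ring, show i + 1 + z = (i + z) + 1 by ring,
      show i + 1 + (j + z) = (i + (j + z)) + 1 by ring]
    simp only [Nat.factorial_succ]
    push_cast
    field_simp
    ring
  rw [hs, hs]
  have h1 : (j * z : ℝ) / ((k + 1) * (k + 1 + (j + z))) ≤ (j * z : ℝ) / ((i + 1) * (i + 1 + (j + z))) := by
    have : (i : ℝ) ≤ k := by exact_mod_cast hik
    gcongr
  have := mul_le_mul_of_nonneg_left h1 (mul_pos (hpos i) (hpos k)).le
  nlinarith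

/-- The second moment of the density of `condProb b j` with respect to `halfProb D b`. -/
noncomputable def chiSq (D b j : ℕ) : ℝ :=
  ∑ w ∈ range (b + 1), condProb b j w * (condProb b j w / halfProb D b w)

theorem chiSq_nonneg (D b j : ℕ) : 0 ≤ chiSq D b j :=
  sum_nonneg fun _ _ => mul_nonneg (condProb_nonneg _ _ _)
    (div_nonneg (condProb_nonneg _ _ _) (halfProb_nonneg _ _ _))

theorem condProb_mid {b j : ℕ} (hj : 2 * j ≤ b) : condProb b j (b / 2) = midProb (b - 2 * j) := by
  rw [condProb, if_pos (by omega), midProb, show b / 2 - j = (b - 2 * j) / 2 by omega]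

/-- Fewer free cards give a more concentrated binomial law. The bound does not depend on `j`, so the
laws of `w` given `j` have a common atom. -/
theorem midProb_le_condProb_mid {b j : ℕ} (hj : 2 * j ≤ b) : midProb b ≤ condProb b j (b / 2) := by
  rw [condProb_mid hj, midProb_eq, midProb_eq]
  exact centralProb_antitone (by omega)

theorem midProb_le_halfProb_mid {D b : ℕ} (hb : b ≤ D) : midProb b ≤ halfProb D b (b / 2) := by
  rw [← sum_pairProb_mul_condProb hb (Nat.div_le_self b 2), ← one_mul (midProb b),
    ← sum_pairProb hb, sum_mul]
  refine sum_le_sum fun j hj => ?_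
  rw [mem_range] at hj
  exact mul_le_mul_of_nonneg_left (midProb_le_condProb_mid (by omega)) (pairProb_nonneg _ _ _)

theorem condProb_div_halfProb {D b j i : ℕ} (hb : b ≤ D) (hj : 2 * j ≤ b) (hi : i ≤ b - 2 * j) :
    condProb b j (j + i) / halfProb D b (j + i) =
      ((b - 2 * j).factorial * (2 * D).choose b / (2 ^ (b - 2 * j) * D.factorial ^ 2) : ℝ) *
      (((i + j).factorial * (i + (D - b + j)).factorial / i.factorial : ℝ) *
      ((b - 2 * j - i + j).factorial * (b - 2 * j - i + (D - b + j)).factorial /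
        (b - 2 * j - i).factorial)) := by
  have hN := (choose_two_mul_pos hb).ne'
  rw [condProb, if_pos (by omega), add_tsub_cancel_left, halfProb, Nat.cast_choose ℝ hi,
    Nat.cast_choose ℝ (by omega : j + i ≤ D), Nat.cast_choose ℝ (by omega : b - (j + i) ≤ D),
    show D - (j + i) = b - 2 * j - i + (D - b + j) by omega,
    show b - (j + i) = b - 2 * j - i + j by omega,
    show D - (b - 2 * j - i + j) = i + (D - b + j) by omega, add_comm j i]
  field_simp

/-- With `m = b - 2 j` and `z = D - b + j`, the density at `j + i` is a constant times `f i * f (m -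
i) * X i`. The `f` factor is largest at `i = m / 2`, by log-concavity, and there the whole density
is at most `midProb m / midProb b`. The remaining factor `X` has an explicit binomial average, which
produces the quotient of the two values of `growth`. -/
theorem chiSq_le {D b j : ℕ} (hb : b ≤ D) (hj : 2 * j ≤ b) :
    chiSq D b j ≤ midProb (b - 2 * j) / midProb b *
      (growth (D - (b - 2 * j) + (b - 2 * j) / 2) / growth (D - (b - 2 * j))) := by
  obtain ⟨m, hm⟩ : ∃ m, m = b - 2 * j := ⟨_, rfl⟩
  obtain ⟨z, hz⟩ : ∃ z, z = D - b + j := ⟨_, rfl⟩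
  have hc : D - m = j + z := by omega
  set f : ℕ → ℝ := fun i => ((i + j).factorial * (i + z).factorial : ℝ) /
      (i.factorial * (i + (j + z)).factorial) with hf
  set X : ℕ → ℝ := fun i => ((i + (j + z)).factorial * (m - i + (j + z)).factorial : ℝ) with hX
  have hXpos : ∀ i, 0 < X i := fun i => by positivity
  set C : ℝ := m.factorial * (2 * D).choose b / (2 ^ m * D.factorial ^ 2) with hC
  have hC0 : 0 ≤ C := by positivity
  have hrho : ∀ i ≤ m, condProb b j (j + i) / halfProb D b (j + i) = C * (f i * f (m - i)) * X i := by
    intro i hi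
    rw [condProb_div_halfProb hb hj (hm ▸ hi), ← hm, ← hz]
    simp only [hf, hX, hC]
    field_simp
  have ha : m / 2 ≤ m := Nat.div_le_self _ _
  have hmid : j + m / 2 = b / 2 := by omega
  have hrho_le : ∀ i ≤ m, condProb b j (j + i) / halfProb D b (j + i) ≤
      midProb m / midProb b / X (m / 2) * X i := by
    intro i hi
    have h1 : C * (f i * f (m - i)) * X i ≤ C * (f (m / 2) * f (m - m / 2)) * X i := by
      have := mul_le_mul_mid_of_logConcave (fun i k h => factorial_ratio_logConcave j z i k h) hi
      gcongr
    have h2 : C * (f (m / 2) * f (m - m / 2)) * X (m / 2) ≤ midProb m / midProb b := by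
      rw [← hrho _ ha, hmid, condProb_mid hj, ← hm]
      exact div_le_div_of_nonneg_left (midProb_pos _).le (midProb_pos _) (midProb_le_halfProb_mid hb)
    rw [hrho i hi]
    refine h1.trans (mul_le_mul_of_nonneg_right ?_ (hXpos i).le)
    rwa [le_div_iff₀ (hXpos _)]
  have hsum : ∑ i ∈ range (m + 1), (m.choose i : ℝ) / 2 ^ m * X i =
      m.factorial * (j + z).factorial ^ 2 / 2 ^ m * (2 * (j + z) + 1 + m).choose (2 * (j + z) + 1) := by
    have h := sum_range_add_choose_mul (j + z) m
    have h' : (∑ i ∈ range (m + 1), ((j + z + i).choose (j + z) * (j + z + (m - i)).choose (j + z) : ℝ)) =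
      (2 * (j + z) + 1 + m).choose (2 * (j + z) + 1) := by exact_mod_cast h
    rw [← h', mul_sum]
    refine sum_congr rfl fun i hi => ?_
    rw [mem_range] at hi
    rw [Nat.cast_choose ℝ (by omega : i ≤ m), Nat.cast_choose ℝ (by omega : j + z ≤ j + z + i),
      Nat.cast_choose ℝ (by omega : j + z ≤ j + z + (m - i)), add_tsub_cancel_left,
      add_tsub_cancel_left, add_comm (j + z) i, add_comm (j + z) (m - i)]
    simp only [hX]
    field_simp
  have hgrowth : (m.factorial * (j + z).factorial ^ 2 / 2 ^ m *
      (2 * (j + z) + 1 + m).choose (2 * (j + z) + 1) : ℝ) =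
      X (m / 2) * (growth (j + z + m / 2) / growth (j + z)) := by
    rw [growth_eq_factorial, growth_eq_factorial, Nat.cast_choose ℝ (by omega), add_tsub_cancel_left]
    simp only [hX]
    obtain ⟨a, hma | hma⟩ := m.even_or_odd'
    · rw [hma, show 2 * a / 2 = a by omega, show 2 * a - a = a by omega,
        show 2 * (j + z) + 1 + 2 * a = 2 * (j + z + a) + 1 by ring, add_comm a (j + z), pow_mul,
        pow_add 4 (j + z) a]
      field_simp
      norm_num
    · rw [hma, show (2 * a + 1) / 2 = a by omega, show 2 * a + 1 - a = a + 1 by omega,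
        show 2 * (j + z) + 1 + (2 * a + 1) = (2 * (j + z + a) + 1) + 1 by ring,
        show a + 1 + (j + z) = (j + z + a) + 1 by ring, add_comm a (j + z), pow_succ 2,
        pow_mul, pow_add 4 (j + z) a, Nat.factorial_succ (2 * (j + z + a) + 1), Nat.factorial_succ (j + z + a)]
      push_cast
      field_simp
      norm_num
      ring
  rw [← hm, hc]
  calc chiSq D b j = ∑ i ∈ range (m + 1), (m.choose i : ℝ) / 2 ^ m *
        (condProb b j (j + i) / halfProb D b (j + i)) := by
        rw [chiSq, sum_condProb_mul hj, ← hm]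
    _ ≤ ∑ i ∈ range (m + 1), (m.choose i : ℝ) / 2 ^ m * (midProb m / midProb b / X (m / 2) * X i) := by
        refine sum_le_sum fun i hi => mul_le_mul_of_nonneg_left (hrho_le i ?_) (by positivity)
        rw [mem_range] at hi; omega
    _ = midProb m / midProb b / X (m / 2) * ∑ i ∈ range (m + 1), (m.choose i : ℝ) / 2 ^ m * X i := by
        rw [mul_sum]; exact sum_congr rfl fun i _ => by ring
    _ = midProb m / midProb b * (growth (j + z + m / 2) / growth (j + z)) := by
        rw [hsum, hgrowth]
        have := (hXpos (m / 2)).ne'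
        field_simp

theorem chiSq_le_sq {D b j : ℕ} (hb : b ≤ D) (hj : 2 * j ≤ b) :
    chiSq D b j ≤ (2 * D + 1) * (D + 2) := by
  refine (chiSq_le hb hj).trans ?_
  have h1 : growth (D - (b - 2 * j) + (b - 2 * j) / 2) / growth (D - (b - 2 * j)) ≤ 2 * D + 1 := by
    rw [div_le_iff₀ (growth_pos _)]
    refine (growth_le_mul _ _).trans (mul_le_mul_of_nonneg_right ?_ (growth_pos _).le)
    have : ((D - (b - 2 * j) + (b - 2 * j) / 2 : ℕ) : ℝ) ≤ D := by exact_mod_cast (by omega)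
    linarith
  have h2 : midProb (b - 2 * j) / midProb b ≤ D + 2 := by
    rw [div_le_iff₀ (midProb_pos _), midProb_eq, midProb_eq]
    have h3 := one_le_mul_centralProb ((b + 1) / 2)
    have h4 := centralProb_le_one ((b - 2 * j + 1) / 2)
    have h5 : (2 * ((b + 1) / 2 : ℕ) + 1 : ℝ) ≤ D + 2 := by exact_mod_cast (by omega)
    nlinarith [centralProb_pos ((b + 1) / 2)]
  have h3 : 0 ≤ midProb (b - 2 * j) / midProb b := div_nonneg (midProb_pos _).le (midProb_pos _).le
  have h4 : 0 ≤ growth (D - (b - 2 * j) + (b - 2 * j) / 2) / growth (D - (b - 2 * j)) :=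
    div_nonneg (growth_pos _).le (growth_pos _).le
  rw [mul_comm]
  exact mul_le_mul h1 h2 h3 (by positivity)

/-- Here `D - m ≥ D / 4` for `m = b - 2 j`, so the argument of `growth` at most quadruples and the
quotient of its values is at most 2. -/
theorem chiSq_le_two_mul {D b j : ℕ} (hb : b ≤ D) (hj : 2 * j ≤ b) (hD : 1 ≤ D)
    (hm : 4 * (b - 2 * j) ≤ 3 * D) : chiSq D b j ≤ 2 * (midProb (b - 2 * j) / midProb b) := by
  refine (chiSq_le hb hj).trans ?_
  rw [mul_comm]
  refine mul_le_mul_of_nonneg_right ?_ (div_nonneg (midProb_pos _).le (midProb_pos _).le)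
  rw [div_le_iff₀ (growth_pos _)]
  exact growth_le_two_mul (by omega) (by omega)

end ThorpShuffle

/-! ### Tail bounds for the number of full pairs. -/

namespace ThorpShuffle
open Finset Filter

theorem pairProb_succ {D b j : ℕ} (hb : b ≤ D) (hj : 2 * (j + 1) ≤ b) :
    pairProb D b (j + 1) * (4 * (j + 1) * (D - b + j + 1)) =
      pairProb D b j * ((b - 2 * j : ℝ) * (b - 2 * j - 1)) := by
  obtain ⟨m, rfl⟩ : ∃ m, b = 2 * (j + 1) + m := ⟨b - 2 * (j + 1), by omega⟩
  obtain ⟨z, rfl⟩ : ∃ z, D = 2 * (j + 1) + m + z := ⟨D - (2 * (j + 1) + m), by omega⟩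
  have e1 : 2 * (j + 1) + m - (j + 1) = j + 1 + m := by omega
  have e2 : 2 * (j + 1) + m - j = j + 1 + m + 1 := by omega
  have e3 : 2 * (j + 1) + m - 2 * (j + 1) = m := by omega
  have e4 : 2 * (j + 1) + m - 2 * j = m + 2 := by omega
  have hN := (choose_two_mul_pos hb).ne'
  unfold pairProb
  rw [e1, e2, e3, e4, Nat.cast_choose ℝ (by omega : j + 1 + m ≤ 2 * (j + 1) + m + z),
    Nat.cast_choose ℝ (by omega : j + 1 + m + 1 ≤ 2 * (j + 1) + m + z),
    Nat.cast_choose ℝ (by omega : j + 1 ≤ j + 1 + m),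
    Nat.cast_choose ℝ (by omega : j ≤ j + 1 + m + 1),
    show 2 * (j + 1) + m + z - (j + 1 + m) = j + z + 1 by omega,
    show 2 * (j + 1) + m + z - (j + 1 + m + 1) = j + z by omega,
    show j + 1 + m - (j + 1) = m by omega, show j + 1 + m + 1 - j = m + 2 by omega,
    show j + 1 + m + 1 = (j + 1 + m) + 1 by rfl, Nat.factorial_succ (j + z),
    Nat.factorial_succ (j + 1 + m), Nat.factorial_succ j, Nat.factorial_succ (m + 1),
    Nat.factorial_succ m, pow_add 2 m 2]
  push_cast
  field_simp
  ring

theorem pairProb_le_one {D b j : ℕ} (hb : b ≤ D) (hj : 2 * j ≤ b) : pairProb D b j ≤ 1 := by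
  rw [← sum_pairProb hb]
  exact single_le_sum (f := fun j => pairProb D b j) (fun i _ => pairProb_nonneg D b i)
    (mem_range.2 (by omega))

theorem pairProb_succ_le {D b j : ℕ} (hb : b ≤ D) (hj : 2 * (j + 1) ≤ b) {r : ℝ}
    (hr : (b - 2 * j : ℝ) * (b - 2 * j - 1) ≤ r * (4 * (j + 1) * (D - b + j + 1))) :
    pairProb D b (j + 1) ≤ r * pairProb D b j := by
  have h := pairProb_succ hb hj
  have hbD : (b : ℝ) ≤ D := by exact_mod_cast hb
  have h0 : (0 : ℝ) < 4 * (j + 1) * (D - b + j + 1) := by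
    have : (0 : ℝ) < D - b + j + 1 := by
      have : (0 : ℝ) ≤ j := j.cast_nonneg
      linarith
    positivity
  have h1 := mul_le_mul_of_nonneg_left hr (pairProb_nonneg D b j)
  refine le_of_mul_le_mul_right ?_ h0
  linarith

theorem pairProb_le_pow {D b j : ℕ} (hb : 2 * b ≤ D) (hj : 2 * j ≤ b) :
    pairProb D b j ≤ ((b : ℝ) ^ 2 / (2 * D)) ^ j := by
  induction j with
  | zero => simpa using pairProb_le_one (by omega) (Nat.zero_le b)
  | succ j ih =>
    have hbD : (2 * b : ℝ) ≤ D := by exact_mod_cast hb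
    have hjb : (2 * (j + 1) : ℝ) ≤ b := by exact_mod_cast hj
    have hj0 : (0 : ℝ) ≤ j := j.cast_nonneg
    have hD : (0 : ℝ) < D := by linarith
    refine (pairProb_succ_le (by omega) hj (r := (b : ℝ) ^ 2 / (2 * D)) ?_).trans ?_
    · have h1 : (b - 2 * j : ℝ) * (b - 2 * j - 1) ≤ (b : ℝ) ^ 2 := by nlinarith
      refine h1.trans ?_
      have h2 : (2 * D : ℝ) ≤ 4 * (j + 1) * (D - b + j + 1) := by nlinarith
      calc (b : ℝ) ^ 2 = (b : ℝ) ^ 2 / (2 * D) * (2 * D) := by field_simp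
        _ ≤ _ := mul_le_mul_of_nonneg_left h2 (by positivity)
    · rw [pow_succ' _ j]
      exact mul_le_mul_of_nonneg_left (ih (by omega)) (by positivity)

/-- Beyond `j = b / 3` consecutive probabilities drop by a factor of at least 4, since there `b - 2
j ≤ j + 1`. -/
theorem pairProb_add_le {D b j k : ℕ} (hb : b ≤ D) (hj : b ≤ 3 * j) (hjk : 2 * (j + k) ≤ b) :
    pairProb D b (j + k) ≤ (1 / 4) ^ k := by
  induction k with
  | zero => simpa using pairProb_le_one hb hjk
  | succ k ih =>
    have hbD : (b : ℝ) ≤ D := by exact_mod_cast hb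
    have hjb : (2 * (j + k + 1) : ℝ) ≤ b := by exact_mod_cast hjk
    have hj3 : (b : ℝ) ≤ 3 * j := by exact_mod_cast hj
    have hk0 : (0 : ℝ) ≤ k := k.cast_nonneg
    rw [← add_assoc, pow_succ']
    refine (pairProb_succ_le hb hjk (r := 1 / 4) ?_).trans
      (mul_le_mul_of_nonneg_left (ih (by omega)) (by norm_num))
    simp only [Nat.add_eq]
    push_cast
    have h1 : (b - 2 * (j + k) : ℝ) ≤ j + k + 1 := by linarith
    have h2 : (b - 2 * (j + k) - 1 : ℝ) ≤ D - b + (j + k) + 1 := by linarith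
    have := mul_le_mul h1 h2 (by linarith) (by linarith)
    linarith

theorem pairProb_le_of_lower {D b j : ℕ} (hb : b ≤ D) (hj : 2 * j ≤ b) (hm : 4 * (b - 2 * j) < b) :
    pairProb D b j ≤ 2 ^ (2 - (b : ℝ) / 16) := by
  have h := pairProb_add_le (j := (b + 2) / 3) (k := j - (b + 2) / 3) hb (by omega) (by omega)
  rw [show (b + 2) / 3 + (j - (b + 2) / 3) = j by omega] at h
  refine h.trans ?_
  have h1 : (b : ℝ) ≤ 24 * (j - (b + 2) / 3 : ℕ) + 16 := by exact_mod_cast (by omega)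
  have hb0 : (0 : ℝ) ≤ b := b.cast_nonneg
  rw [← Real.rpow_natCast, show (1 / 4 : ℝ) = 2 ^ (-2 : ℝ) by
    rw [Real.rpow_neg (by norm_num)]; norm_num, ← Real.rpow_mul (by norm_num)]
  exact Real.rpow_le_rpow_of_exponent_le (by norm_num) (by linarith)

/-- While `b - 2 j ≥ 5 D / 8` full pairs are too few, and each step down in `j` at least halves the
probability. -/
theorem pairProb_le_mul_add {D b j k : ℕ} (hb : b ≤ D) (hj : 2 * (j + k) ≤ b)
    (hm : 5 * D ≤ 8 * (b - 2 * (j + k))) :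
    pairProb D b j ≤ (1 / 2) ^ k := by
  induction k generalizing j with
  | zero => simpa using pairProb_le_one hb hj
  | succ k ih =>
    have hbD : (b : ℝ) ≤ D := by exact_mod_cast hb
    have h5 : (5 * D : ℝ) ≤ 8 * (b - 2 * (j + (k + 1))) := by
      have h : 5 * D + 16 * (j + (k + 1)) ≤ 8 * b := by omega
      have : (5 * D + 16 * (j + (k + 1)) : ℝ) ≤ 8 * b := by exact_mod_cast h
      linarith
    have hk0 : (0 : ℝ) ≤ k := k.cast_nonneg
    have hj0 : (0 : ℝ) ≤ j := j.cast_nonneg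
    have hD0 : (0 : ℝ) ≤ D := D.cast_nonneg
    have h := pairProb_succ hb (by omega : 2 * (j + 1) ≤ b)
    have ih := ih (j := j + 1) (by omega) (by omega)
    rw [pow_succ']
    refine le_trans ?_ (mul_le_mul_of_nonneg_left ih (by norm_num))
    set m : ℝ := b - 2 * j with hm'
    have hmD : 5 * (D : ℝ) + 16 ≤ 8 * m := by linarith
    have h0 : 0 < m * (m - 1) := mul_pos (by linarith) (by linarith)
    have h1 : 4 * (j + 1) * (D - b + j + 1) ≤ 1 / 2 * (m * (m - 1)) := by
      have h2 : 4 * (j + 1) * (D - b + j + 1) ≤ (D - m + 2) ^ 2 := by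
        rw [hm']; nlinarith [sq_nonneg ((j + 1 : ℝ) - (D - b + j + 1))]
      have h3 : D - m + 2 ≤ 3 / 5 * (m - 1) := by linarith
      have h4 : 0 ≤ D - m + 2 := by linarith
      nlinarith
    have h2 := mul_le_mul_of_nonneg_left h1 (pairProb_nonneg D b (j + 1))
    refine le_of_mul_le_mul_right ?_ h0
    linarith

theorem pairProb_le_of_upper {D b j : ℕ} (hb : b ≤ D) (hj : 2 * j ≤ b) (hm : 3 * D < 4 * (b - 2 * j)) :
    pairProb D b j ≤ 2 ^ (2 - (b : ℝ) / 16) := by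
  -- Each step lowers `b - 2 j` by 2, so `D / 16` steps take it from above `3 D / 4` to no less than
  -- `5 D / 8`.
  have h := pairProb_le_mul_add (j := j) (k := D / 16) hb (by omega) (by omega)
  refine h.trans ?_
  have h1 : (b : ℝ) ≤ 16 * (D / 16 : ℕ) + 16 := by exact_mod_cast (by omega)
  rw [← Real.rpow_natCast, show (1 / 2 : ℝ) = 2 ^ (-1 : ℝ) by
    rw [Real.rpow_neg (by norm_num)]; norm_num, ← Real.rpow_mul (by norm_num)]
  exact Real.rpow_le_rpow_of_exponent_le (by norm_num) (by linarith)

/-- A large chi-square value means that `midProb (b - 2 j)` exceeds `2 * midProb b`, hence that `b -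
2 j` is less than a quarter of `b`. So exceptional `j` lie in the lower or the upper range treated
above. -/
theorem four_mul_lt_of_four_lt_chiSq {D b j : ℕ} (hb : b ≤ D) (hj : 2 * j ≤ b) (hD : 1 ≤ D)
    (h : 4 < chiSq D b j) (hm : 4 * (b - 2 * j) ≤ 3 * D) : 4 * (b - 2 * j) < b := by
  have h1 := chiSq_le_two_mul hb hj hD hm
  have h2 : 2 * midProb b < midProb (b - 2 * j) := by
    rw [← lt_div_iff₀ (midProb_pos b)]; linarith
  rw [midProb_eq, midProb_eq] at h2
  have h3 := centralProb_sq_mul_monotone (by omega : (b - 2 * j + 1) / 2 ≤ (b + 1) / 2)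
  simp only at h3
  have hp := centralProb_pos ((b + 1) / 2)
  -- The strict version is needed to absorb the rounding in `(b - 2 * j + 1) / 2`; it fails only at
  -- index zero, where `b ≠ 0` suffices.
  have h4 : 4 * ((b - 2 * j + 1) / 2) ≤ (b + 1) / 2 ∧
      ((b - 2 * j + 1) / 2 ≠ 0 → 4 * ((b - 2 * j + 1) / 2) < (b + 1) / 2) := by
    have h5 : ∀ x : ℕ, (4 * centralProb ((b + 1) / 2) ^ 2) * x ≤
        centralProb ((b - 2 * j + 1) / 2) ^ 2 * x := fun x =>
      mul_le_mul_of_nonneg_right (by nlinarith) x.cast_nonneg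
    constructor
    · have h6 := (h5 _).trans h3
      have : ((4 * ((b - 2 * j + 1) / 2) : ℕ) : ℝ) ≤ ((b + 1) / 2 : ℕ) := by
        push_cast
        refine le_of_mul_le_mul_left ?_ (pow_pos hp 2)
        linarith
      exact_mod_cast this
    · intro h0
      have h7 : (0 : ℝ) < ((b - 2 * j + 1) / 2 : ℕ) := by exact_mod_cast Nat.pos_of_ne_zero h0
      have h6 : (4 * centralProb ((b + 1) / 2) ^ 2) * ((b - 2 * j + 1) / 2 : ℕ) <
        centralProb ((b - 2 * j + 1) / 2) ^ 2 * ((b - 2 * j + 1) / 2 : ℕ) :=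
        mul_lt_mul_of_pos_right (by nlinarith) h7
      have : ((4 * ((b - 2 * j + 1) / 2) : ℕ) : ℝ) < ((b + 1) / 2 : ℕ) := by
        push_cast
        refine lt_of_mul_lt_mul_left ?_ (pow_pos hp 2).le
        linarith
      exact_mod_cast this
  have h5 : b ≠ 0 := by
    rintro rfl
    simp at h2
    linarith [hp]
  omega

theorem chiSq_le_two_pow {D b j : ℕ} (hb : 2 * b ≤ D) (hj : 2 * j ≤ b) (hD : 1 ≤ D) :
    chiSq D b j ≤ 2 ^ (j + 1) := by
  refine (chiSq_le_two_mul (by omega) hj hD (by omega)).trans ?_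
  rw [pow_succ']
  refine mul_le_mul_of_nonneg_left ?_ (by norm_num)
  rw [div_le_iff₀ (midProb_pos _), midProb_eq, midProb_eq]
  have := centralProb_le_two_pow_mul ((b - 2 * j + 1) / 2) j
  rwa [show (b - 2 * j + 1) / 2 + j = (b + 1) / 2 by omega] at this

end ThorpShuffle

/-! ### The exceptional numbers of full pairs contribute little, uniformly in the number of cards.
-/

namespace ThorpShuffle
open Finset Filter

theorem eventually_two_rpow_le :
    ∀ᶠ n : ℕ in atTop, (2 : ℝ) ^ (4 - 7 / 40 * (n : ℝ)) ≤ 1 / (100 * n) := by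
  have h := tendsto_pow_const_mul_const_pow_of_lt_one 1 (r := (2 : ℝ) ^ (-(7 / 40) : ℝ)) (by positivity)
    (Real.rpow_lt_one_of_one_lt_of_neg (by norm_num) (by norm_num))
  filter_upwards [h.eventually_le_const (show (0 : ℝ) < 1 / 1600 by norm_num), eventually_ge_atTop 1]
    with n hn h1
  have hn0 : (0 : ℝ) < n := by exact_mod_cast h1
  rw [← Real.rpow_natCast (2 ^ _), ← Real.rpow_mul (by norm_num), pow_one] at hn
  rw [sub_eq_add_neg, Real.rpow_add (by norm_num), le_div_iff₀ (by positivity),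
    show -(7 / 40 * (n : ℝ)) = -(7 / 40) * n by ring]
  norm_num at hn ⊢
  linarith

theorem eventually_sq_le_two_rpow :
    ∀ᶠ n : ℕ in atTop, 1000 * (n : ℝ) ^ 2 ≤ 2 ^ ((n : ℝ) / 8) := by
  have h := tendsto_pow_const_mul_const_pow_of_lt_one 2 (r := (2 : ℝ) ^ (-(1 / 8) : ℝ)) (by positivity)
    (Real.rpow_lt_one_of_one_lt_of_neg (by norm_num) (by norm_num))
  filter_upwards [h.eventually_le_const (show (0 : ℝ) < 1 / 1000 by norm_num)] with n hn
  rw [← Real.rpow_natCast (2 ^ _), ← Real.rpow_mul (by norm_num)] at hn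
  have h2 : (2 : ℝ) ^ (-(1 / 8) * (n : ℝ)) * 2 ^ ((n : ℝ) / 8) = 1 := by
    rw [← Real.rpow_add (by norm_num)]; ring_nf; simp
  have h3 : (0 : ℝ) < 2 ^ ((n : ℝ) / 8) := by positivity
  nlinarith [mul_le_mul_of_nonneg_right hn h3.le]

theorem two_mul_two_pow_pred {n : ℕ} (hn : 1 ≤ n) : 2 * 2 ^ (n - 1) = 2 ^ n := by
  rw [← pow_succ', Nat.sub_add_cancel hn]

/-- Few cards rarely form pairs: `j` full pairs have probability at most `2 ^ (-3 n j / 4)`, against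
a chi-square value of at most `2 ^ (j + 1)`. The worst case `j = 2` gives `2 ^ (3 - 3 n / 10)`, and
there are at most `2 ^ (n / 8 + 1)` terms. -/
theorem sum_chiSq_tail_le_of_small {n b : ℕ} (hn : 4 ≤ n) (hb : (b : ℝ) ≤ 2 ^ ((n : ℝ) / 8)) :
    ∑ j ∈ range (b / 2 + 1) with 4 < chiSq (2 ^ (n - 1)) b j,
      pairProb (2 ^ (n - 1)) b j * chiSq (2 ^ (n - 1)) b j ^ (2 * (n : ℝ) / 5 + 1) ≤
      2 ^ (4 - 7 / 40 * (n : ℝ)) := by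
  have hn4 : (4 : ℝ) ≤ n := by exact_mod_cast hn
  have hbD : 2 * b ≤ 2 ^ (n - 1) := by
    have h1 : (2 : ℝ) ^ ((n : ℝ) / 8) ≤ 2 ^ ((n - 2 : ℕ) : ℝ) :=
      Real.rpow_le_rpow_of_exponent_le (by norm_num) (by
        rw [Nat.cast_sub (by omega)]; push_cast; linarith)
    have h2 : b ≤ 2 ^ (n - 2) := by
      have := hb.trans h1
      rw [Real.rpow_natCast] at this
      exact_mod_cast this
    have h3 := two_mul_two_pow_pred (n := n - 1) (by omega)
    rw [show n - 1 - 1 = n - 2 by omega] at h3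
    omega
  have hD1 : 1 ≤ 2 ^ (n - 1) := Nat.one_le_two_pow
  have h2D : 2 * ((2 ^ (n - 1) : ℕ) : ℝ) = 2 ^ (n : ℝ) := by
    rw [Real.rpow_natCast]
    exact_mod_cast two_mul_two_pow_pred (n := n) (by omega)
  have hterm : ∀ j ∈ (range (b / 2 + 1)).filter fun j => 4 < chiSq (2 ^ (n - 1)) b j,
      pairProb (2 ^ (n - 1)) b j * chiSq (2 ^ (n - 1)) b j ^ (2 * (n : ℝ) / 5 + 1) ≤
      2 ^ (3 - 3 / 10 * (n : ℝ)) := by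
    intro j hj
    rw [mem_filter, mem_range] at hj
    have hjb : 2 * j ≤ b := by omega
    have h1 := chiSq_le_two_pow hbD hjb hD1
    -- With fewer than two full pairs the bound `2 ^ (j + 1)` does not exceed 4.
    have hj2 : 2 ≤ j := by
      by_contra h
      have : (2 : ℝ) ^ (j + 1) ≤ 2 ^ 2 := pow_le_pow_right₀ (by norm_num) (by omega)
      linarith [hj.2]
    have h2 := pairProb_le_pow hbD hjb
    have h3 : (b : ℝ) ^ 2 / (2 * (2 ^ (n - 1) : ℕ)) ≤ 2 ^ (-(3 / 4) * (n : ℝ)) := by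
      rw [h2D, div_le_iff₀ (by positivity), ← Real.rpow_add (by norm_num)]
      calc (b : ℝ) ^ 2 ≤ (2 ^ ((n : ℝ) / 8)) ^ 2 := by gcongr
        _ = 2 ^ ((n : ℝ) / 8 * 2) := by rw [← Real.rpow_natCast, ← Real.rpow_mul (by norm_num)]; norm_num
        _ ≤ _ := Real.rpow_le_rpow_of_exponent_le (by norm_num) (by linarith)
    calc _ ≤ (2 ^ (-(3 / 4) * (n : ℝ))) ^ j * ((2 ^ (j + 1) : ℝ)) ^ (2 * (n : ℝ) / 5 + 1) := by
          apply mul_le_mul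
          · exact h2.trans (pow_le_pow_left₀ (by positivity) h3 j)
          · exact Real.rpow_le_rpow (chiSq_nonneg _ _ _) h1 (by positivity)
          · exact Real.rpow_nonneg (chiSq_nonneg _ _ _) _
          · positivity
      _ = 2 ^ (-(3 / 4) * (n : ℝ) * j + (j + 1) * (2 * (n : ℝ) / 5 + 1)) := by
          rw [← Real.rpow_natCast, ← Real.rpow_mul (by norm_num), ← Real.rpow_natCast 2 (j + 1),
            ← Real.rpow_mul (by norm_num), ← Real.rpow_add (by norm_num)]
          push_cast; rfl
      _ ≤ _ := by
          have hj2' : (2 : ℝ) ≤ j := by exact_mod_cast hj2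
          refine Real.rpow_le_rpow_of_exponent_le (by norm_num) ?_
          nlinarith
  refine (sum_le_card_nsmul _ _ _ hterm).trans ?_
  rw [nsmul_eq_mul]
  have hcard : (#((range (b / 2 + 1)).filter fun j => 4 < chiSq (2 ^ (n - 1)) b j) : ℝ) ≤
      2 ^ ((n : ℝ) / 8 + 1) := by
    have h1 : #((range (b / 2 + 1)).filter fun j => 4 < chiSq (2 ^ (n - 1)) b j) ≤ b + 1 :=
      (card_filter_le _ _).trans (by rw [card_range]; omega)
    have h2 : (1 : ℝ) ≤ 2 ^ ((n : ℝ) / 8) := Real.one_le_rpow (by norm_num) (by positivity)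
    rw [Real.rpow_add (by norm_num), Real.rpow_one]
    calc _ ≤ ((b + 1 : ℕ) : ℝ) := by exact_mod_cast h1
      _ ≤ _ := by push_cast; linarith
  refine (mul_le_mul_of_nonneg_right hcard (by positivity)).trans ?_
  rw [← Real.rpow_add (by norm_num)]
  exact Real.rpow_le_rpow_of_exponent_le (by norm_num) (by linarith)

/-- Now the tail probability `2 ^ (2 - b / 16)` is doubly exponentially small in `n`, whereas the
power of the chi-square value is only the exponential of a quadratic in `n`. -/
theorem sum_chiSq_tail_le_of_large {n b : ℕ} (hn : 2 ≤ n) (hb : b ≤ 2 ^ (n - 1))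
    (hb8 : (2 : ℝ) ^ ((n : ℝ) / 8) ≤ b) (hn8 : 1000 * (n : ℝ) ^ 2 ≤ 2 ^ ((n : ℝ) / 8)) :
    ∑ j ∈ range (b / 2 + 1) with 4 < chiSq (2 ^ (n - 1)) b j,
      pairProb (2 ^ (n - 1)) b j * chiSq (2 ^ (n - 1)) b j ^ (2 * (n : ℝ) / 5 + 1) ≤
      2 ^ (4 - 7 / 40 * (n : ℝ)) := by
  have hD1 : 1 ≤ 2 ^ (n - 1) := Nat.one_le_two_pow
  have hn2 : (2 : ℝ) ≤ n := by exact_mod_cast hn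
  have h2D : 2 * ((2 ^ (n - 1) : ℕ) : ℝ) = 2 ^ (n : ℝ) := by
    rw [Real.rpow_natCast]
    exact_mod_cast two_mul_two_pow_pred (n := n) (by omega)
  have h4 : (4 : ℝ) ≤ 2 ^ (n : ℝ) := by
    calc (4 : ℝ) = 2 ^ (2 : ℝ) := by norm_num
      _ ≤ _ := Real.rpow_le_rpow_of_exponent_le (by norm_num) hn2
  have hterm : ∀ j ∈ (range (b / 2 + 1)).filter fun j => 4 < chiSq (2 ^ (n - 1)) b j,
      pairProb (2 ^ (n - 1)) b j * chiSq (2 ^ (n - 1)) b j ^ (2 * (n : ℝ) / 5 + 1) ≤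
      2 ^ (2 - (b : ℝ) / 16 + (2 * n + 1) * (2 * (n : ℝ) / 5 + 1)) := by
    intro j hj
    rw [mem_filter, mem_range] at hj
    have hjb : 2 * j ≤ b := by omega
    have h1 : pairProb (2 ^ (n - 1)) b j ≤ 2 ^ (2 - (b : ℝ) / 16) := by
      rcases le_or_gt (4 * (b - 2 * j)) (3 * 2 ^ (n - 1)) with h | h
      · exact pairProb_le_of_lower hb hjb (four_mul_lt_of_four_lt_chiSq hb hjb hD1 hj.2 h)
      · exact pairProb_le_of_upper hb hjb h
    have h2 : chiSq (2 ^ (n - 1)) b j ≤ 2 ^ (2 * n + 1 : ℝ) := by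
      refine (chiSq_le_sq hb hjb).trans ?_
      rw [h2D, Real.rpow_add (by norm_num), Real.rpow_one, two_mul (n : ℝ), Real.rpow_add (by norm_num)]
      nlinarith
    rw [Real.rpow_add (by norm_num : (0 : ℝ) < 2), Real.rpow_mul (by norm_num : (0 : ℝ) ≤ 2)]
    refine mul_le_mul h1 (Real.rpow_le_rpow (chiSq_nonneg _ _ _) h2 (by positivity))
      (Real.rpow_nonneg (chiSq_nonneg _ _ _) _) (by positivity)
  refine (sum_le_card_nsmul _ _ _ hterm).trans ?_
  rw [nsmul_eq_mul]
  have hcard : (#((range (b / 2 + 1)).filter fun j => 4 < chiSq (2 ^ (n - 1)) b j) : ℝ) ≤ 2 ^ (n : ℝ) := by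
    have h1 : #((range (b / 2 + 1)).filter fun j => 4 < chiSq (2 ^ (n - 1)) b j) ≤ 2 ^ (n - 1) + 1 :=
      (card_filter_le _ _).trans (by rw [card_range]; omega)
    have h3 : ((2 ^ (n - 1) + 1 : ℕ) : ℝ) ≤ 2 ^ (n : ℝ) := by push_cast at h2D ⊢; linarith
    exact (by exact_mod_cast h1 : (_ : ℝ) ≤ ((2 ^ (n - 1) + 1 : ℕ) : ℝ)).trans h3
  refine (mul_le_mul_of_nonneg_right hcard (by positivity)).trans ?_
  rw [← Real.rpow_add (by norm_num)]
  refine Real.rpow_le_rpow_of_exponent_le (by norm_num) ?_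
  nlinarith

theorem eventually_sum_chiSq_tail_le : ∀ᶠ n : ℕ in atTop, ∀ b ≤ 2 ^ (n - 1),
    ∑ j ∈ range (b / 2 + 1) with 4 < chiSq (2 ^ (n - 1)) b j,
      pairProb (2 ^ (n - 1)) b j * chiSq (2 ^ (n - 1)) b j ^ (2 * (n : ℝ) / 5 + 1) ≤
      1 / (100 * n) := by
  filter_upwards [eventually_two_rpow_le, eventually_sq_le_two_rpow, eventually_ge_atTop 4]
    with n h1 h2 h3 b hb
  rcases le_total (b : ℝ) (2 ^ ((n : ℝ) / 8)) with h | h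
  · exact (sum_chiSq_tail_le_of_small h3 h).trans h1
  · exact (sum_chiSq_tail_le_of_large (by omega) hb h h2).trans h1

end ThorpShuffle

/-! ### Newton expansions and binomial averages of polynomials. -/

namespace ThorpShuffle
open Finset
open scoped Matrix

theorem dotProduct_mulVec_le_of_eigenvalue_le {ι : Type*} [Fintype ι] [DecidableEq ι]
    {S : Matrix ι ι ℝ} (hS : S.IsHermitian) (y : ι → ℝ) {c : ℝ}
    (h : ∀ (u : ι → ℝ) (l : ℝ), u ≠ 0 → S *ᵥ u = l • u → l ≤ c ∨ u ⬝ᵥ y = 0) :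
    y ⬝ᵥ S *ᵥ y ≤ c * (y ⬝ᵥ y) := by
  set e := hS.eigenvectorBasis with he
  have hinner : ∀ x z : ι → ℝ, inner ℝ (WithLp.toLp 2 x) (WithLp.toLp 2 z) = x ⬝ᵥ z := by
    intro x z
    rw [EuclideanSpace.inner_eq_star_dotProduct]
    simp [dotProduct_comm]
  have h1 := e.sum_inner_mul_inner (WithLp.toLp 2 y) (WithLp.toLp 2 (S *ᵥ y))
  have h2 := e.sum_inner_mul_inner (WithLp.toLp 2 y) (WithLp.toLp 2 y)
  rw [hinner] at h1 h2
  rw [← h1, ← h2, mul_sum]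
  refine sum_le_sum fun i _ => ?_
  have hei : e i = WithLp.toLp 2 (e i).ofLp := rfl
  have hb : inner ℝ (WithLp.toLp 2 y) (e i) = (e i).ofLp ⬝ᵥ y := by
    rw [hei, hinner, dotProduct_comm]
  have hc : inner ℝ (e i) (WithLp.toLp 2 y) = (e i).ofLp ⬝ᵥ y := by rw [hei, hinner]
  have hd : inner ℝ (e i) (WithLp.toLp 2 (S *ᵥ y)) = hS.eigenvalues i * ((e i).ofLp ⬝ᵥ y) := by
    rw [hei, hinner, Matrix.dotProduct_mulVec, ← Matrix.mulVec_transpose]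
    have hT : Sᵀ = S := by rw [← Matrix.conjTranspose_eq_transpose_of_trivial]; exact hS.eq
    rw [hT, hS.mulVec_eigenvectorBasis, smul_dotProduct, smul_eq_mul]
  rw [hb, hc, hd]
  have hne : (e i).ofLp ≠ 0 := by
    intro h0
    have := e.orthonormal.ne_zero i
    exact this (by rw [hei, h0]; rfl)
  rcases h _ _ hne (hS.mulVec_eigenvectorBasis i) with h3 | h3
  · nlinarith [mul_le_mul_of_nonneg_right h3 (mul_self_nonneg ((e i).ofLp ⬝ᵥ y))]
  · rw [h3]; simp

/-- Newton's forward difference formula, with the `l`-th difference replaced by any family obeying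
the same recurrence; this generality is needed for averages whose number of trials depends on `j`.
-/
theorem eq_sum_choose_mul_of_recurrence {J : ℕ} {F : ℕ → ℕ → ℝ}
    (hF : ∀ l j, l + j + 1 ≤ J → F l (j + 1) = F l j + F (l + 1) j) (j l : ℕ) (h : l + j ≤ J) :
    F l j = ∑ i ∈ range (j + 1), (j.choose i : ℝ) * F (l + i) 0 := by
  induction j generalizing l with
  | zero => simp
  | succ j ih =>
    rw [hF l j (by omega), ih l (by omega), ih (l + 1) (by omega), sum_range_succ' _ (j + 1),
      sum_range_succ' _ j]
    have h1 : ∑ i ∈ range (j + 1), ((j + 1).choose (i + 1) : ℝ) * F (l + (i + 1)) 0 =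
        ∑ i ∈ range (j + 1), (j.choose i : ℝ) * F (l + 1 + i) 0 +
        ∑ i ∈ range (j + 1), (j.choose (i + 1) : ℝ) * F (l + (i + 1)) 0 := by
      rw [← sum_add_distrib]
      refine sum_congr rfl fun i _ => ?_
      rw [Nat.choose_succ_succ', show l + 1 + i = l + (i + 1) by ring]; push_cast; ring
    rw [h1, sum_range_succ (fun i => (j.choose (i + 1) : ℝ) * F (l + (i + 1)) 0)]
    simp
    ring

theorem sum_choose_mul_extend {J j : ℕ} (hj : j ≤ J) (a : ℕ → ℝ) :
    ∑ i ∈ range (j + 1), (j.choose i : ℝ) * a i = ∑ i ∈ range (J + 1), (j.choose i : ℝ) * a i := by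
  refine sum_subset (range_mono (by omega)) fun i _ hi => ?_
  rw [mem_range] at hi
  rw [Nat.choose_eq_zero_of_lt (by omega)]; simp

theorem exists_sum_choose (J : ℕ) (v : ℕ → ℝ) :
    ∃ c : ℕ → ℝ, ∀ j ≤ J, v j = ∑ i ∈ range (J + 1), (j.choose i : ℝ) * c i := by
  refine ⟨fun i => (fwdDiff 1)^[i] v 0, fun j hj => ?_⟩
  have h := eq_sum_choose_mul_of_recurrence (J := J) (F := fun l j => (fwdDiff 1)^[l] v j)
    (fun l j _ => by simp only [Function.iterate_succ_apply', fwdDiff]; ring) j 0 (by omega)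
  simp only [zero_add] at h
  rw [← sum_choose_mul_extend hj]
  simpa using h

theorem eq_zero_of_sum_choose_eq_zero {J : ℕ} {c : ℕ → ℝ}
    (h : ∀ j ≤ J, ∑ i ∈ range (J + 1), (j.choose i : ℝ) * c i = 0) (j : ℕ) (hj : j ≤ J) : c j = 0 := by
  induction j using Nat.strong_induction_on with
  | _ j ih =>
    have h1 := h j hj
    rw [← sum_choose_mul_extend hj, sum_range_succ, sum_eq_zero] at h1
    · simpa using h1
    · intro i hi
      rw [mem_range] at hi
      rw [ih i hi (by omega), mul_zero]

/-- Average of `p (x + i)` over a symmetric binomial variable `i` with `m` trials. -/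
noncomputable def binomAvg (m : ℕ) (p : ℝ → ℝ) (x : ℝ) : ℝ :=
  ∑ i ∈ range (m + 1), (m.choose i : ℝ) / 2 ^ m * p (x + i)

theorem binomAvg_succ (m : ℕ) (p : ℝ → ℝ) (x : ℝ) :
    binomAvg (m + 1) p x = (binomAvg m p x + binomAvg m p (x + 1)) / 2 := by
  unfold binomAvg
  rw [sum_range_succ' _ (m + 1), sum_range_succ' (fun i => (m.choose i : ℝ) / 2 ^ m * p (x + i)) m]
  have h1 : ∑ k ∈ range (m + 1), ((m + 1).choose (k + 1) : ℝ) / 2 ^ (m + 1) * p (x + (k + 1 : ℕ)) =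
      (∑ k ∈ range (m + 1), (m.choose k : ℝ) / 2 ^ m * p (x + 1 + k) +
      ∑ k ∈ range (m + 1), (m.choose (k + 1) : ℝ) / 2 ^ m * p (x + (k + 1 : ℕ))) / 2 := by
    rw [← sum_add_distrib, sum_div]
    refine sum_congr rfl fun i _ => ?_
    rw [Nat.choose_succ_succ', show x + 1 + i = x + (i + 1 : ℕ) by push_cast; ring, pow_succ]
    push_cast
    field_simp
  rw [h1, sum_range_succ (fun k => (m.choose (k + 1) : ℝ) / 2 ^ m * p (x + (k + 1 : ℕ)))]
  simp [pow_succ]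
  ring

theorem binomAvg_fwdDiff (m : ℕ) (p : ℝ → ℝ) (x : ℝ) :
    binomAvg m (fwdDiff 1 p) x = binomAvg m p (x + 1) - binomAvg m p x := by
  unfold binomAvg fwdDiff
  rw [← sum_sub_distrib]
  refine sum_congr rfl fun i _ => ?_
  rw [show x + i + 1 = x + 1 + i by ring]; ring

/-- Replacing two fair trials by their mean 1 costs a quarter of the second difference. Turning two
free cards into a full pair is exactly this replacement. -/
theorem binomAvg_sub (m : ℕ) (p : ℝ → ℝ) (x : ℝ) :
    binomAvg m p (x + 1) = binomAvg (m + 2) p x +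
      -(1 / 4) * binomAvg m ((fwdDiff 1)^[2] p) x := by
  simp only [Function.iterate_succ_apply, Function.iterate_zero, id, binomAvg_fwdDiff, binomAvg_succ]
  ring

/-- The coefficient of `C(j, l)` involves a difference of order `2 l`, so a polynomial of degree `2
k` in `w` averages to a combination of `C(j, l)` with `l ≤ k`: the channel is triangular. -/
theorem binomAvg_eq_sum_choose {b : ℕ} (p : ℝ → ℝ) {j : ℕ} (hj : j ≤ b / 2) :
    binomAvg (b - 2 * j) p j = ∑ l ∈ range (b / 2 + 1), (j.choose l : ℝ) *
      ((-(1 / 4)) ^ l * binomAvg (b - 2 * l) ((fwdDiff 1)^[2 * l] p) 0) := by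
  have h := eq_sum_choose_mul_of_recurrence (J := b / 2) (F := fun l j =>
    (-(1 / 4)) ^ l * binomAvg (b - 2 * l - 2 * j) ((fwdDiff 1)^[2 * l] p) j) ?_ j 0 (by omega)
  · simp only [zero_add, mul_zero, tsub_zero, pow_zero, one_mul, Function.iterate_zero, id,
      Nat.cast_zero] at h
    rw [h, sum_choose_mul_extend hj]
  · intro l j hlj
    have e1 : b - 2 * l - 2 * j = (b - 2 * l - 2 * (j + 1)) + 2 := by omega
    have e2 : b - 2 * (l + 1) - 2 * j = b - 2 * l - 2 * (j + 1) := by omega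
    rw [e1, e2, show 2 * (l + 1) = 2 + 2 * l by ring, Function.iterate_add_apply]
    push_cast
    rw [binomAvg_sub, pow_succ]
    ring

/-- The polynomial `w ↦ C(w, k) C(b - w, k)`. -/
noncomputable def choosePoly (b k : ℕ) : Polynomial ℝ :=
  Polynomial.C ((k.factorial : ℝ) ^ 2)⁻¹ *
    (descPochhammer ℝ k * (descPochhammer ℝ k).comp (Polynomial.C (-1) * Polynomial.X + Polynomial.C (b : ℝ)))

theorem choosePoly_eval {b k w : ℕ} (hw : w ≤ b) :
    (choosePoly b k).eval (w : ℝ) = (w.choose k * (b - w).choose k : ℝ) := by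
  have h : (-1 * (w : ℝ) + b) = ((b - w : ℕ) : ℝ) := by rw [Nat.cast_sub hw]; ring
  simp only [choosePoly, Polynomial.eval_mul, Polynomial.eval_C, Polynomial.eval_comp,
    Polynomial.eval_add, Polynomial.eval_X, h, descPochhammer_eval_eq_descFactorial,
    Nat.descFactorial_eq_factorial_mul_choose]
  push_cast
  field_simp

theorem choosePoly_natDegree (b k : ℕ) : (choosePoly b k).natDegree = 2 * k := by
  have h1 : (Polynomial.C (-1 : ℝ) * Polynomial.X + Polynomial.C (b : ℝ)).natDegree = 1 :=
    Polynomial.natDegree_linear (by norm_num)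
  have hp := monic_descPochhammer ℝ k
  have hc : (descPochhammer ℝ k).comp
      (Polynomial.C (-1) * Polynomial.X + Polynomial.C (b : ℝ)) ≠ 0 := by
    rw [← Polynomial.leadingCoeff_ne_zero, Polynomial.leadingCoeff_comp (by rw [h1]; norm_num),
      Polynomial.leadingCoeff_linear (by norm_num), hp.leadingCoeff]
    positivity
  rw [choosePoly, Polynomial.natDegree_C_mul (by positivity), Polynomial.natDegree_mul hp.ne_zero hc,
    Polynomial.natDegree_comp, h1, descPochhammer_natDegree]
  ring

theorem choosePoly_leadingCoeff (b k : ℕ) :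
    (choosePoly b k).leadingCoeff = (-1) ^ k / (k.factorial : ℝ) ^ 2 := by
  have h1 : (Polynomial.C (-1 : ℝ) * Polynomial.X + Polynomial.C (b : ℝ)).natDegree = 1 :=
    Polynomial.natDegree_linear (by norm_num)
  have hp := monic_descPochhammer ℝ k
  rw [choosePoly, Polynomial.leadingCoeff_mul, Polynomial.leadingCoeff_mul, Polynomial.leadingCoeff_C,
    Polynomial.leadingCoeff_comp (by rw [h1]; norm_num), Polynomial.leadingCoeff_linear (by norm_num),
    hp.leadingCoeff, descPochhammer_natDegree]
  ring

theorem binomAvg_const (m : ℕ) (c x : ℝ) : binomAvg m (fun _ => c) x = c := by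
  unfold binomAvg
  rw [← sum_mul, ← sum_div]
  have h : (∑ i ∈ range (m + 1), (m.choose i : ℝ)) = 2 ^ m := by
    exact_mod_cast Nat.sum_range_choose m
  rw [h, div_self (by positivity), one_mul]

/-- The difference of order `2 k` of a polynomial of that degree is `(2 k)!` times the leading
coefficient `(-1) ^ k / k!²`. This gives the diagonal entries. -/
theorem binomAvg_choosePoly_top (b k m : ℕ) :
    (-(1 / 4)) ^ k * binomAvg m ((fwdDiff 1)^[2 * k] (choosePoly b k).eval) 0 = centralProb k := by
  have h := Polynomial.fwdDiff_iter_degree_eq_factorial (choosePoly b k)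
  rw [choosePoly_natDegree, choosePoly_leadingCoeff] at h
  rw [h]
  have h2 : (((-1) ^ k / (k.factorial : ℝ) ^ 2) • ((2 * k).factorial : ℝ → ℝ)) =
      fun _ => (-1) ^ k / (k.factorial : ℝ) ^ 2 * (2 * k).factorial := rfl
  rw [h2, binomAvg_const, centralProb, Nat.centralBinom_eq_two_mul_choose,
    Nat.cast_choose ℝ (by omega : k ≤ 2 * k), show 2 * k - k = k by omega]
  rw [show (-(1 / 4) : ℝ) ^ k = (-1) ^ k / 4 ^ k by rw [← div_pow]; norm_num]
  have h3 : ((-1 : ℝ) ^ k) * (-1) ^ k = 1 := by rw [← mul_pow]; norm_num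
  field_simp
  linear_combination h3

theorem binomAvg_choosePoly_eq_zero {b k l : ℕ} (h : k < l) (m : ℕ) :
    binomAvg m ((fwdDiff 1)^[2 * l] (choosePoly b k).eval) 0 = 0 := by
  rw [Polynomial.fwdDiff_iter_eq_zero_of_degree_lt (by rw [choosePoly_natDegree]; omega)]
  exact binomAvg_const m 0 0

end ThorpShuffle

/-! ### The spectral gap of the channel between full pairs and the first half. -/

namespace ThorpShuffle
open Finset
open scoped Matrix

/-- Conditional average, given the size `w` of the first half, of a function of the number of full
pairs. -/
noncomputable def halfAvg (D b : ℕ) (g : ℕ → ℝ) (w : ℕ) : ℝ :=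
  (∑ j ∈ range (b / 2 + 1), pairProb D b j * condProb b j w * g j) / halfProb D b w

/-- Average over `condProb b j` of `halfAvg D b g`. -/
noncomputable def pairAvg (D b : ℕ) (g : ℕ → ℝ) (j : ℕ) : ℝ :=
  ∑ w ∈ range (b + 1), condProb b j w * halfAvg D b g w

theorem halfAvg_choose {D b w : ℕ} (hb : b ≤ D) (hw : w ≤ b) {k : ℕ} (hk : k ≤ D) :
    halfAvg D b (fun j => (j.choose k : ℝ)) w = (w.choose k * (b - w).choose k : ℝ) / D.choose k := by
  rw [halfAvg, sum_pairProb_mul_condProb_mul_choose hb hw k hk,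
    mul_div_cancel_left₀ _ (halfProb_pos hb hw).ne']

theorem pairAvg_choose {D b j : ℕ} (hb : b ≤ D) (hj : j ≤ b / 2) {k : ℕ} (hk : k ≤ D) :
    pairAvg D b (fun j => (j.choose k : ℝ)) j = ∑ l ∈ range (b / 2 + 1), (j.choose l : ℝ) *
      (((-(1 / 4)) ^ l * binomAvg (b - 2 * l) ((fwdDiff 1)^[2 * l] (choosePoly b k).eval) 0) /
        D.choose k) := by
  have h1 : pairAvg D b (fun j => (j.choose k : ℝ)) j =
      binomAvg (b - 2 * j) (choosePoly b k).eval j / D.choose k := by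
    have h := sum_condProb_mul (b := b) (j := j) (by omega) (fun w => (choosePoly b k).eval (w : ℝ))
    rw [binomAvg]
    simp only [Nat.cast_add] at h
    rw [← h, pairAvg, sum_div]
    refine sum_congr rfl fun w hw => ?_
    rw [mem_range] at hw
    rw [halfAvg_choose hb (by omega) hk, choosePoly_eval (by omega)]; ring
  rw [h1, binomAvg_eq_sum_choose _ hj, sum_div]
  exact sum_congr rfl fun l _ => by ring

theorem pairAvg_sum {D b : ℕ} {ι : Type*} (s : Finset ι) (c : ι → ℝ) (f : ι → ℕ → ℝ) (j : ℕ) :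
    pairAvg D b (fun j => ∑ i ∈ s, f i j * c i) j = ∑ i ∈ s, pairAvg D b (f i) j * c i := by
  simp only [pairAvg, halfAvg, mul_sum, sum_mul, sum_div]
  refine Eq.trans (sum_congr rfl fun w _ => ?_) sum_comm
  refine Eq.trans ?_ sum_comm
  exact sum_congr rfl fun _ _ => sum_congr rfl fun _ _ => by ring

theorem pairAvg_congr {D b : ℕ} {f g : ℕ → ℝ} (h : ∀ j ≤ b / 2, f j = g j) (j : ℕ) :
    pairAvg D b f j = pairAvg D b g j := by
  unfold pairAvg halfAvg
  refine sum_congr rfl fun w _ => ?_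
  congr 2
  exact sum_congr rfl fun i hi => by rw [mem_range] at hi; rw [h i (by omega)]

/-- In the basis `C(j, k)` the operator is triangular with diagonal `centralProb k / C(D, k)`. The
highest nonzero coefficient of an eigenvector determines its eigenvalue: either it is the constant
one, or `1 ≤ k ≤ D / 2` and `C(D, k) ≥ D`. -/
theorem pairAvg_eigenvalue {D b : ℕ} (hb : b ≤ D) {v : ℕ → ℝ} {l : ℝ}
    (hv : ∃ j ≤ b / 2, v j ≠ 0) (h : ∀ j ≤ b / 2, pairAvg D b v j = l * v j) :
    l ≤ 1 / D ∨ ∀ j ≤ b / 2, v j = v 0 := by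
  obtain ⟨c, hc⟩ := exists_sum_choose (b / 2) v
  set d : ℕ → ℕ → ℝ := fun k i =>
    (-(1 / 4)) ^ i * binomAvg (b - 2 * i) ((fwdDiff 1)^[2 * i] (choosePoly b k).eval) 0 / D.choose k
    with hd
  have hM : ∀ j ≤ b / 2, pairAvg D b v j =
      ∑ i ∈ range (b / 2 + 1), (j.choose i : ℝ) * ∑ k ∈ range (b / 2 + 1), d k i * c k := by
    intro j hj
    rw [pairAvg_congr hc, pairAvg_sum (range (b / 2 + 1)) c (fun k j => (j.choose k : ℝ))]
    calc _ = ∑ k ∈ range (b / 2 + 1), ∑ i ∈ range (b / 2 + 1), (j.choose i : ℝ) * d k i * c k := by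
          refine sum_congr rfl fun k hk => ?_
          rw [mem_range] at hk
          rw [pairAvg_choose hb hj (by omega), sum_mul]
      _ = _ := by
          rw [sum_comm]
          exact sum_congr rfl fun i _ => by rw [mul_sum]; exact sum_congr rfl fun k _ => by ring
  have hcoef := eq_zero_of_sum_choose_eq_zero (J := b / 2)
    (c := fun i => ∑ k ∈ range (b / 2 + 1), d k i * c k - l * c i) fun j hj => by
      simp only [mul_sub, sum_sub_distrib]
      rw [← hM j hj, h j hj, hc j hj, mul_sum, sub_eq_zero]
      exact sum_congr rfl fun i _ => by ring
  have hex : ∃ k ∈ range (b / 2 + 1), c k ≠ 0 := by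
    by_contra! h0
    obtain ⟨j, hj, hvj⟩ := hv
    exact hvj (by rw [hc j hj]; exact sum_eq_zero fun i hi => by rw [h0 i hi, mul_zero])
  obtain ⟨k, hk, hkmax⟩ := ((range (b / 2 + 1)).filter fun k => c k ≠ 0).exists_max_image id
    (by obtain ⟨k, hk⟩ := hex; exact ⟨k, by simpa using hk⟩)
  rw [mem_filter, mem_range] at hk
  have htop : ∀ i ∈ range (b / 2 + 1), k < i → c i = 0 := by
    intro i hi hki
    by_contra hci
    have := hkmax i (mem_filter.2 ⟨hi, hci⟩)
    simp only [id] at this; omega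
  rcases Nat.eq_zero_or_pos k with rfl | hk0
  · right
    intro j hj
    rw [hc j hj, hc 0 (Nat.zero_le _)]
    refine sum_congr rfl fun i hi => ?_
    rcases Nat.eq_zero_or_pos i with rfl | hi0
    · simp
    · rw [htop i hi hi0]; simp
  · left
    have h1 := hcoef k (by omega)
    rw [sum_eq_single k] at h1
    · have h2 : d k k = centralProb k / D.choose k := by
        simp only [hd]; rw [binomAvg_choosePoly_top]
      have h3 : l = d k k := by
        have : (d k k - l) * c k = 0 := by linarith
        rcases mul_eq_zero.1 this with h | h
        · linarith
        · exact absurd h hk.2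
      have hDk : (D : ℝ) ≤ D.choose k := by
        have : D.choose 1 ≤ D.choose k := by
          have hmono : ∀ i, 1 ≤ i → i ≤ k → D.choose 1 ≤ D.choose i := by
            intro i hi
            induction i, hi using Nat.le_induction with
            | base => intro _; exact le_rfl
            | succ i hi ih =>
              intro hik
              exact (ih (by omega)).trans (Nat.choose_le_succ_of_lt_half_left (by omega))
          exact hmono k hk0 le_rfl
        rw [Nat.choose_one_right] at this
        exact_mod_cast this
      have hD0 : (0 : ℝ) < D := by exact_mod_cast (by omega : 0 < D)
      rw [h3, h2]
      exact div_le_div₀ zero_le_one (centralProb_le_one k) hD0 hDk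
    · intro i hi hik
      rcases lt_or_gt_of_ne hik with h' | h'
      · simp only [hd]; rw [binomAvg_choosePoly_eq_zero h']; simp
      · rw [htop i hi h', mul_zero]
    · intro h'; exact absurd (mem_range.2 hk.1) h'

/-- Conjugation by the square root of `pairProb` makes the operator symmetric, and the left side is
its quadratic form. A function of mean zero is orthogonal to the constants, so only eigenvalues up
to `1 / D` contribute. -/
theorem sum_halfProb_mul_halfAvg_sq_le {D b : ℕ} (hb : b ≤ D) {g : ℕ → ℝ}
    (hg : ∑ j ∈ range (b / 2 + 1), pairProb D b j * g j = 0) :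
    ∑ w ∈ range (b + 1), halfProb D b w * halfAvg D b g w ^ 2 ≤
      1 / D * ∑ j ∈ range (b / 2 + 1), pairProb D b j * g j ^ 2 := by
  set r : ℕ → ℝ := fun j => Real.sqrt (pairProb D b j) with hr
  have hr2 : ∀ j, r j * r j = pairProb D b j := fun j => Real.mul_self_sqrt (pairProb_nonneg _ _ _)
  have hrpos : ∀ j ≤ b / 2, 0 < r j := fun j hj => Real.sqrt_pos.2 (pairProb_pos hb (by omega))
  set S : Matrix (Fin (b / 2 + 1)) (Fin (b / 2 + 1)) ℝ := fun i l =>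
    ∑ w ∈ range (b + 1), r i * r l * (condProb b i w * condProb b l w / halfProb D b w) with hS
  have hSH : S.IsHermitian := by
    refine Matrix.IsHermitian.ext fun i l => ?_
    simp only [hS, star_trivial]
    exact sum_congr rfl fun w _ => by ring
  have hSmul : ∀ (f : ℕ → ℝ) (i : Fin (b / 2 + 1)),
      (S *ᵥ fun l => r l * f l) i = r i * pairAvg D b f i := by
    intro f i
    simp only [Matrix.mulVec, dotProduct, hS, pairAvg, halfAvg, mul_sum, sum_mul, sum_div]
    rw [sum_comm]
    refine sum_congr rfl fun w _ => ?_
    rw [sum_range]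
    refine sum_congr rfl fun l _ => ?_
    rw [← hr2 l]; ring
  have key := dotProduct_mulVec_le_of_eigenvalue_le hSH (fun l => r l * g l) (c := 1 / D) ?_
  · have e1 : (fun l : Fin (b / 2 + 1) => r l * g l) ⬝ᵥ (fun l : Fin (b / 2 + 1) => r l * g l) =
        ∑ j ∈ range (b / 2 + 1), pairProb D b j * g j ^ 2 := by
      rw [sum_range]
      exact sum_congr rfl fun l _ => by rw [← hr2 l]; ring
    have e2 : (fun l : Fin (b / 2 + 1) => r l * g l) ⬝ᵥ S *ᵥ (fun l : Fin (b / 2 + 1) => r l * g l) =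
        ∑ w ∈ range (b + 1), halfProb D b w * halfAvg D b g w ^ 2 := by
      have : S *ᵥ (fun l : Fin (b / 2 + 1) => r l * g l) =
          fun i : Fin (b / 2 + 1) => r i * pairAvg D b g i :=
        funext fun i => hSmul g i
      rw [this]
      simp only [dotProduct]
      rw [← sum_range (fun j => r j * g j * (r j * pairAvg D b g j))]
      simp only [pairAvg, mul_sum]
      rw [sum_comm]
      refine sum_congr rfl fun w hw => ?_
      rw [mem_range] at hw
      have h1 : halfProb D b w * halfAvg D b g w =
          ∑ j ∈ range (b / 2 + 1), pairProb D b j * condProb b j w * g j := by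
        rw [halfAvg, mul_div_cancel₀ _ (halfProb_pos hb (by omega)).ne']
      rw [sq, ← mul_assoc, h1, sum_mul]
      exact sum_congr rfl fun j _ => by rw [← hr2 j]; ring
    rw [← e1, ← e2]; exact key
  · intro u l hu hul
    obtain ⟨v, hv⟩ : ∃ v : ℕ → ℝ, v = fun j => if h : j < b / 2 + 1 then u ⟨j, h⟩ / r j else 0 :=
      ⟨_, rfl⟩
    have huv : u = fun i : Fin (b / 2 + 1) => r i * v i := by
      funext i
      have := (hrpos i (by omega)).ne'
      simp only [hv, i.2, dif_pos]
      field_simp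
    have hex : ∃ j ≤ b / 2, v j ≠ 0 := by
      by_contra! h0
      refine hu ?_
      rw [huv]; funext i; simp [h0 i (by omega)]
    clear hv
    have heig : ∀ j ≤ b / 2, pairAvg D b v j = l * v j := by
      intro j hj
      have h1 := congrFun hul ⟨j, by omega⟩
      rw [huv, hSmul v] at h1
      simp only [Pi.smul_apply, smul_eq_mul] at h1
      refine mul_left_cancel₀ (hrpos j hj).ne' ?_
      linarith
    rcases pairAvg_eigenvalue hb hex heig with h | h
    · exact Or.inl h
    · right
      have : u ⬝ᵥ (fun l : Fin (b / 2 + 1) => r l * g l) =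
          v 0 * ∑ j ∈ range (b / 2 + 1), pairProb D b j * g j := by
        rw [sum_range, mul_sum, huv]
        refine sum_congr rfl fun i _ => ?_
        change r i * v i * (r i * g i) = _
        rw [h i (by omega), ← hr2 i]; ring
      rw [this, hg, mul_zero]

end ThorpShuffle

/-! ### Consequences of convexity: the common atom and the chi-square cost. -/

namespace ThorpShuffle
open Finset

theorem map_sum_mul_add_mul_le {ι : Type*} {φ : ℝ → ℝ} (hφ : ConvexOn ℝ (Set.Ici 0) φ)
    (s : Finset ι) {w x : ι → ℝ} {r y : ℝ} (hw : ∀ i ∈ s, 0 ≤ w i) (hx : ∀ i ∈ s, 0 ≤ x i)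
    (hr : 0 ≤ r) (hy : 0 ≤ y) (hsum : ∑ i ∈ s, w i + r = 1) :
    φ (∑ i ∈ s, w i * x i + r * y) ≤ ∑ i ∈ s, w i * φ (x i) + r * φ y := by
  have h := hφ.map_sum_le (t := insertNone s) (w := fun o => o.elim r w)
    (p := fun o => o.elim y x) ?_ ?_ ?_
  · simp only [sum_insertNone, Option.elim, smul_eq_mul] at h
    rw [add_comm, add_comm (∑ i ∈ s, w i * φ (x i))]; exact h
  · intro o ho
    cases o with
    | none => exact hr
    | some i => exact hw i (by simpa using ho)
  · simp only [sum_insertNone, Option.elim]; linarith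
  · intro o ho
    cases o with
    | none => exact hy
    | some i => exact hx i (by simpa using ho)

/-- Split off the atom of mass `midProb b` at `w = b / 2` from every law of `w` given `j`. On that
part `h` is replaced by its mean 1, where `phi` vanishes; Jensen's inequality handles the rest. -/
theorem sum_halfProb_mul_phi_halfAvg_le {D b : ℕ} (hb : b ≤ D) {a : ℝ} (ha : 0 < a)
    {h : ℕ → ℝ} (h0 : ∀ j, 0 ≤ h j)
    (h1 : ∑ j ∈ range (b / 2 + 1), pairProb D b j * h j = 1) :
    ∑ w ∈ range (b + 1), halfProb D b w * phi a (halfAvg D b h w) ≤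
      (1 - midProb b) * ∑ j ∈ range (b / 2 + 1), pairProb D b j * phi a (h j) := by
  have hphi1 : phi a 1 = 0 := phi_one a
  have key : ∀ w ∈ range (b + 1), halfProb D b w * phi a (halfAvg D b h w) ≤
      ∑ j ∈ range (b / 2 + 1),
        pairProb D b j * (condProb b j w - if w = b / 2 then midProb b else 0) * phi a (h j) := by
    intro w hw
    rw [mem_range] at hw
    have hν := halfProb_pos hb (show w ≤ b by omega)
    set β : ℝ := if w = b / 2 then midProb b else 0 with hβ
    have hβ0 : 0 ≤ β := by
      rw [hβ]; split_ifs
      · exact (midProb_pos b).le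
      · exact le_rfl
    have hβq : ∀ j ∈ range (b / 2 + 1), β ≤ condProb b j w := by
      intro j hj
      rw [mem_range] at hj
      rw [hβ]; split_ifs with hwb
      · rw [hwb]; exact midProb_le_condProb_mid (by omega)
      · exact condProb_nonneg _ _ _
    have hs : ∑ j ∈ range (b / 2 + 1), pairProb D b j * (condProb b j w - β) =
        halfProb D b w - β := by
      simp only [mul_sub, sum_sub_distrib, ← sum_mul]
      rw [sum_pairProb_mul_condProb hb (by omega), sum_pairProb hb, one_mul]
    have hj := map_sum_mul_add_mul_le (convexOn_phi ha) (range (b / 2 + 1))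
      (w := fun j => pairProb D b j * (condProb b j w - β) / halfProb D b w) (x := h)
      (r := β / halfProb D b w) (y := 1)
      (fun j hj => div_nonneg (mul_nonneg (pairProb_nonneg _ _ _)
        (sub_nonneg.2 (hβq j hj))) hν.le) (fun j _ => h0 j) (div_nonneg hβ0 hν.le) zero_le_one
      (by rw [← sum_div, hs, ← add_div, sub_add_cancel, div_self hν.ne'])
    have hG : ∑ j ∈ range (b / 2 + 1),
        pairProb D b j * (condProb b j w - β) / halfProb D b w * h j + β / halfProb D b w * 1 =
        halfAvg D b h w := by
      have e : β / halfProb D b w * 1 =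
          ∑ j ∈ range (b / 2 + 1), β / halfProb D b w * (pairProb D b j * h j) := by
        rw [← mul_sum, h1]
      rw [e, ← sum_add_distrib, halfAvg, sum_div]
      exact sum_congr rfl fun j _ => by ring
    rw [hG, hphi1, mul_zero, add_zero] at hj
    refine (mul_le_mul_of_nonneg_left hj hν.le).trans_eq ?_
    rw [mul_sum]
    exact sum_congr rfl fun j _ => by field_simp
  refine (sum_le_sum key).trans_eq ?_
  rw [sum_comm, mul_sum]
  refine sum_congr rfl fun j hj => ?_
  rw [mem_range] at hj
  rw [← sum_mul, ← mul_sum, sum_sub_distrib, sum_condProb (by omega), sum_ite_eq' (range (b + 1)),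
    if_pos (by rw [mem_range]; omega)]
  ring

/-- By concavity of `x ^ a` the mean of the `a`-th power of the density is at most the `a`-th power
of its mean, which is `chiSq`. -/
theorem sum_halfProb_mul_phi_div_le {D b j : ℕ} (hb : b ≤ D) (hj : 2 * j ≤ b) {a : ℝ} (ha : 0 < a)
    (ha1 : a ≤ 1) :
    ∑ w ∈ range (b + 1), halfProb D b w * phi a (condProb b j w / halfProb D b w) ≤
      (chiSq D b j ^ a - 1) / a := by
  rw [le_div_iff₀' ha, mul_sum]
  have hν : ∀ w ∈ range (b + 1), 0 < halfProb D b w := fun w hw =>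
    halfProb_pos hb (by rw [mem_range] at hw; omega)
  have e : ∀ w ∈ range (b + 1), a * (halfProb D b w * phi a (condProb b j w / halfProb D b w)) =
      condProb b j w * (condProb b j w / halfProb D b w) ^ a +
        (a * halfProb D b w - (1 + a) * condProb b j w) := by
    intro w hw
    have h1 : a * (halfProb D b w * phi a (condProb b j w / halfProb D b w)) =
      halfProb D b w * (a * phi a (condProb b j w / halfProb D b w)) := by ring
    have h0 := condProb_nonneg b j w
    have hp := hν w hw
    rw [h1, phi_eq ha, Real.rpow_add_of_nonneg (by positivity) zero_le_one ha.le, Real.rpow_one]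
    field_simp
    ring
  rw [sum_congr rfl e, sum_add_distrib, sum_sub_distrib, ← mul_sum, ← mul_sum, sum_halfProb hb,
    sum_condProb hj]
  have := (Real.concaveOn_rpow ha.le ha1).le_map_sum (t := range (b + 1)) (w := condProb b j)
    (p := fun w => condProb b j w / halfProb D b w) (fun w _ => condProb_nonneg _ _ _)
    (sum_condProb hj) (fun w hw => div_nonneg (condProb_nonneg _ _ _) (hν w hw).le)
  simp only [smul_eq_mul] at this
  rw [chiSq]
  linarith

/-- The average over `halfProb` of the square of `halfAvg`, bounded by means of `chiSq`. -/
theorem sum_halfProb_mul_halfAvg_sq_le_mul {D b : ℕ} (hb : b ≤ D) {g : ℕ → ℝ} (hg : ∀ j, 0 ≤ g j) :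
    ∑ w ∈ range (b + 1), halfProb D b w * halfAvg D b g w ^ 2 ≤
      (∑ j ∈ range (b / 2 + 1), pairProb D b j * g j) *
        ∑ j ∈ range (b / 2 + 1), pairProb D b j * g j * chiSq D b j := by
  have hν : ∀ w ∈ range (b + 1), 0 < halfProb D b w := fun w hw =>
    halfProb_pos hb (by rw [mem_range] at hw; omega)
  have key : ∀ w ∈ range (b + 1), halfProb D b w * halfAvg D b g w ^ 2 ≤
      (∑ j ∈ range (b / 2 + 1), pairProb D b j * g j) * ∑ j ∈ range (b / 2 + 1),
        pairProb D b j * g j * (condProb b j w * (condProb b j w / halfProb D b w)) := by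
    intro w hw
    have hp := hν w hw
    have cs := sum_sq_le_sum_mul_sum_of_sq_le_mul (range (b / 2 + 1))
      (r := fun j => pairProb D b j * condProb b j w * g j) (f := fun j => pairProb D b j * g j)
      (g := fun j => pairProb D b j * g j * condProb b j w ^ 2)
      (fun j _ => mul_nonneg (pairProb_nonneg _ _ _) (hg j))
      (fun j _ => mul_nonneg (mul_nonneg (pairProb_nonneg _ _ _) (hg j)) (sq_nonneg _))
      (fun j _ => le_of_eq (by ring))
    have e1 : halfProb D b w * halfAvg D b g w ^ 2 =
        (∑ j ∈ range (b / 2 + 1), pairProb D b j * condProb b j w * g j) ^ 2 / halfProb D b w := by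
      rw [halfAvg]; field_simp
    rw [e1, div_le_iff₀ hp]
    refine cs.trans_eq ?_
    rw [mul_assoc]
    refine congrArg (_ * ·) ?_
    rw [sum_mul]
    refine sum_congr rfl fun j _ => ?_
    field_simp
  refine (sum_le_sum key).trans_eq ?_
  rw [← mul_sum, sum_comm]
  simp only [← mul_sum, chiSq, mul_assoc]

end ThorpShuffle

/-! ### Splitting the test function into parts of different size. -/

namespace ThorpShuffle
open Finset

theorem halfAvg_add (D b : ℕ) (f g : ℕ → ℝ) (w : ℕ) :
    halfAvg D b (fun j => f j + g j) w = halfAvg D b f w + halfAvg D b g w := by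
  simp only [halfAvg, ← add_div, ← sum_add_distrib, mul_add]

theorem halfAvg_sub_const {D b w : ℕ} (hb : b ≤ D) (hw : w ≤ b) (f : ℕ → ℝ) (c : ℝ) :
    halfAvg D b (fun j => f j - c) w = halfAvg D b f w - c := by
  have := (halfProb_pos hb hw).ne'
  rw [halfAvg, halfAvg, div_eq_iff this, sub_mul, div_mul_cancel₀ _ this,
    ← sum_pairProb_mul_condProb hb hw]
  simp only [mul_sub, sum_sub_distrib, ← sum_mul]
  ring

theorem sum_halfProb_mul_halfAvg {D b : ℕ} (hb : b ≤ D) (f : ℕ → ℝ) :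
    ∑ w ∈ range (b + 1), halfProb D b w * halfAvg D b f w =
      ∑ j ∈ range (b / 2 + 1), pairProb D b j * f j := by
  have e : ∀ w ∈ range (b + 1), halfProb D b w * halfAvg D b f w =
      ∑ j ∈ range (b / 2 + 1), pairProb D b j * condProb b j w * f j := fun w hw => by
    rw [mem_range] at hw
    rw [halfAvg, mul_div_cancel₀ _ (halfProb_pos hb (by omega)).ne']
  rw [sum_congr rfl e, sum_comm]
  refine sum_congr rfl fun j hj => ?_
  rw [mem_range] at hj
  rw [← sum_mul, ← mul_sum, sum_condProb (by omega), mul_one]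

theorem halfAvg_nonneg {D b w : ℕ} {f : ℕ → ℝ} (hf : ∀ j, 0 ≤ f j) : 0 ≤ halfAvg D b f w :=
  div_nonneg (sum_nonneg fun j _ => mul_nonneg (mul_nonneg (pairProb_nonneg _ _ _)
    (condProb_nonneg _ _ _)) (hf j)) (halfProb_nonneg _ _ _)

/-- Jensen's inequality for the mixture of the normalised image of `f` (weight `1 - δ`) and the laws
of `w` given `j` (weights from `g`). Each point of `g` thus pays at most its chi-square cost. -/
theorem sum_halfProb_mul_phi_halfAvg_add_le {D b : ℕ} (hb : b ≤ D) {a : ℝ} (ha : 0 < a)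
    (ha1 : a ≤ 1) {f g : ℕ → ℝ} (hf : ∀ j, 0 ≤ f j) (hg : ∀ j, 0 ≤ g j) {δ : ℝ}
    (h1 : ∑ j ∈ range (b / 2 + 1), pairProb D b j * f j = 1 - δ)
    (h2 : ∑ j ∈ range (b / 2 + 1), pairProb D b j * g j = δ) :
    ∑ w ∈ range (b + 1), halfProb D b w * phi a (halfAvg D b (fun j => f j + g j) w) ≤
      (1 - δ) * ∑ w ∈ range (b + 1), halfProb D b w * phi a (halfAvg D b f w / (1 - δ)) +
      ∑ j ∈ range (b / 2 + 1), pairProb D b j * g j * ((chiSq D b j ^ a - 1) / a) := by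
  have hp : ∀ (u : ℕ → ℝ), (∀ j, 0 ≤ u j) → ∀ j ∈ range (b / 2 + 1), 0 ≤ pairProb D b j * u j :=
    fun u hu j _ => mul_nonneg (pairProb_nonneg _ _ _) (hu j)
  have hδ1 : 0 ≤ 1 - δ := h1 ▸ sum_nonneg (hp f hf)
  have key : ∀ w ∈ range (b + 1),
      halfProb D b w * phi a (halfAvg D b (fun j => f j + g j) w) ≤
      (1 - δ) * (halfProb D b w * phi a (halfAvg D b f w / (1 - δ))) +
      ∑ j ∈ range (b / 2 + 1), pairProb D b j * g j *
        (halfProb D b w * phi a (condProb b j w / halfProb D b w)) := by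
    intro w hw
    rw [mem_range] at hw
    have hν := halfProb_pos hb (show w ≤ b by omega)
    have hj := map_sum_mul_add_mul_le (convexOn_phi ha) (range (b / 2 + 1))
      (w := fun j => pairProb D b j * g j) (x := fun j => condProb b j w / halfProb D b w)
      (r := 1 - δ) (y := halfAvg D b f w / (1 - δ)) (hp g hg)
      (fun j _ => div_nonneg (condProb_nonneg _ _ _) hν.le) hδ1
      (div_nonneg (halfAvg_nonneg hf) hδ1) (by rw [h2]; ring)
    -- If `δ = 1` the quotient is zero by convention, and `f` vanishes on the range of the sum as
    -- well.
    have e1 : (1 - δ) * (halfAvg D b f w / (1 - δ)) = halfAvg D b f w := by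
      rcases hδ1.eq_or_lt with h0 | h0
      · have : halfAvg D b f w = 0 := by
          rw [halfAvg, sum_eq_zero, zero_div]
          intro j hj
          have := (sum_eq_zero_iff_of_nonneg (hp f hf)).1 (h1.trans h0.symm) j hj
          rw [mul_right_comm, this, zero_mul]
        rw [this]; simp
      · rw [mul_div_cancel₀ _ h0.ne']
    have e2 : ∑ j ∈ range (b / 2 + 1), pairProb D b j * g j * (condProb b j w / halfProb D b w) =
        halfAvg D b g w := by
      rw [halfAvg, sum_div]
      exact sum_congr rfl fun j _ => by ring
    rw [e1, e2, add_comm (halfAvg D b g w), ← halfAvg_add] at hj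
    refine (mul_le_mul_of_nonneg_left hj hν.le).trans_eq ?_
    rw [mul_add, mul_sum, add_comm]
    congr 1
    · ring
    · exact sum_congr rfl fun j _ => by ring
  refine (sum_le_sum key).trans ?_
  rw [sum_add_distrib, ← mul_sum, sum_comm]
  refine add_le_add le_rfl (sum_le_sum fun j hj => ?_)
  rw [← mul_sum]
  refine mul_le_mul_of_nonneg_left ?_ (hp g hg j hj)
  rw [mem_range] at hj
  exact sum_halfProb_mul_phi_div_le hb (by omega) ha ha1

/-- The divergence is at most the squared deviation, and the deviations of the two parts are
separated by `(u + v)² ≤ 2 u² + 2 v²`: the spectral gap is used for `f`, Cauchy-Schwarz with `chiSq`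
for `g`. -/
theorem mul_sum_halfProb_mul_phi_halfAvg_div_le {D b : ℕ} (hb : b ≤ D) {a : ℝ} (ha : 0 < a)
    (ha1 : a ≤ 1) {f g : ℕ → ℝ} (hf : ∀ j, 0 ≤ f j) (hg : ∀ j, 0 ≤ g j) {m r : ℝ}
    (h1 : ∑ j ∈ range (b / 2 + 1), pairProb D b j * f j = m)
    (h2 : ∑ j ∈ range (b / 2 + 1), pairProb D b j * g j = r) (hmr : 0 < m + r) :
    (m + r) * ∑ w ∈ range (b + 1), halfProb D b w *
        phi a (halfAvg D b (fun j => f j + g j) w / (m + r)) ≤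
      (m + r)⁻¹ * (2 / D * ∑ j ∈ range (b / 2 + 1), pairProb D b j * (f j - m) ^ 2 +
        2 * r * ∑ j ∈ range (b / 2 + 1), pairProb D b j * g j * chiSq D b j) := by
  set N := m + r with hN
  have key : ∀ w ∈ range (b + 1),
      halfProb D b w * phi a (halfAvg D b (fun j => f j + g j) w / N) ≤
      N⁻¹ ^ 2 * (2 * (halfProb D b w * halfAvg D b (fun j => f j - m) w ^ 2) +
        2 * (halfProb D b w * halfAvg D b g w ^ 2) +
        (2 * r ^ 2 * halfProb D b w - 4 * r * (halfProb D b w * halfAvg D b g w))) := by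
    intro w hw
    rw [mem_range] at hw
    have hν := halfProb_pos hb (show w ≤ b by omega)
    rw [halfAvg_add, halfAvg_sub_const hb (by omega)]
    have hx : 0 ≤ (halfAvg D b f w + halfAvg D b g w) / N :=
      div_nonneg (add_nonneg (halfAvg_nonneg hf) (halfAvg_nonneg hg)) hmr.le
    refine (mul_le_mul_of_nonneg_left (phi_le_sq ha ha1 hx) hν.le).trans ?_
    set x := halfAvg D b f w
    set y := halfAvg D b g w
    have e : (x + y) / N - 1 = N⁻¹ * ((x - m) + (y - r)) := by
      rw [inv_mul_eq_div, eq_div_iff hmr.ne', sub_mul, div_mul_cancel₀ _ hmr.ne', hN]; ring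
    rw [e, mul_pow, mul_left_comm]
    refine mul_le_mul_of_nonneg_left ?_ (by positivity)
    have : ((x - m) + (y - r)) ^ 2 ≤ 2 * (x - m) ^ 2 + 2 * (y - r) ^ 2 := by
      nlinarith [sq_nonneg ((x - m) - (y - r))]
    refine (mul_le_mul_of_nonneg_left this hν.le).trans_eq ?_
    ring
  refine (mul_le_mul_of_nonneg_left (sum_le_sum key) hmr.le).trans ?_
  have hm0 : ∑ j ∈ range (b / 2 + 1), pairProb D b j * (f j - m) = 0 := by
    simp only [mul_sub, sum_sub_distrib, ← sum_mul]
    rw [h1, sum_pairProb hb]; ring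
  have hX := sum_halfProb_mul_halfAvg_sq_le hb hm0
  have hY := sum_halfProb_mul_halfAvg_sq_le_mul hb hg
  rw [h2] at hY
  rw [← mul_sum]
  simp only [sum_add_distrib, sum_sub_distrib, ← mul_sum]
  rw [sum_halfProb hb, sum_halfProb_mul_halfAvg hb, h2, ← mul_assoc,
    show N * N⁻¹ ^ 2 = N⁻¹ by field_simp]
  refine mul_le_mul_of_nonneg_left ?_ (inv_nonneg.2 hmr.le)
  have e : 2 / (D : ℝ) * ∑ j ∈ range (b / 2 + 1), pairProb D b j * (f j - m) ^ 2 =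
    2 * (1 / D * ∑ j ∈ range (b / 2 + 1), pairProb D b j * (f j - m) ^ 2) := by ring
  rw [e]
  nlinarith [sq_nonneg r]

end ThorpShuffle

/-! ### The contraction inequality for a large number of pairs. -/

namespace ThorpShuffle
open Finset

theorem rpow_sub_one_div_le {R M a : ℝ} (ha : 0 < a) (hR : 0 ≤ R) (hM : 1 ≤ M) (hRM : R ≤ M) :
    (R ^ a - 1) / a ≤ M ^ a * Real.log M := by
  have hM0 : 0 < M := by linarith
  have h1 : R ^ a ≤ M ^ a := Real.rpow_le_rpow hR hRM ha.le
  have hp : 0 < M ^ a := Real.rpow_pos_of_pos hM0 a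
  have h2 := Real.one_sub_inv_le_log_of_pos hp
  rw [Real.log_rpow hM0] at h2
  rw [div_le_iff₀ ha]
  have h3 := mul_le_mul_of_nonneg_left h2 hp.le
  rw [mul_sub, mul_inv_cancel₀ hp.ne', mul_one] at h3
  nlinarith

theorem mul_log_sub_le_phiZero {x : ℝ} : x * (Real.log x - 1) ≤ phiZero x := by
  rw [phiZero]; linarith

-- Put `s = 2 n / 5`, `K = 4 ^ s` and `M j = max 4 (chiSq D b j)`, and cut `h` at the levels `K ≤ M
-- j ^ s`. Above `M j ^ s` the chi-square cost `log (M j)` is at most `log (h j) / s`, a fraction of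
-- order `1 / n` of the entropy. Below `K` the gap `1 / D` outweighs the factor `K` lost in
-- comparing variance with entropy. In between, `chiSq` exceeds 4, and the tail hypothesis applies.
set_option maxHeartbeats 800000 in
theorem sum_halfProb_mul_phi_halfAvg_le_of_large {D b n : ℕ} (hb : b ≤ D) (hn : 0 < n)
    {a : ℝ} (ha : 0 < a) (ha1 : a ≤ 1)
    (hM : ∀ j ≤ b / 2, (max 4 (chiSq D b j)) ^ a ≤ 11 / 10)
    (hL : 60 ≤ 2 * (n : ℝ) / 5 * Real.log 4)
    (hK : 8 * (4 : ℝ) ^ (2 * (n : ℝ) / 5) / D ≤ 1 / (100 * n))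
    (ht : ∑ j ∈ range (b / 2 + 1) with 4 < chiSq D b j,
      pairProb D b j * chiSq D b j ^ (2 * (n : ℝ) / 5 + 1) ≤ 1 / (100 * n))
    {h : ℕ → ℝ} (h0 : ∀ j, 0 ≤ h j)
    (h1 : ∑ j ∈ range (b / 2 + 1), pairProb D b j * h j = 1) :
    ∑ w ∈ range (b + 1), halfProb D b w * phi a (halfAvg D b h w) ≤
      3 / n * ∑ j ∈ range (b / 2 + 1), pairProb D b j * phiZero (h j) := by
  have hn' : (0 : ℝ) < n := by exact_mod_cast hn
  set s : ℝ := 2 * (n : ℝ) / 5 with hs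
  have hs0 : 0 < s := by positivity
  set K : ℝ := 4 ^ s with hKdef
  set L : ℝ := s * Real.log 4 with hLdef
  have hK1 : 1 ≤ K := Real.one_le_rpow (by norm_num) hs0.le
  have hlogK : Real.log K = L := Real.log_rpow (by norm_num) s
  set M : ℕ → ℝ := fun j => max 4 (chiSq D b j) with hMdef
  have hM4 : ∀ j, 4 ≤ M j := fun j => le_max_left _ _
  have hKM : ∀ j, K ≤ M j ^ s := fun j => Real.rpow_le_rpow (by norm_num) (hM4 j) hs0.le
  set μ := pairProb D b with hμ
  have hμ0 : ∀ j, 0 ≤ μ j := pairProb_nonneg _ _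
  set J := range (b / 2 + 1) with hJ
  set A : ℕ → Prop := fun j => M j ^ s < h j with hA
  set B : ℕ → Prop := fun j => h j ≤ M j ^ s ∧ K < h j with hB
  classical
  set hA' : ℕ → ℝ := fun j => if A j then h j else 0 with hA'd
  set hB' : ℕ → ℝ := fun j => if B j then h j else 0 with hB'd
  set hC' : ℕ → ℝ := fun j => if h j ≤ K then h j else 0 with hC'd
  have hA0 : ∀ j, 0 ≤ hA' j := fun j => by simp only [hA'd]; split_ifs <;> simp [h0]
  have hB0 : ∀ j, 0 ≤ hB' j := fun j => by simp only [hB'd]; split_ifs <;> simp [h0]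
  have hC0 : ∀ j, 0 ≤ hC' j := fun j => by simp only [hC'd]; split_ifs <;> simp [h0]
  have hABC : ∀ j, hC' j + hB' j + hA' j = h j := by
    intro j
    simp only [hA'd, hB'd, hC'd, hA, hB]
    rcases le_or_gt (h j) K with h' | h'
    · rw [if_pos h', if_neg (by rintro ⟨_, h2⟩; linarith),
        if_neg (not_lt.2 (h'.trans (hKM j)))]; ring
    · rw [if_neg h'.not_ge]
      rcases le_or_gt (h j) (M j ^ s) with h2 | h2
      · rw [if_pos ⟨h2, h'⟩, if_neg h2.not_gt]; ring
      · rw [if_neg (by rintro ⟨h3, _⟩; linarith), if_pos h2]; ring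
  have hL60 : 60 ≤ L := hL
  have hlog : ∀ j, K < h j → L ≤ Real.log (h j) := fun j hj => by
    rw [← hlogK]; exact Real.log_le_log (by linarith) hj.le
  have hφ0 : ∀ j, 0 ≤ phiZero (h j) := fun j => phiZero_nonneg (h0 j)
  -- pointwise bounds
  have pA : ∀ j ≤ b / 2, hA' j * ((chiSq D b j ^ a - 1) / a) ≤ 14 / (5 * n) * phiZero (h j) := by
    intro j hj
    simp only [hA'd]
    split_ifs with hAj
    · have hKh : K < h j := (hKM j).trans_lt hAj
      have hlg := hlog j hKh
      have h2 := rpow_sub_one_div_le ha (chiSq_nonneg D b j) (by linarith [hM4 j])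
        (le_max_right 4 (chiSq D b j))
      have hlM : s * Real.log (M j) ≤ Real.log (h j) := by
        rw [← Real.log_rpow (by linarith [hM4 j])]
        exact Real.log_le_log (Real.rpow_pos_of_pos (by linarith [hM4 j]) _) hAj.le
      have hlM0 : 0 ≤ Real.log (M j) := Real.log_nonneg (by linarith [hM4 j])
      have h3 : (chiSq D b j ^ a - 1) / a ≤ 11 / 10 * (Real.log (h j) / s) := by
        refine h2.trans (mul_le_mul (hM j hj) ?_ hlM0 (by norm_num))
        rw [le_div_iff₀ hs0]; linarith
      refine (mul_le_mul_of_nonneg_left h3 (h0 j)).trans ?_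
      -- The constant `14 / 5` is `11 / 10 * 5 / 2` times `56 / 55`; the last factor pays for
      -- replacing `log (h j)` by `log (h j) - 1`, as `log (h j) ≥ 60`.
      have h4 : h j * (11 / 10 * (Real.log (h j) / s)) =
          14 / (5 * n) * (55 / 56 * (h j * Real.log (h j))) := by
        rw [hs]; field_simp; ring
      rw [h4]
      refine mul_le_mul_of_nonneg_left ?_ (by positivity)
      refine le_trans ?_ mul_log_sub_le_phiZero
      nlinarith [h0 j]
    · rw [zero_mul]; exact mul_nonneg (by positivity) (hφ0 j)
  have pAB : ∀ j, K < h j → h j * (L - 1) ≤ phiZero (h j) := fun j hj =>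
    (mul_le_mul_of_nonneg_left (by linarith [hlog j hj]) (h0 j)).trans mul_log_sub_le_phiZero
  have pB : ∀ j, hB' j ≤ phiZero (h j) := by
    intro j
    simp only [hB'd]; split_ifs with hBj
    · have := pAB j hBj.2
      nlinarith [h0 j]
    · exact hφ0 j
  have pA' : ∀ j, hA' j * (L - 1) ≤ phiZero (h j) := by
    intro j
    simp only [hA'd]; split_ifs with hAj
    · exact pAB j ((hKM j).trans_lt hAj)
    · rw [zero_mul]; exact hφ0 j
  have pC : ∀ j, (hC' j - 1) ^ 2 ≤ 2 * K * phiZero (h j) := by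
    intro j
    simp only [hC'd]; split_ifs with hCj
    · exact sq_le_phiZero hK1 (h0 j) hCj
    · have := pAB j (not_le.1 hCj)
      have h2 : 1 ≤ phiZero (h j) := by nlinarith [not_le.1 hCj]
      nlinarith
  have pR : ∀ j, hB' j * chiSq D b j ≤
      if 4 < chiSq D b j then chiSq D b j ^ (s + 1) else 0 := by
    intro j
    simp only [hB'd]; split_ifs with hBj hRj hRj
    · have hMR : M j = chiSq D b j := max_eq_right hRj.le
      rw [Real.rpow_add (by linarith), Real.rpow_one]
      refine mul_le_mul_of_nonneg_right ?_ (by linarith)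
      rw [← hMR]; exact hBj.1
    · exfalso
      have hMR : M j = 4 := max_eq_left (not_lt.1 hRj)
      have := hBj.1
      rw [hMR] at this
      exact absurd hBj.2 (not_lt.2 this)
    · rw [zero_mul]; exact Real.rpow_nonneg (by linarith) _
    · rw [zero_mul]
  set δ := ∑ j ∈ J, μ j * hA' j with hδ
  set r := ∑ j ∈ J, μ j * hB' j with hr
  set m := ∑ j ∈ J, μ j * hC' j with hm
  set E := ∑ j ∈ J, μ j * phiZero (h j) with hE
  have hsumμ : ∀ u v : ℕ → ℝ, (∀ j, u j ≤ v j) → ∑ j ∈ J, μ j * u j ≤ ∑ j ∈ J, μ j * v j :=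
    fun u v huv => sum_le_sum fun j _ => mul_le_mul_of_nonneg_left (huv j) (hμ0 j)
  have hn0 : ∀ u : ℕ → ℝ, (∀ j, 0 ≤ u j) → 0 ≤ ∑ j ∈ J, μ j * u j :=
    fun u hu => sum_nonneg fun j _ => mul_nonneg (hμ0 j) (hu j)
  have hδ0 : 0 ≤ δ := hn0 _ hA0
  have hr0 : 0 ≤ r := hn0 _ hB0
  have hm0 : 0 ≤ m := hn0 _ hC0
  have hE0 : 0 ≤ E := hn0 _ hφ0
  have hsum : m + r = 1 - δ := by
    rw [← h1, hm, hr, hδ, ← sum_add_distrib, ← sum_sub_distrib]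
    exact sum_congr rfl fun j _ => by rw [← hABC j]; ring
  have hrE : r ≤ E := hsumμ _ _ pB
  have hδE : δ * (L - 1) ≤ E := by
    have := hsumμ _ _ pA'
    simpa only [← mul_assoc, ← sum_mul] using this
  have hAE : ∑ j ∈ J, μ j * hA' j * ((chiSq D b j ^ a - 1) / a) ≤ 14 / (5 * n) * E := by
    rw [hE, mul_sum]
    refine sum_le_sum fun j hj => ?_
    rw [hJ, mem_range] at hj
    rw [mul_assoc, mul_left_comm (14 / (5 * (n : ℝ)))]
    exact mul_le_mul_of_nonneg_left (pA j (by omega)) (hμ0 j)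
  have htB : ∑ j ∈ J, μ j * hB' j * chiSq D b j ≤ 1 / (100 * n) := by
    refine le_trans ?_ ht
    rw [sum_filter]
    refine sum_le_sum fun j _ => ?_
    rw [mul_assoc]
    refine (mul_le_mul_of_nonneg_left (pR j) (hμ0 j)).trans_eq ?_
    split_ifs <;> simp
  -- The variance is at most the second moment about 1 and about 0. The first gives a bound by the
  -- entropy, the second a bound by the mass `m`, needed when little mass lies below `K`.
  have hV1 : ∑ j ∈ J, μ j * (hC' j - m) ^ 2 ≤ 2 * K * E := by
    have h2 : ∑ j ∈ J, μ j * (hC' j - m) ^ 2 ≤ ∑ j ∈ J, μ j * (hC' j - 1) ^ 2 := by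
      have e : ∑ j ∈ J, μ j * (hC' j - 1) ^ 2 =
          ∑ j ∈ J, μ j * (hC' j - m) ^ 2 + (m - 1) ^ 2 := by
        have e2 : ∀ j ∈ J, μ j * (hC' j - 1) ^ 2 = μ j * (hC' j - m) ^ 2 +
            (2 * (m - 1) * (μ j * hC' j) + ((1 - m ^ 2) * μ j)) := fun j _ => by ring
        rw [sum_congr rfl e2, sum_add_distrib, sum_add_distrib, ← mul_sum, ← mul_sum, ← hm,
          sum_pairProb hb]
        ring
      rw [e]; nlinarith [sq_nonneg (m - 1)]
    refine h2.trans ((hsumμ _ _ pC).trans_eq ?_)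
    rw [hE, mul_sum]
    exact sum_congr rfl fun j _ => by ring
  have hV2 : ∑ j ∈ J, μ j * (hC' j - m) ^ 2 ≤ K * m := by
    have h2 : ∑ j ∈ J, μ j * (hC' j - m) ^ 2 ≤ ∑ j ∈ J, μ j * hC' j ^ 2 := by
      have e : ∑ j ∈ J, μ j * hC' j ^ 2 = ∑ j ∈ J, μ j * (hC' j - m) ^ 2 + m ^ 2 := by
        have e2 : ∀ j ∈ J, μ j * hC' j ^ 2 = μ j * (hC' j - m) ^ 2 +
            (2 * m * (μ j * hC' j) + (- m ^ 2 * μ j)) := fun j _ => by ring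
        rw [sum_congr rfl e2, sum_add_distrib, sum_add_distrib, ← mul_sum, ← mul_sum, ← hm,
          sum_pairProb hb]
        ring
      rw [e]; nlinarith [sq_nonneg m]
    refine h2.trans ((hsumμ _ (fun j => K * hC' j) fun j => ?_).trans_eq ?_)
    · simp only [hC'd]; split_ifs with hCj
      · rw [sq]; exact mul_le_mul_of_nonneg_right hCj (h0 j)
      · simp
    · rw [hm, mul_sum]
      exact sum_congr rfl fun j _ => by ring
  have hfun : (fun j => (hC' j + hB' j) + hA' j) = h := funext hABC
  have hsplit := sum_halfProb_mul_phi_halfAvg_add_le hb ha ha1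
    (f := fun j => hC' j + hB' j) (g := hA') (δ := δ)
    (fun j => add_nonneg (hC0 j) (hB0 j)) hA0
    (by rw [← hsum, hm, hr, ← sum_add_distrib]; exact sum_congr rfl fun j _ => by ring) rfl
  rw [hfun, ← hsum] at hsplit
  refine hsplit.trans ?_
  -- The budget `3 / n` is divided as `14 / (5 n)` for the large values and `1 / (5 n)` for all
  -- others.
  refine le_trans (add_le_add (b := 1 / (5 * n) * E) ?_ hAE) (le_of_eq (by field_simp; ring))
  rcases (add_nonneg hm0 hr0).eq_or_lt with hz | hpos
  · rw [← hz, zero_mul]; positivity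
  refine (mul_sum_halfProb_mul_phi_halfAvg_div_le hb ha ha1 hC0 hB0 rfl rfl hpos).trans ?_
  rw [inv_mul_le_iff₀ hpos]
  set V := ∑ j ∈ J, μ j * (hC' j - m) ^ 2 with hV
  have hD0 : (0 : ℝ) ≤ D := Nat.cast_nonneg D
  have htB' : 2 * r * ∑ j ∈ J, μ j * hB' j * chiSq D b j ≤ 2 * r * (1 / (100 * n)) :=
    mul_le_mul_of_nonneg_left htB (by positivity)
  have hu : (0 : ℝ) < 1 / (100 * n) := by positivity
  have e5 : 1 / (5 * (n : ℝ)) = 20 * (1 / (100 * n)) := by field_simp; norm_num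
  rw [e5]
  set u := 1 / (100 * (n : ℝ)) with hud
  -- Normalising the smaller values divides by their mass `m + r = 1 - δ`. This is harmless if `δ ≤
  -- 1 / 2`; otherwise the entropy `E` is at least 1, and the bounds proportional to `m + r`
  -- suffice.
  rcases le_or_gt δ (1 / 2) with hδ2 | hδ2
  · have h3 : 2 / D * V ≤ u * E := by
      calc 2 / D * V ≤ 2 / D * (2 * K * E) := mul_le_mul_of_nonneg_left hV1 (by positivity)
        _ = 8 * K / D * E / 2 := by ring
        _ ≤ u * E / 2 := by
          have := mul_le_mul_of_nonneg_right hK hE0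
          linarith
        _ ≤ u * E := by linarith [mul_nonneg hu.le hE0]
    have h4 : 1 / 2 ≤ m + r := by linarith
    have h5 : 2 * r * u ≤ 2 * E * u := by gcongr
    have h6 : 1 / 2 * (20 * u * E) ≤ (m + r) * (20 * u * E) :=
      mul_le_mul_of_nonneg_right h4 (by positivity)
    linarith [mul_nonneg hu.le hE0]
  · have hE1 : 1 ≤ E := by nlinarith
    have h3 : 2 / D * V ≤ u * (m + r) := by
      calc 2 / D * V ≤ 2 / D * (K * m) := mul_le_mul_of_nonneg_left hV2 (by positivity)
        _ = 8 * K / D * m / 4 := by ring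
        _ ≤ u * m / 4 := by
          have := mul_le_mul_of_nonneg_right hK hm0
          linarith
        _ ≤ u * (m + r) := by nlinarith [mul_nonneg hu.le hm0, mul_nonneg hu.le hr0]
    have h5 : 2 * r * u ≤ 2 * (m + r) * u := by gcongr; linarith
    have h6 : (m + r) * (20 * u * 1) ≤ (m + r) * (20 * u * E) := by gcongr
    linarith [mul_nonneg hu.le hpos.le]

end ThorpShuffle

/-! ### Contraction for every number of pairs, and the sequence of exponents. -/

namespace ThorpShuffle
open Finset Filter

/-- The contraction inequality, with factor `ε`, for averaging over the pairs of two halves of size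
`D`. -/
def Contracts (D : ℕ) (a ε : ℝ) : Prop :=
  ∀ b ≤ D, ∀ h : ℕ → ℝ, (∀ j, 0 ≤ h j) →
    ∑ j ∈ range (b / 2 + 1), pairProb D b j * h j = 1 →
    ∑ w ∈ range (b + 1), halfProb D b w * phi a (halfAvg D b h w) ≤
      ε * ∑ j ∈ range (b / 2 + 1), pairProb D b j * phiZero (h j)

theorem one_div_le_midProb {D b : ℕ} (hb : b ≤ D) : 1 / ((D : ℝ) + 2) ≤ midProb b := by
  rw [midProb_eq]
  have h := one_le_mul_centralProb ((b + 1) / 2)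
  have h2 : (2 * (((b + 1) / 2 : ℕ) : ℝ) + 1) ≤ D + 2 := by
    have : 2 * ((b + 1) / 2) + 1 ≤ D + 2 := by omega
    exact_mod_cast this
  have hD : (0 : ℝ) < D + 2 := by positivity
  have h0 : 0 ≤ centralProb ((b + 1) / 2) := by
    by_contra hneg
    push Not at hneg
    have : (0 : ℝ) ≤ 2 * (((b + 1) / 2 : ℕ) : ℝ) + 1 := by positivity
    nlinarith
  rw [div_le_iff₀' hD]
  exact h.trans (mul_le_mul_of_nonneg_right h2 h0)

theorem one_div_le_pairProb {D b j : ℕ} (hb : b ≤ D) (hj : 2 * j ≤ b) :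
    1 / (2 : ℝ) ^ (2 * D) ≤ pairProb D b j := by
  have h1 : 0 < D.choose (b - j) := Nat.choose_pos (by omega)
  have h2 : 0 < (b - j).choose j := Nat.choose_pos (by omega)
  have h3 : 0 < 2 ^ (b - 2 * j) := by positivity
  have h4 : 1 ≤ D.choose (b - j) * (b - j).choose j * 2 ^ (b - 2 * j) :=
    Nat.mul_pos (Nat.mul_pos h1 h2) h3
  have h5 : (2 * D).choose b ≤ 2 ^ (2 * D) := Nat.choose_le_two_pow _ _
  exact div_le_div₀ (by positivity) (by exact_mod_cast h4) (choose_two_mul_pos hb)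
    (by exact_mod_cast h5)

/-- The common atom contracts `phi a` by `1 - β`. Every relevant `pairProb` is at least `1 / X`, so
a density is at most `X`, and comparing `phi a` with `phiZero` costs `(1 + a) X ^ a`, which is close
to 1 for small `a`. -/
theorem exists_contracts (D : ℕ) : ∃ a₀ ε : ℝ, 0 < a₀ ∧ 0 < ε ∧ ε < 1 ∧
    ∀ a, 0 < a → a ≤ a₀ → Contracts D a ε := by
  set β : ℝ := 1 / ((D : ℝ) + 2) with hβ
  have hD0 : (0 : ℝ) ≤ D := Nat.cast_nonneg D
  have hβ0 : 0 < β := by positivity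
  have hβ1 : β ≤ 1 / 2 := one_div_le_one_div_of_le (by norm_num) (by linarith)
  set X : ℝ := 2 ^ (2 * D) with hX
  have hX1 : 1 ≤ X := one_le_pow₀ (by norm_num)
  have hX0 : 0 < X := by linarith
  have hcont : ContinuousAt (fun a : ℝ => (1 - β) * ((1 + a) * X ^ a)) 0 :=
    continuousAt_const.mul ((continuousAt_const.add continuousAt_id).mul
      (Real.continuousAt_const_rpow hX0.ne'))
  have hev : ∀ᶠ a in nhds (0 : ℝ), (1 - β) * ((1 + a) * X ^ a) < 1 - β / 2 :=
    hcont.eventually_lt_const (by simp; linarith)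
  obtain ⟨r, hr, hball⟩ := Metric.eventually_nhds_iff.1 hev
  refine ⟨r / 2, 1 - β / 2, by positivity, by linarith, by linarith, fun a ha har => ?_⟩
  intro b hb h h0 h1
  have hlt := hball (y := a) (by rw [Real.dist_eq, sub_zero, abs_of_pos ha]; linarith)
  have hE0 : 0 ≤ ∑ j ∈ range (b / 2 + 1), pairProb D b j * phiZero (h j) :=
    sum_nonneg fun j _ => mul_nonneg (pairProb_nonneg _ _ _) (phiZero_nonneg (h0 j))
  have hle : ∑ j ∈ range (b / 2 + 1), pairProb D b j * phi a (h j) ≤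
      (1 + a) * X ^ a * ∑ j ∈ range (b / 2 + 1), pairProb D b j * phiZero (h j) := by
    rw [mul_sum]
    refine sum_le_sum fun j hj => ?_
    have hj' : 2 * j ≤ b := by rw [mem_range] at hj; omega
    rw [mul_left_comm]
    refine mul_le_mul_of_nonneg_left (phi_le_mul_phiZero ha hX1 (h0 j) ?_) (pairProb_nonneg _ _ _)
    have h2 : pairProb D b j * h j ≤ 1 := h1 ▸ single_le_sum (f := fun j => pairProb D b j * h j)
      (fun i _ => mul_nonneg (pairProb_nonneg _ _ _) (h0 i)) hj
    have h3 := mul_le_mul_of_nonneg_right (one_div_le_pairProb hb hj') (h0 j)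
    rw [one_div_mul_eq_div, div_le_iff₀ hX0] at h3
    nlinarith
  have hmid := one_div_le_midProb hb
  have hmid1 : 0 ≤ (1 + a) * X ^ a * ∑ j ∈ range (b / 2 + 1), pairProb D b j * phiZero (h j) := by
    positivity
  have hphi0 : 0 ≤ ∑ j ∈ range (b / 2 + 1), pairProb D b j * phi a (h j) :=
    hE0.trans (sum_le_sum fun j _ => mul_le_mul_of_nonneg_left (phiZero_le_phi ha (h0 j))
      (pairProb_nonneg _ _ _))
  calc _ ≤ (1 - midProb b) * ∑ j ∈ range (b / 2 + 1), pairProb D b j * phi a (h j) :=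
        sum_halfProb_mul_phi_halfAvg_le hb ha h0 h1
    _ ≤ (1 - β) * ∑ j ∈ range (b / 2 + 1), pairProb D b j * phi a (h j) :=
        mul_le_mul_of_nonneg_right (by linarith) hphi0
    _ ≤ (1 - β) * ((1 + a) * X ^ a *
          ∑ j ∈ range (b / 2 + 1), pairProb D b j * phiZero (h j)) :=
        mul_le_mul_of_nonneg_left hle (by linarith)
    _ = (1 - β) * ((1 + a) * X ^ a) *
          ∑ j ∈ range (b / 2 + 1), pairProb D b j * phiZero (h j) := by ring
    _ ≤ _ := mul_le_mul_of_nonneg_right hlt.le hE0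

theorem eventually_contracts : ∀ᶠ n : ℕ in atTop, ∀ a : ℝ, 0 < a → a ≤ 1 / (n : ℝ) ^ 3 →
    Contracts (2 ^ (n - 1)) a (3 / n) := by
  filter_upwards [eventually_two_rpow_le, eventually_sum_chiSq_tail_le, eventually_ge_atTop 200]
    with n h1 h2 hn a ha han b hb h h0 hh
  have hn' : (200 : ℝ) ≤ n := by exact_mod_cast hn
  have hlog : 3 / 4 ≤ Real.log 4 := by
    have := Real.one_sub_inv_le_log_of_pos (show (0 : ℝ) < 4 by norm_num)
    norm_num at this; linarith
  have ha1 : a ≤ 1 := han.trans (by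
    rw [div_le_one (by positivity)]; exact one_le_pow₀ (by linarith))
  refine sum_halfProb_mul_phi_halfAvg_le_of_large hb (by omega) ha ha1 ?_ ?_ ?_ (h2 b hb) h0 hh
  · intro j hj
    have hD : (((2 ^ (n - 1) : ℕ) : ℝ)) * 2 = 2 ^ n := by
      have := two_mul_two_pow_pred (show 1 ≤ n by omega)
      rw [mul_comm]; exact_mod_cast this
    -- A polynomial bound in `D` is exponential in `n`; since `n a ≤ n⁻²`, its `a`-th power is below
    -- `11 / 10`.
    have h8 : max 4 (chiSq (2 ^ (n - 1)) b j) ≤ 8 ^ n := by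
      have e8 : (8 : ℝ) ^ n = 2 ^ n * 2 ^ n * 2 ^ n := by
        rw [← mul_pow, ← mul_pow]; norm_num
      have hx : (4 : ℝ) ≤ 2 ^ n := by
        calc (4 : ℝ) = 2 ^ 2 := by norm_num
          _ ≤ 2 ^ n := pow_le_pow_right₀ (by norm_num) (by omega)
      refine max_le ?_ ?_
      · rw [e8]; nlinarith
      · refine (chiSq_le_sq hb (by omega)).trans ?_
        rw [e8]
        generalize ((2 ^ (n - 1) : ℕ) : ℝ) = D at *
        rw [← hD] at hx ⊢
        have : 2 ≤ D := by linarith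
        nlinarith [mul_nonneg (sub_nonneg.2 this) (sub_nonneg.2 this),
          mul_nonneg (mul_nonneg (sub_nonneg.2 this) (sub_nonneg.2 this)) (sub_nonneg.2 this)]
    have hM0 : (0 : ℝ) ≤ max 4 (chiSq (2 ^ (n - 1)) b j) := le_max_of_le_left (by norm_num)
    have hna : n * a ≤ 1 / (n : ℝ) ^ 2 := by
      calc n * a ≤ n * (1 / (n : ℝ) ^ 3) := by gcongr
        _ = _ := by field_simp
    have hn2 : 1 / (n : ℝ) ^ 2 ≤ 1 / 100 := one_div_le_one_div_of_le (by norm_num) (by nlinarith)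
    calc _ ≤ ((8 : ℝ) ^ n) ^ a := Real.rpow_le_rpow hM0 h8 ha.le
      _ = 8 ^ (n * a) := by rw [Real.rpow_mul (by norm_num), Real.rpow_natCast]
      _ = (1 + 7) ^ (n * a) := by norm_num
      _ ≤ 1 + (n * a) * 7 :=
        rpow_one_add_le_one_add_mul_self (by norm_num) (by positivity) (by linarith)
      _ ≤ _ := by linarith
  · nlinarith
  · refine le_trans ?_ h1
    have hD : (((2 ^ (n - 1) : ℕ) : ℝ)) = 2 ^ ((n : ℝ) - 1) := by
      rw [Real.rpow_sub (by norm_num), Real.rpow_one, Real.rpow_natCast, eq_div_iff (by norm_num),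
        mul_comm]
      exact_mod_cast two_mul_two_pow_pred (show 1 ≤ n by omega)
    rw [hD, show (4 : ℝ) = 2 ^ (2 : ℝ) by norm_num, ← Real.rpow_mul (by norm_num),
      show (8 : ℝ) = 2 ^ (3 : ℝ) by norm_num, ← Real.rpow_add (by norm_num),
      ← Real.rpow_sub (by norm_num)]
    norm_num
    linarith

/-- The one-dimensional hypercontractive inequality. -/
theorem sum_halfProb_mul_halfAvg_rpow_le {D b : ℕ} (hb : b ≤ D) {a a' ε : ℝ} (ha' : 0 < a')
    (haa : a' < a) (haε : a' ≤ a * (1 - ε)) (hC : Contracts D a ε) {h : ℕ → ℝ}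
    (h0 : ∀ j, 0 ≤ h j) :
    ∑ w ∈ range (b + 1), halfProb D b w * halfAvg D b h w ^ (1 + a) ≤
      (∑ j ∈ range (b / 2 + 1), pairProb D b j * h j ^ ((1 + a) / (1 + a'))) ^ (1 + a') := by
  have ha : 0 < a := ha'.trans haa
  -- This makes `1 + β` the inner exponent. Both sides are then homogeneous of degree `1 + a`, so
  -- `h` may be normalised to mean 1.
  set β := (a - a') / (1 + a') with hβ
  have hβ0 : 0 < β := div_pos (by linarith) (by linarith)
  have e1 : (1 + a) / (1 + a') = 1 + β := by rw [hβ]; field_simp; ring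
  have e2 : (1 + a') * β = a - a' := by rw [hβ]; field_simp
  rw [e1]
  set m := ∑ j ∈ range (b / 2 + 1), pairProb D b j * h j with hm
  have hm0 : 0 ≤ m := sum_nonneg fun j _ => mul_nonneg (pairProb_nonneg _ _ _) (h0 j)
  rcases hm0.eq_or_lt with hz | hpos
  · have hz' : ∀ j ∈ range (b / 2 + 1), pairProb D b j * h j = 0 :=
      (sum_eq_zero_iff_of_nonneg fun j _ => mul_nonneg (pairProb_nonneg _ _ _) (h0 j)).1 hz.symm
    have hG : ∀ w, halfAvg D b h w = 0 := fun w => by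
      rw [halfAvg, sum_eq_zero, zero_div]
      intro j hj
      rw [mul_right_comm, hz' j hj, zero_mul]
    simp only [hG, Real.zero_rpow (show 1 + a ≠ 0 by linarith), mul_zero, sum_const_zero]
    exact Real.rpow_nonneg (sum_nonneg fun j _ =>
      mul_nonneg (pairProb_nonneg _ _ _) (Real.rpow_nonneg (h0 j) _)) _
  · set g : ℕ → ℝ := fun j => h j / m with hg
    have hg0 : ∀ j, 0 ≤ g j := fun j => div_nonneg (h0 j) hm0
    have hg1 : ∑ j ∈ range (b / 2 + 1), pairProb D b j * g j = 1 := by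
      simp only [hg, ← mul_div_assoc, ← sum_div]
      rw [← hm, div_self hpos.ne']
    have hhg : ∀ j, h j = m * g j := fun j => by simp only [hg]; field_simp
    have hGg : ∀ w, halfAvg D b h w = m * halfAvg D b g w := fun w => by
      rw [halfAvg, halfAvg, mul_div_assoc', mul_sum]
      congr 1
      exact sum_congr rfl fun j _ => by rw [hhg j]; ring
    have hL : ∑ w ∈ range (b + 1), halfProb D b w * halfAvg D b h w ^ (1 + a) =
        m ^ (1 + a) * ∑ w ∈ range (b + 1), halfProb D b w * halfAvg D b g w ^ (1 + a) := by
      rw [mul_sum]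
      refine sum_congr rfl fun w _ => ?_
      rw [hGg, Real.mul_rpow hm0 (halfAvg_nonneg hg0)]; ring
    have hR : ∑ j ∈ range (b / 2 + 1), pairProb D b j * h j ^ (1 + β) =
        m ^ (1 + β) * ∑ j ∈ range (b / 2 + 1), pairProb D b j * g j ^ (1 + β) := by
      rw [mul_sum]
      refine sum_congr rfl fun j _ => ?_
      rw [hhg j, Real.mul_rpow hm0 (hg0 j)]; ring
    have hS0 : 0 ≤ ∑ j ∈ range (b / 2 + 1), pairProb D b j * g j ^ (1 + β) :=
      sum_nonneg fun j _ => mul_nonneg (pairProb_nonneg _ _ _) (Real.rpow_nonneg (hg0 j) _)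
    rw [hL, hR, Real.mul_rpow (by positivity) hS0, ← Real.rpow_mul hm0,
      show (1 + β) * (1 + a') = 1 + a by linarith]
    refine mul_le_mul_of_nonneg_left ?_ (by positivity)
    -- The left side is at most `1 + a ε E` by contraction, the right side at least `(1 + β E) ^ (1
    -- + a') ≥ 1 + (a - a') E` by Bernoulli, and `a ε ≤ a - a'`.
    set E := ∑ j ∈ range (b / 2 + 1), pairProb D b j * phiZero (g j) with hE
    have hE0 : 0 ≤ E :=
      sum_nonneg fun j _ => mul_nonneg (pairProb_nonneg _ _ _) (phiZero_nonneg (hg0 j))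
    have hc := hC b hb g hg0 hg1
    rw [← hE] at hc
    have hl : ∑ w ∈ range (b + 1), halfProb D b w * halfAvg D b g w ^ (1 + a) ≤
        1 + a * (ε * E) := by
      have e : ∀ w ∈ range (b + 1), halfProb D b w * halfAvg D b g w ^ (1 + a) =
          a * (halfProb D b w * phi a (halfAvg D b g w)) +
            ((1 + a) * (halfProb D b w * halfAvg D b g w) - a * halfProb D b w) := fun w _ => by
        have := phi_eq ha (halfAvg D b g w)
        linear_combination (-halfProb D b w) * this
      rw [sum_congr rfl e, sum_add_distrib, sum_sub_distrib, ← mul_sum, ← mul_sum, ← mul_sum,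
        sum_halfProb_mul_halfAvg hb, hg1, sum_halfProb hb]
      linarith [mul_le_mul_of_nonneg_left hc ha.le]
    have hr : 1 + β * E ≤ ∑ j ∈ range (b / 2 + 1), pairProb D b j * g j ^ (1 + β) := by
      have e : ∀ j ∈ range (b / 2 + 1), pairProb D b j * g j ^ (1 + β) =
          β * (pairProb D b j * phi β (g j)) +
            ((1 + β) * (pairProb D b j * g j) - β * pairProb D b j) := fun j _ => by
        have := phi_eq hβ0 (g j)
        linear_combination (-pairProb D b j) * this
      rw [sum_congr rfl e, sum_add_distrib, sum_sub_distrib, ← mul_sum, ← mul_sum, ← mul_sum,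
        hg1, sum_pairProb hb]
      have : E ≤ ∑ j ∈ range (b / 2 + 1), pairProb D b j * phi β (g j) :=
        sum_le_sum fun j _ => mul_le_mul_of_nonneg_left (phiZero_le_phi hβ0 (hg0 j))
          (pairProb_nonneg _ _ _)
      linarith [mul_le_mul_of_nonneg_left this hβ0.le]
    refine hl.trans (le_trans ?_ (Real.rpow_le_rpow (by positivity) hr (by linarith)))
    have hB := one_add_mul_self_le_rpow_one_add (s := β * E) (p := 1 + a')
      (by linarith [mul_nonneg hβ0.le hE0]) (by linarith)
    refine le_trans ?_ hB
    have : (1 + a') * (β * E) = (a - a') * E := by rw [← mul_assoc, e2]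
    rw [this]
    nlinarith

/-- A sequence of exponents along which every step of the shuffle is hypercontractive. -/
theorem exists_exponents : ∃ (α : ℕ → ℝ) (c : ℝ), 0 < c ∧ (∀ n, 0 < α n) ∧ (∀ n, α n ≤ 1) ∧
    (∀ n : ℕ, 1 ≤ n → c / (n : ℝ) ^ 4 ≤ α n) ∧
    ∀ n, α (n + 1) < α n ∧ ∃ ε, α (n + 1) ≤ α n * (1 - ε) ∧ Contracts (2 ^ n) (α n) ε := by
  obtain ⟨N, hN⟩ := eventually_atTop.1 eventually_contracts
  set N' := max N 6 with hN'
  choose a₀ ε ha₀ hε0 hε1 hc using fun n : ℕ => exists_contracts (2 ^ n)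
  have hNpos : (6 : ℝ) ≤ N' := by exact_mod_cast le_max_right N 6
  -- The third condition makes the exponent at each `n ≥ N'` at most `1 / (n + 1) ^ 3`, as the
  -- contraction inequality for large `n` requires.
  obtain ⟨A, hA0, hA1, hA2, hA3⟩ : ∃ A : ℝ, 0 < A ∧ A ≤ 1 ∧ A ≤ 1 / (8 * (N' : ℝ) ^ 3) ∧
      ∀ n ∈ range (N' + 1), A ≤ a₀ n := by
    have hev : ∀ᶠ A in nhdsWithin (0 : ℝ) (Set.Ioi 0),
        A ≤ 1 ∧ A ≤ 1 / (8 * (N' : ℝ) ^ 3) ∧ ∀ n ∈ range (N' + 1), A ≤ a₀ n := by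
      refine eventually_nhdsWithin_of_eventually_nhds ?_
      refine (eventually_le_nhds (by norm_num)).and ((eventually_le_nhds (by positivity)).and ?_)
      rw [Filter.eventually_all_finset]
      exact fun n _ => eventually_le_nhds (ha₀ n)
    obtain ⟨A, h, hA⟩ := (hev.and self_mem_nhdsWithin).exists
    exact ⟨A, hA, h⟩
  set P : ℕ → ℝ := fun n => A * ∏ i ∈ range n, (1 - ε i) with hP
  have hP0 : ∀ n, 0 < P n := fun n =>
    mul_pos hA0 (prod_pos fun i _ => by linarith [hε1 i])
  have hPs : ∀ n, P (n + 1) = P n * (1 - ε n) := fun n => by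
    simp only [hP, prod_range_succ, mul_assoc]
  have hPanti : Antitone P := antitone_nat_of_succ_le fun n => by
    rw [hPs]; nlinarith [hP0 n, hε0 n]
  have hPA : ∀ n, P n ≤ A := fun n => (hPanti (Nat.zero_le n)).trans_eq (by simp [hP])
  -- Past `N'` the sequence decays like `n⁻⁴`: with `x = 1 / (n + 1) ≤ 1 / 6` one has `(1 - x) ^ 4 ≤
  -- 1 - 3 x`, which is the factor allowed by `ε = 3 / (n + 1)`. This is why `N' ≥ 6`.
  refine ⟨fun n => if n ≤ N' then P n else P N' * ((N' : ℝ) / n) ^ 4, P N', hP0 _,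
    fun n => ?_, fun n => ?_, fun n hn => ?_, fun n => ?_⟩
  · dsimp only; split_ifs with h
    · exact hP0 n
    · have : (0 : ℝ) < n := by exact_mod_cast (by omega : 0 < n)
      have := hP0 N'
      positivity
  · dsimp only; split_ifs with h
    · exact (hPA n).trans hA1
    · have hn : (N' : ℝ) ≤ n := by exact_mod_cast (by omega : N' ≤ n)
      have h1 : ((N' : ℝ) / n) ^ 4 ≤ 1 := pow_le_one₀ (by positivity)
        (div_le_one_of_le₀ hn (by positivity))
      nlinarith [hP0 N', (hPA N').trans hA1]
  · have hn' : (1 : ℝ) ≤ n := by exact_mod_cast hn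
    dsimp only; split_ifs with h
    · exact (div_le_self (hP0 N').le (one_le_pow₀ hn')).trans (hPanti h)
    · rw [div_pow, ← mul_div_assoc]
      refine div_le_div_of_nonneg_right ?_ (by positivity)
      exact le_mul_of_one_le_right (hP0 N').le (one_le_pow₀ (by linarith))
  · dsimp only
    rcases Nat.lt_or_ge n N' with h | h
    · rw [if_pos (by omega : n + 1 ≤ N'), if_pos h.le]
      refine ⟨by rw [hPs]; nlinarith [hP0 n, hε0 n], ε n, (hPs n).le, hc n _ (hP0 n) ?_⟩
      exact (hPA n).trans (hA3 n (mem_range.2 (by omega)))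
    · have hn' : (N' : ℝ) ≤ n := by exact_mod_cast h
      have hn0 : (0 : ℝ) < n := by linarith
      have e : (if n ≤ N' then P n else P N' * ((N' : ℝ) / n) ^ 4) =
          P N' * ((N' : ℝ) / n) ^ 4 := by
        split_ifs with h2
        · rw [show n = N' by omega, div_self (by linarith)]; simp
        · rfl
      rw [e, if_neg (by omega)]
      have hlt : ((N' : ℝ) / (n + 1 : ℕ)) ^ 4 =
          ((N' : ℝ) / n) ^ 4 * (1 - 1 / ((n + 1 : ℕ) : ℝ)) ^ 4 := by
        push_cast
        rw [← mul_pow]; congr 1; field_simp; ring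
      set x : ℝ := 1 / ((n + 1 : ℕ) : ℝ) with hx
      have hx0 : 0 < x := by positivity
      have hx6 : x ≤ 1 / 6 := one_div_le_one_div_of_le (by norm_num) (by push_cast; linarith)
      have hb : (1 - x) ^ 4 ≤ 1 - 3 * x := by
        have h1 := mul_nonneg hx0.le (show 0 ≤ 1 - 6 * x by linarith)
        have h2 := mul_nonneg (pow_nonneg hx0.le 3) (show 0 ≤ 4 - x by linarith)
        nlinarith
      have hPN := hP0 N'
      have hq : 0 < P N' * ((N' : ℝ) / n) ^ 4 := by positivity
      refine ⟨?_, 3 / ((n + 1 : ℕ) : ℝ), ?_, ?_⟩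
      · rw [hlt, ← mul_assoc]; nlinarith
      · rw [hlt, ← mul_assoc, show 3 / ((n + 1 : ℕ) : ℝ) = 3 * x by rw [hx]; ring]
        exact mul_le_mul_of_nonneg_left hb hq.le
      · have := hN (n + 1) ((le_max_left N 6).trans (by omega))
        rw [Nat.add_sub_cancel] at this
        refine this _ hq ?_
        have h1 : P N' * ((N' : ℝ) / n) ^ 4 ≤ 1 / (8 * (N' : ℝ) ^ 3) * ((N' : ℝ) / n) ^ 4 :=
          mul_le_mul_of_nonneg_right ((hPA N').trans hA2) (by positivity)
        refine h1.trans ?_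
        have hN0 : (0 : ℝ) < N' := by linarith
        have e3 : 1 / (8 * (N' : ℝ) ^ 3) * ((N' : ℝ) / n) ^ 4 = N' / (8 * n ^ 4) := by
          field_simp
        rw [e3, div_le_div_iff₀ (by positivity) (by positivity)]
        push_cast
        have h2 : ((n : ℝ) + 1) ^ 3 ≤ (2 * n) ^ 3 := pow_le_pow_left₀ (by positivity) (by linarith) 3
        calc (N' : ℝ) * ((n : ℝ) + 1) ^ 3 ≤ (n : ℝ) * (2 * n) ^ 3 := by gcongr
          _ = 1 * (8 * (n : ℝ) ^ 4) := by ring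

end ThorpShuffle

/-! ### Hypercontractivity and its tensorisation. -/

namespace ThorpShuffle
open Finset

/-- The operator `T` is hypercontractive on `S`: its `L²` norm there is bounded by the `Lᵖ` norm. -/
def Hypercontractive {X : Type*} (T : (X → ℝ) → X → ℝ) (p : ℝ) (S : Finset X) : Prop :=
  ∀ f : X → ℝ, (∀ x, 0 ≤ f x) →
    (∑ x ∈ S, T f x ^ 2) / #S ≤ ((∑ x ∈ S, f x ^ p) / #S) ^ (2 / p)

/-- The tensor product of two operators on functions. -/
def tensorOp {X Y : Type*} (T : (X → ℝ) → X → ℝ) (T' : (Y → ℝ) → Y → ℝ) :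
    (X × Y → ℝ) → X × Y → ℝ :=
  fun F z => T' (fun y => T (fun x => F (x, y)) z.1) z.2

theorem sum_rpow_sum_le {X Y : Type*} (s : Finset X) (t : Finset Y) {q : ℝ} (hq : 1 ≤ q)
    {g : X → Y → ℝ} (hg : ∀ x y, 0 ≤ g x y) :
    (∑ x ∈ s, (∑ y ∈ t, g x y) ^ q) ^ (1 / q) ≤ ∑ y ∈ t, (∑ x ∈ s, g x y ^ q) ^ (1 / q) := by
  classical
  induction t using Finset.induction_on with
  | empty =>
    have h0 : q ≠ 0 := by linarith
    simp [Real.zero_rpow h0, Real.zero_rpow (inv_ne_zero h0)]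
  | insert a t ha ih =>
    simp only [sum_insert ha]
    refine (Real.Lp_add_le_of_nonneg s hq (fun x _ => hg x a)
      (fun x _ => sum_nonneg fun y _ => hg x y)).trans ?_
    exact add_le_add le_rfl ih

theorem Hypercontractive.sum_le {X : Type*} {T : (X → ℝ) → X → ℝ} {p : ℝ} {S : Finset X}
    (h : Hypercontractive T p S) {f : X → ℝ} (hf : ∀ x, 0 ≤ f x) :
    ∑ x ∈ S, T f x ^ 2 ≤ #S * ((∑ x ∈ S, f x ^ p) / #S) ^ (2 / p) := by
  rcases S.eq_empty_or_nonempty with rfl | hS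
  · simp
  · have hn : (0 : ℝ) < #S := by exact_mod_cast hS.card_pos
    rw [← div_le_iff₀' hn]; exact h f hf

theorem hypercontractive_of_sum_le {X : Type*} {T : (X → ℝ) → X → ℝ} {p : ℝ} {S : Finset X}
    (h : S.Nonempty → ∀ f : X → ℝ, (∀ x, 0 ≤ f x) →
      ∑ x ∈ S, T f x ^ 2 ≤ #S * ((∑ x ∈ S, f x ^ p) / #S) ^ (2 / p)) :
    Hypercontractive T p S := by
  intro f hf
  rcases S.eq_empty_or_nonempty with rfl | hS
  · simp [Real.rpow_nonneg]
  · have hn : (0 : ℝ) < #S := by exact_mod_cast hS.card_pos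
    rw [div_le_iff₀' hn]; exact h hS f hf

/-- Apply the inequality of `T'` in the second variable, exchange the two norms by Minkowski's
inequality with exponent `2 / p ≥ 1`, then apply that of `T` in the first variable. Only positivity
of `T` is required, not linearity. -/
theorem Hypercontractive.tensor {X Y : Type*} {T : (X → ℝ) → X → ℝ} {T' : (Y → ℝ) → Y → ℝ}
    {p : ℝ} (hp : 0 < p) (hp2 : p ≤ 2) {S : Finset X} {S' : Finset Y}
    (h : Hypercontractive T p S) (h' : Hypercontractive T' p S')
    (hT : ∀ f : X → ℝ, (∀ x, 0 ≤ f x) → ∀ x, 0 ≤ T f x) :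
    Hypercontractive (tensorOp T T') p (S ×ˢ S') := by
  refine hypercontractive_of_sum_le fun hne F hF => ?_
  obtain ⟨hS, hS'⟩ := nonempty_product.1 hne
  have hn : (0 : ℝ) < #S := by exact_mod_cast hS.card_pos
  have hn' : (0 : ℝ) < #S' := by exact_mod_cast hS'.card_pos
  set q := 2 / p with hq
  have hq1 : 1 ≤ q := by rw [hq, le_div_iff₀ hp]; linarith
  have hq0 : 0 < q := by linarith
  have hk : ∀ x y, 0 ≤ T (fun x => F (x, y)) x := fun x y => hT _ (fun x => hF _) x
  have hkp : ∀ x y, 0 ≤ T (fun x => F (x, y)) x ^ p := fun x y => Real.rpow_nonneg (hk x y) p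
  have h1 : ∀ x ∈ S, ∑ y ∈ S', T' (fun y => T (fun x => F (x, y)) x) y ^ 2 ≤
      #S' * ((∑ y ∈ S', T (fun x => F (x, y)) x ^ p) / #S') ^ q := fun x _ =>
    h'.sum_le (fun y => hk x y)
  have h2 : ∑ x ∈ S, (∑ y ∈ S', T (fun x => F (x, y)) x ^ p) ^ q ≤
      #S * (∑ y ∈ S', (∑ x ∈ S, F (x, y) ^ p) / #S) ^ q := by
    have hm := sum_rpow_sum_le S S' hq1 hkp
    have hA0 : 0 ≤ ∑ x ∈ S, (∑ y ∈ S', T (fun x => F (x, y)) x ^ p) ^ q :=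
      sum_nonneg fun x _ => Real.rpow_nonneg (sum_nonneg fun y _ => hkp x y) _
    have h3 : ∀ y ∈ S', (∑ x ∈ S, (T (fun x => F (x, y)) x ^ p) ^ q) ^ (1 / q) ≤
        (#S : ℝ) ^ (1 / q) * ((∑ x ∈ S, F (x, y) ^ p) / #S) := by
      intro y _
      have h4 : ∀ x ∈ S, (T (fun x => F (x, y)) x ^ p) ^ q = T (fun x => F (x, y)) x ^ 2 := by
        intro x _
        rw [← Real.rpow_mul (hk x y), hq, mul_div_cancel₀ _ hp.ne']
        exact_mod_cast Real.rpow_natCast _ 2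
      have hB0 : 0 ≤ (∑ x ∈ S, F (x, y) ^ p) / #S :=
        div_nonneg (sum_nonneg fun x _ => Real.rpow_nonneg (hF _) _) hn.le
      rw [sum_congr rfl h4]
      refine (Real.rpow_le_rpow (sum_nonneg fun x _ => sq_nonneg _)
        (h.sum_le (fun x => hF (x, y))) (by positivity)).trans_eq ?_
      rw [Real.mul_rpow hn.le (Real.rpow_nonneg hB0 _), ← Real.rpow_mul hB0, ← hq,
        mul_one_div_cancel hq0.ne', Real.rpow_one]
    have h5 := hm.trans (sum_le_sum h3)
    have hC0 : 0 ≤ ∑ y ∈ S', (∑ x ∈ S, F (x, y) ^ p) / #S := sum_nonneg fun y _ =>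
      div_nonneg (sum_nonneg fun x _ => Real.rpow_nonneg (hF _) _) hn.le
    rw [← mul_sum] at h5
    have h6 := Real.rpow_le_rpow (Real.rpow_nonneg hA0 _) h5 hq0.le
    rwa [← Real.rpow_mul hA0, one_div_mul_cancel hq0.ne', Real.rpow_one,
      Real.mul_rpow (by positivity) hC0, ← Real.rpow_mul hn.le, one_div_mul_cancel hq0.ne',
      Real.rpow_one] at h6
  rw [sum_product, sum_product_right, card_product]
  refine (sum_le_sum h1).trans ?_
  have h7 : ∀ x ∈ S, (#S' : ℝ) * ((∑ y ∈ S', T (fun x => F (x, y)) x ^ p) / #S') ^ q =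
      #S' * ((#S' : ℝ)⁻¹ ^ q * (∑ y ∈ S', T (fun x => F (x, y)) x ^ p) ^ q) := by
    intro x _
    rw [div_eq_inv_mul, Real.mul_rpow (by positivity) (sum_nonneg fun y _ => hkp x y)]
  rw [sum_congr rfl h7, ← mul_sum, ← mul_sum]
  have hC0 : 0 ≤ ∑ y ∈ S', (∑ x ∈ S, F (x, y) ^ p) / #S := sum_nonneg fun y _ =>
    div_nonneg (sum_nonneg fun x _ => Real.rpow_nonneg (hF _) _) hn.le
  calc _ ≤ (#S' : ℝ) * ((#S' : ℝ)⁻¹ ^ q *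
        (#S * (∑ y ∈ S', (∑ x ∈ S, F (x, y) ^ p) / #S) ^ q)) := by gcongr
    _ = #S' * #S * ((#S' : ℝ)⁻¹ * (∑ y ∈ S', (∑ x ∈ S, F (x, y) ^ p) / #S)) ^ q := by
      rw [Real.mul_rpow (by positivity) hC0]; ring
    _ = _ := by
      rw [← sum_div]; push_cast
      congr 1
      · ring
      · congr 1; field_simp

theorem Hypercontractive.of_equiv {X Y : Type*} (e : X ≃ Y) {T : (X → ℝ) → X → ℝ}
    {T' : (Y → ℝ) → Y → ℝ} (hTT' : ∀ f x, T f x = T' (f ∘ e.symm) (e x)) {p : ℝ} {S : Finset X}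
    {S' : Finset Y} (hS : ∀ x, x ∈ S ↔ e x ∈ S') (h : Hypercontractive T' p S') :
    Hypercontractive T p S := by
  intro f hf
  have hS' : S' = S.map e.toEmbedding := by
    ext y; rw [mem_map_equiv, hS, Equiv.apply_symm_apply]
  have := h (f ∘ e.symm) (fun y => hf _)
  rw [hS', sum_map, sum_map, card_map] at this
  simpa [hTT'] using this

end ThorpShuffle

/-! ### Counting configurations on two paired halves. -/

namespace ThorpShuffle
open Finset

section Counting
variable {C : Type*}

/-- Interchange the components of `z` at the places where `c` is `true`. -/
def pairSwap (c : C → Bool) (z : (C → Bool) × (C → Bool)) : (C → Bool) × (C → Bool) :=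
  (fun i => if c i then z.2 i else z.1 i, fun i => if c i then z.1 i else z.2 i)

theorem pairSwap_pairSwap (c : C → Bool) (z : (C → Bool) × (C → Bool)) :
    pairSwap c (pairSwap c z) = z := by
  refine Prod.ext (funext fun i => ?_) (funext fun i => ?_) <;> simp only [pairSwap] <;>
    cases c i <;> simp

/-- `pairSwap` as an equivalence. -/
def pairSwapEquiv (c : C → Bool) : (C → Bool) × (C → Bool) ≃ (C → Bool) × (C → Bool) :=
  ⟨pairSwap c, pairSwap c, pairSwap_pairSwap c, pairSwap_pairSwap c⟩

variable [Fintype C]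

/-- The number of places where `u` takes the value `s`. -/
def count (s : Bool) (u : C → Bool) : ℕ := #{i | u i = s}

/-- The number of places where both components of `z` take the value `s`. -/
def pairCount (s : Bool) (z : (C → Bool) × (C → Bool)) : ℕ := #{i | z.1 i = s ∧ z.2 i = s}

theorem count_eq_sum (s : Bool) (u : C → Bool) : count s u = ∑ i, if u i = s then 1 else 0 :=
  card_filter _ _

theorem count_add_count_pairSwap (s : Bool) (c : C → Bool) (z : (C → Bool) × (C → Bool)) :
    count s (pairSwap c z).1 + count s (pairSwap c z).2 = count s z.1 + count s z.2 := by
  simp only [count_eq_sum, ← sum_add_distrib]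
  refine sum_congr rfl fun i _ => ?_
  simp only [pairSwap]
  by_cases h : c i = true <;> simp [h, add_comm]

theorem pairCount_pairSwap (s : Bool) (c : C → Bool) (z : (C → Bool) × (C → Bool)) :
    pairCount s (pairSwap c z) = pairCount s z := by
  unfold pairCount pairSwap
  congr 1
  ext i
  simp only [mem_filter, mem_univ, true_and]
  cases c i <;> simp [and_comm]

theorem two_mul_pairCount_le (s : Bool) (z : (C → Bool) × (C → Bool)) :
    2 * pairCount s z ≤ count s z.1 + count s z.2 := by
  rw [two_mul]
  refine add_le_add (card_le_card fun i => ?_) (card_le_card fun i => ?_)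
  · simp only [mem_filter, mem_univ, true_and]; exact And.left
  · simp only [mem_filter, mem_univ, true_and]; exact And.right

theorem count_false_eq (u : C → Bool) : count false u = Fintype.card C - count true u := by
  have h : count true u + count false u = Fintype.card C := by
    simp only [count_eq_sum, ← sum_add_distrib]
    rw [← card_univ, card_eq_sum_ones]
    refine sum_congr rfl fun i _ => ?_
    cases u i <;> simp
  omega

theorem count_le (s : Bool) (u : C → Bool) : count s u ≤ Fintype.card C := by
  rw [← card_univ]; exact card_le_card (filter_subset _ _)

variable [DecidableEq C]

theorem card_filter_sum_eq_coeff (e : C → Bool → ℕ) (w : ℕ) :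
    #{c : C → Bool | ∑ i, e i (c i) = w} =
      (∏ i, ∑ s : Bool, (Polynomial.X : Polynomial ℕ) ^ e i s).coeff w := by
  rw [prod_univ_sum, Fintype.piFinset_univ, Polynomial.finsetSum_coeff, card_filter]
  refine sum_congr rfl fun c _ => ?_
  rw [prod_pow_eq_pow_sum, Polynomial.coeff_X_pow]
  simp only [eq_comm]

theorem card_count_eq (s : Bool) (w : ℕ) :
    #{u : C → Bool | count s u = w} = (Fintype.card C).choose w := by
  have h := card_filter_sum_eq_coeff (C := C) (fun _ b => if b = s then 1 else 0) w
  simp only [← count_eq_sum] at h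
  rw [h]
  have e : ∑ b : Bool, (Polynomial.X : Polynomial ℕ) ^ (if b = s then 1 else 0) =
      Polynomial.X + 1 := by
    cases s <;> simp [add_comm]
  rw [e, prod_const, card_univ, Polynomial.coeff_X_add_one_pow]
  simp

/-- In the generating function a full pair contributes `2 X`, an empty pair 2 and a half-full pair
`1 + X`. -/
theorem card_pairSwap_eq (s : Bool) (z : (C → Bool) × (C → Bool)) (w : ℕ) :
    (#{c : C → Bool | count s (pairSwap c z).1 = w} : ℝ) = 2 ^ Fintype.card C *
      condProb (count s z.1 + count s z.2) (pairCount s z) w := by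
  have h := card_filter_sum_eq_coeff (C := C)
    (fun i b => if (if b then z.2 i else z.1 i) = s then 1 else 0) w
  set d := pairCount s z with hd
  set m := #{i | ¬(z.1 i = s ↔ z.2 i = s)} with hm
  set n := #{i | z.1 i ≠ s ∧ z.2 i ≠ s} with hn
  have hcard : d + m + n = Fintype.card C := by
    rw [hd, hm, hn, pairCount]
    simp only [card_filter]
    rw [← sum_add_distrib, ← sum_add_distrib, ← card_univ, card_eq_sum_ones]
    refine sum_congr rfl fun i _ => ?_
    by_cases h1 : z.1 i = s <;> by_cases h2 : z.2 i = s <;> simp [h1, h2]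
  have hb : count s z.1 + count s z.2 = 2 * d + m := by
    rw [hd, hm, count, count, pairCount]
    simp only [card_filter]
    rw [mul_sum, ← sum_add_distrib, ← sum_add_distrib]
    refine sum_congr rfl fun i _ => ?_
    by_cases h1 : z.1 i = s <;> by_cases h2 : z.2 i = s <;> simp [h1, h2]
  have hprod : ∏ i, ∑ b : Bool, (Polynomial.X : Polynomial ℕ) ^
        (if (if b then z.2 i else z.1 i) = s then 1 else 0) =
      2 ^ (d + n) * (Polynomial.X ^ d * (1 + Polynomial.X) ^ m) := by
    have e : ∀ i, ∑ b : Bool, (Polynomial.X : Polynomial ℕ) ^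
        (if (if b then z.2 i else z.1 i) = s then 1 else 0) =
        (if z.1 i = s ∧ z.2 i = s then 2 * Polynomial.X else 1) *
        (if z.1 i ≠ s ∧ z.2 i ≠ s then 2 else 1) *
        (if ¬(z.1 i = s ↔ z.2 i = s) then 1 + Polynomial.X else 1) := by
      intro i
      by_cases h1 : z.1 i = s <;> by_cases h2 : z.2 i = s <;>
        simp [h1, h2, two_mul, add_comm, one_add_one_eq_two]
    simp only [e, prod_mul_distrib]
    rw [← prod_filter, ← prod_filter, ← prod_filter, prod_const, prod_const, prod_const, ← hm,
      ← hn, hd, pairCount]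
    ring
  have hcount : ∀ c : C → Bool, count s (pairSwap c z).1 =
      ∑ i, if (if c i then z.2 i else z.1 i) = s then 1 else 0 := fun c => by
    rw [count_eq_sum]; rfl
  simp only [← hcount] at h
  rw [h, hprod, show (2 : Polynomial ℕ) ^ (d + n) = Polynomial.C (2 ^ (d + n)) by simp,
    Polynomial.coeff_C_mul, Polynomial.coeff_X_pow_mul', hb, condProb,
    show 2 * d + m - 2 * d = m by omega, ← hcard]
  split_ifs
  · rw [Polynomial.coeff_one_add_X_pow]
    push_cast
    field_simp
    ring
  · simp

/-- The configurations on two halves with `b` cards, `j` pairs being full. -/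
def pairClass (C : Type*) [Fintype C] [DecidableEq C] (s : Bool) (b j : ℕ) :
    Finset ((C → Bool) × (C → Bool)) :=
  {z | count s z.1 + count s z.2 = b ∧ pairCount s z = j}

/-- Averaging over all swaps changes neither the class nor `Γ`, but it randomises the number in the
first half. -/
theorem sum_pairClass_filter_eq (s : Bool) (b j w : ℕ) {Γ : (C → Bool) × (C → Bool) → ℝ}
    (hΓ : ∀ c z, Γ (pairSwap c z) = Γ z) :
    ∑ z ∈ pairClass C s b j with count s z.1 = w, Γ z =
      condProb b j w * ∑ z ∈ pairClass C s b j, Γ z := by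
  have h1 : ∀ c : C → Bool, ∑ z ∈ pairClass C s b j with count s z.1 = w, Γ z =
      ∑ z ∈ pairClass C s b j, if count s (pairSwap c z).1 = w then Γ z else 0 := by
    intro c
    rw [sum_filter]
    refine (sum_equiv (pairSwapEquiv c) (fun z => ?_) fun z _ => ?_).symm
    · simp only [pairClass, mem_filter, mem_univ, true_and, pairSwapEquiv, Equiv.coe_fn_mk,
        count_add_count_pairSwap, pairCount_pairSwap]
    · simp only [pairSwapEquiv, Equiv.coe_fn_mk, hΓ]
  have h2 : (2 : ℝ) ^ Fintype.card C * ∑ z ∈ pairClass C s b j with count s z.1 = w, Γ z =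
      2 ^ Fintype.card C * (condProb b j w * ∑ z ∈ pairClass C s b j, Γ z) := by
    calc _ = ∑ _c : C → Bool, ∑ z ∈ pairClass C s b j with count s z.1 = w, Γ z := by
          rw [sum_const, card_univ, Fintype.card_fun, Fintype.card_bool, nsmul_eq_mul]; push_cast
          rfl
      _ = ∑ z ∈ pairClass C s b j, ∑ c : C → Bool,
          if count s (pairSwap c z).1 = w then Γ z else 0 := by
        exact (sum_congr rfl fun c _ => h1 c).trans sum_comm
      _ = ∑ z ∈ pairClass C s b j, 2 ^ Fintype.card C * (condProb b j w * Γ z) := by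
        refine sum_congr rfl fun z hz => ?_
        simp only [pairClass, mem_filter, mem_univ, true_and] at hz
        rw [← sum_filter, sum_const, nsmul_eq_mul, card_pairSwap_eq, hz.1, hz.2]; ring
      _ = _ := by rw [mul_sum, mul_sum]
  exact mul_left_cancel₀ (by positivity) h2

/-- The configurations on two halves with `w` and `b - w` cards. -/
def halfClass (C : Type*) [Fintype C] [DecidableEq C] (s : Bool) (b w : ℕ) :
    Finset ((C → Bool) × (C → Bool)) :=
  ({u | count s u = w} : Finset (C → Bool)) ×ˢ ({v | count s v = b - w} : Finset (C → Bool))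

theorem card_halfClass (s : Bool) (b w : ℕ) :
    #(halfClass C s b w) = (Fintype.card C).choose w * (Fintype.card C).choose (b - w) := by
  rw [halfClass, card_product, card_count_eq, card_count_eq]

theorem sum_halfClass_eq (s : Bool) {b w : ℕ} (hw : w ≤ b) {Γ : (C → Bool) × (C → Bool) → ℝ}
    (hΓ : ∀ c z, Γ (pairSwap c z) = Γ z) :
    ∑ z ∈ halfClass C s b w, Γ z =
      ∑ j ∈ range (b / 2 + 1), condProb b j w * ∑ z ∈ pairClass C s b j, Γ z := by
  rw [← sum_fiberwise_of_maps_to (t := range (b / 2 + 1)) (g := pairCount s)]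
  · refine sum_congr rfl fun j _ => ?_
    rw [← sum_pairClass_filter_eq s b j w hΓ]
    refine sum_congr ?_ fun _ _ => rfl
    ext z
    simp only [halfClass, pairClass, mem_filter, mem_product, mem_univ, true_and]
    constructor
    · rintro ⟨⟨h1, h2⟩, h3⟩; exact ⟨⟨by omega, h3⟩, h1⟩
    · rintro ⟨⟨h1, h2⟩, h3⟩; exact ⟨⟨h3, by omega⟩, h2⟩
  · intro z hz
    simp only [halfClass, mem_filter, mem_product, mem_univ, true_and] at hz
    have := two_mul_pairCount_le s z
    rw [mem_range]; omega

/-- Counting the configurations with `w` cards in the first half in two ways gives a linear system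
for the class sizes. It is triangular, since `condProb b i w = 0` for `i > w`; taking `w = j`
determines the size for `j` from the smaller ones. -/
theorem card_pairClass (s : Bool) {b j : ℕ} (hb : b ≤ Fintype.card C) (hj : j ≤ b / 2) :
    (#(pairClass C s b j) : ℝ) =
      (2 * Fintype.card C).choose b * pairProb (Fintype.card C) b j := by
  have hN := choose_two_mul_pos hb
  have h1 : ∀ w ≤ b, ∑ j ∈ range (b / 2 + 1), condProb b j w * #(pairClass C s b j) =
      ∑ j ∈ range (b / 2 + 1), condProb b j w *
        ((2 * Fintype.card C).choose b * pairProb (Fintype.card C) b j) := by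
    intro w hw
    have h2 := sum_halfClass_eq (C := C) s hw (Γ := fun _ => 1) (fun _ _ => rfl)
    simp only [sum_const, nsmul_eq_mul, mul_one] at h2
    rw [← h2, card_halfClass]
    have h3 := sum_pairProb_mul_condProb hb hw
    rw [halfProb, eq_div_iff hN.ne', sum_mul] at h3
    push_cast
    rw [← h3]
    exact sum_congr rfl fun j _ => by ring
  induction j using Nat.strong_induction_on with
  | _ j ih =>
    have h2 := h1 j (by omega)
    rw [← sub_eq_zero, ← sum_sub_distrib, sum_eq_single j] at h2
    · have h3 : condProb b j j ≠ 0 := by simp [condProb]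
      rw [← mul_sub] at h2
      exact sub_eq_zero.1 ((mul_eq_zero.1 h2).resolve_left h3)
    · intro i hi hij
      rcases lt_or_gt_of_ne hij with h | h
      · rw [ih i h (by omega), sub_self]
      · simp [condProb, h.not_ge]
    · intro h; exact absurd (mem_range.2 (by omega)) h

end Counting
end ThorpShuffle

/-! ### The induction step: averaging over swaps, then acting in the two halves. -/

namespace ThorpShuffle
open Finset

section SwapAvg
variable {C : Type*} [Fintype C] [DecidableEq C]

/-- The average over all interchanges of pairs. -/
noncomputable def swapAvg (F : (C → Bool) × (C → Bool) → ℝ) (z : (C → Bool) × (C → Bool)) : ℝ :=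
  (∑ c : C → Bool, F (pairSwap c z)) / 2 ^ Fintype.card C

theorem swapAvg_pairSwap (F : (C → Bool) × (C → Bool) → ℝ) (c : C → Bool)
    (z : (C → Bool) × (C → Bool)) : swapAvg F (pairSwap c z) = swapAvg F z := by
  unfold swapAvg
  congr 1
  have hinv : Function.Involutive fun c' : C → Bool => fun i => xor (c' i) (c i) := fun c' => by
    funext i; simp
  refine Fintype.sum_equiv hinv.toPerm _ _ fun c' => congrArg F ?_
  refine Prod.ext (funext fun i => ?_) (funext fun i => ?_) <;>
    simp only [pairSwap, Function.Involutive.coe_toPerm] <;>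
    by_cases h : c i = true <;> by_cases h' : c' i = true <;> simp [h, h']

theorem swapAvg_nonneg {F : (C → Bool) × (C → Bool) → ℝ} (hF : ∀ z, 0 ≤ F z)
    (z : (C → Bool) × (C → Bool)) : 0 ≤ swapAvg F z :=
  div_nonneg (sum_nonneg fun _ _ => hF _) (by positivity)

theorem sum_swapAvg_rpow_le {F : (C → Bool) × (C → Bool) → ℝ} (hF : ∀ z, 0 ≤ F z) {p : ℝ}
    (hp : 1 ≤ p) (s : Bool) (b : ℕ) :
    ∑ z with count s z.1 + count s z.2 = b, swapAvg F z ^ p ≤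
      ∑ z with count s z.1 + count s z.2 = b, F z ^ p := by
  have hc : (0 : ℝ) < 2 ^ Fintype.card C := by positivity
  have hcard : ∑ _c : C → Bool, (1 : ℝ) / 2 ^ Fintype.card C = 1 := by
    rw [sum_const, card_univ, Fintype.card_fun, Fintype.card_bool, nsmul_eq_mul]
    push_cast
    rw [mul_one_div_cancel hc.ne']
  have h1 : ∀ z, swapAvg F z ^ p ≤
      ∑ c : C → Bool, 1 / 2 ^ Fintype.card C * F (pairSwap c z) ^ p := by
    intro z
    have := Real.rpow_arith_mean_le_arith_mean_rpow univ
      (fun _ : C → Bool => (1 : ℝ) / 2 ^ Fintype.card C) (fun c => F (pairSwap c z))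
      (fun _ _ => by positivity) hcard (fun _ _ => hF _) hp
    refine le_trans (le_of_eq ?_) this
    rw [swapAvg, ← mul_sum, div_eq_inv_mul, one_div]
  refine (sum_le_sum fun z _ => h1 z).trans (le_of_eq ?_)
  rw [sum_comm]
  have h2 : ∀ c : C → Bool, ∑ z with count s z.1 + count s z.2 = b,
      1 / 2 ^ Fintype.card C * F (pairSwap c z) ^ p =
      1 / 2 ^ Fintype.card C * ∑ z with count s z.1 + count s z.2 = b, F z ^ p := by
    intro c
    rw [mul_sum]
    refine sum_equiv (pairSwapEquiv c) (fun z => ?_) fun z _ => rfl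
    simp only [mem_filter, mem_univ, true_and, pairSwapEquiv, Equiv.coe_fn_mk,
        count_add_count_pairSwap]
  rw [sum_congr rfl fun c _ => h2 c, ← sum_mul, hcard, one_mul]

theorem sum_filter_eq_sum_pairClass (s : Bool) (b : ℕ) (Γ : (C → Bool) × (C → Bool) → ℝ) :
    ∑ z with count s z.1 + count s z.2 = b, Γ z =
      ∑ j ∈ range (b / 2 + 1), ∑ z ∈ pairClass C s b j, Γ z := by
  rw [← sum_fiberwise_of_maps_to (t := range (b / 2 + 1)) (g := pairCount s)]
  · simp only [filter_filter, pairClass]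
  · intro z hz
    simp only [mem_filter, mem_univ, true_and] at hz
    have := two_mul_pairCount_le s z
    rw [mem_range]; omega

theorem sum_filter_eq_sum_halfClass (s : Bool) (b : ℕ) (Γ : (C → Bool) × (C → Bool) → ℝ) :
    ∑ z with count s z.1 + count s z.2 = b, Γ z =
      ∑ w ∈ range (b + 1), ∑ z ∈ halfClass C s b w, Γ z := by
  rw [← sum_fiberwise_of_maps_to (t := range (b + 1)) (g := fun z => count s z.1)]
  · refine sum_congr rfl fun w hw => sum_congr ?_ fun _ _ => rfl
    rw [mem_range] at hw
    ext z
    simp only [halfClass, mem_filter, mem_product, mem_univ, true_and]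
    omega
  · intro z hz
    simp only [mem_filter, mem_univ, true_and] at hz
    rw [mem_range]; omega

theorem card_filter_count_add_count (s : Bool) {b : ℕ} (hb : b ≤ Fintype.card C) :
    (#{z : (C → Bool) × (C → Bool) | count s z.1 + count s z.2 = b} : ℝ) =
      (2 * Fintype.card C).choose b := by
  have h := sum_filter_eq_sum_pairClass (C := C) s b (fun _ => 1)
  simp only [sum_const, nsmul_eq_mul, mul_one] at h
  rw [h, sum_congr rfl fun j hj => card_pairClass s hb (by rw [mem_range] at hj; omega),
    ← mul_sum, sum_pairProb hb, mul_one]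

theorem sum_div_card_rpow_le {X : Type*} (S : Finset X) {f : X → ℝ} (hf : ∀ x, 0 ≤ f x) {r : ℝ}
    (hr : 1 ≤ r) : ((∑ x ∈ S, f x) / #S) ^ r ≤ (∑ x ∈ S, f x ^ r) / #S := by
  rcases S.eq_empty_or_nonempty with rfl | hS
  · simp [Real.zero_rpow (show r ≠ 0 by linarith)]
  · have hn : (0 : ℝ) < #S := by exact_mod_cast hS.card_pos
    have := Real.rpow_arith_mean_le_arith_mean_rpow S (fun _ => (1 : ℝ) / #S) f
      (fun _ _ => by positivity) (by rw [sum_const, nsmul_eq_mul]; field_simp)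
      (fun x _ => hf x) hr
    rwa [← mul_sum, ← mul_sum, one_div_mul_eq_div, one_div_mul_eq_div] at this

/-- On the configurations with `w` cards in the first half, tensorisation bounds the `L²` norm by a
mean of `g ^ p`, where `g = swapAvg F`. As `g` is invariant under swaps, that mean is `halfAvg` of
the means of `g ^ p` over the classes with `j` full pairs. The channel inequality raises the
exponent from `p` to `p'`, and Jensen's inequality removes the class means and the swap average. -/
theorem Hypercontractive.tensor_swapAvg {T : ((C → Bool) → ℝ) → (C → Bool) → ℝ} {a a' ε : ℝ}
    (ha1 : a ≤ 1) (ha' : 0 < a') (haa : a' < a) (haε : a' ≤ a * (1 - ε))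
    (hC : Contracts (Fintype.card C) a ε) (s : Bool)
    (h : ∀ w, Hypercontractive T (2 / (1 + a)) {u | count s u = w})
    (hT : ∀ f : (C → Bool) → ℝ, (∀ x, 0 ≤ f x) → ∀ x, 0 ≤ T f x) {b : ℕ}
    (hb : b ≤ Fintype.card C) :
    Hypercontractive (fun F => tensorOp T T (swapAvg F)) (2 / (1 + a'))
      {z | count s z.1 + count s z.2 = b} := by
  refine hypercontractive_of_sum_le fun hne F hF => ?_
  set D := Fintype.card C with hD
  have ha0 : 0 < 1 + a := by linarith
  have ha0' : 0 < 1 + a' := by linarith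
  set p := 2 / (1 + a) with hp
  set p' := 2 / (1 + a') with hp'
  have hp0 : 0 < p := by positivity
  have hp2 : p ≤ 2 := div_le_self (by norm_num) (by linarith)
  have hp1' : 1 ≤ p' := by rw [hp', le_div_iff₀ ha0']; linarith
  have e1 : 2 / p = 1 + a := by rw [hp]; field_simp
  have e2 : 2 / p' = 1 + a' := by rw [hp']; field_simp
  have e3 : p * ((1 + a) / (1 + a')) = p' := by rw [hp, hp']; field_simp
  have hr1 : 1 ≤ (1 + a) / (1 + a') := by rw [le_div_iff₀ ha0']; linarith
  have hN := choose_two_mul_pos hb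
  set N : ℝ := ((2 * D).choose b : ℝ) with hNd
  set g := swapAvg F with hg
  have hg0 : ∀ z, 0 ≤ g z := swapAvg_nonneg hF
  have hgp0 : ∀ z, 0 ≤ g z ^ p := fun z => Real.rpow_nonneg (hg0 z) p
  set H : ℕ → ℝ := fun j => (∑ z ∈ pairClass C s b j, g z ^ p) / #(pairClass C s b j) with hH
  have hH0 : ∀ j, 0 ≤ H j := fun j =>
    div_nonneg (sum_nonneg fun z _ => hgp0 z) (Nat.cast_nonneg _)
  have hJ : ∀ j ∈ range (b / 2 + 1), ∀ y : ℝ,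
      pairProb D b j * (y / #(pairClass C s b j)) = y / N := by
    intro j hj y
    rw [mem_range] at hj
    have := pairProb_pos hb (show 2 * j ≤ b by omega)
    have hc : (#(pairClass C s b j) : ℝ) = N * pairProb D b j := card_pairClass s hb (by omega)
    rw [hc]
    field_simp
  have hhalf : ∀ w ∈ range (b + 1), (∑ z ∈ halfClass C s b w, g z ^ p) / #(halfClass C s b w) =
      halfAvg D b H w := by
    intro w hw
    rw [mem_range] at hw
    have hν := halfProb_pos hb (show w ≤ b by omega)
    have hcard : (#(halfClass C s b w) : ℝ) = N * halfProb D b w := by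
      rw [card_halfClass, halfProb, mul_div_cancel₀ _ hN.ne']; push_cast; rfl
    rw [hcard, halfAvg, ← div_div]
    congr 1
    rw [sum_halfClass_eq s (by omega) (fun c z => by rw [hg, swapAvg_pairSwap]), sum_div]
    refine sum_congr rfl fun j hj => ?_
    rw [mul_right_comm, show pairProb D b j * H j = _ from hJ j hj _]
    ring
  have hstep : ∀ w ∈ range (b + 1), ∑ z ∈ halfClass C s b w, tensorOp T T g z ^ 2 ≤
      N * (halfProb D b w * halfAvg D b H w ^ (1 + a)) := by
    intro w hw
    have h1 := ((h w).tensor hp0 hp2 (h (b - w)) hT).sum_le hg0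
    rw [← halfClass, hhalf w hw, e1] at h1
    refine h1.trans_eq ?_
    rw [← mul_assoc, halfProb, mul_div_cancel₀ _ hN.ne', card_halfClass]
    push_cast; rfl
  have hlast : ∑ j ∈ range (b / 2 + 1), pairProb D b j * H j ^ ((1 + a) / (1 + a')) ≤
      (∑ z with count s z.1 + count s z.2 = b, F z ^ p') / N := by
    calc _ ≤ ∑ j ∈ range (b / 2 + 1), (∑ z ∈ pairClass C s b j, g z ^ p') / N := by
          refine sum_le_sum fun j hj => ?_
          rw [← hJ j hj]
          refine mul_le_mul_of_nonneg_left ?_ (pairProb_nonneg _ _ _)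
          refine (sum_div_card_rpow_le _ hgp0 hr1).trans_eq ?_
          simp only [← Real.rpow_mul (hg0 _), e3]
      _ = (∑ z with count s z.1 + count s z.2 = b, g z ^ p') / N := by
          rw [sum_filter_eq_sum_pairClass, sum_div]
      _ ≤ _ := div_le_div_of_nonneg_right (sum_swapAvg_rpow_le hF hp1' s b) hN.le
  rw [card_filter_count_add_count s hb, e2, sum_filter_eq_sum_halfClass]
  refine (sum_le_sum hstep).trans ?_
  rw [← mul_sum]
  refine mul_le_mul_of_nonneg_left ?_ hN.le
  refine (sum_halfProb_mul_halfAvg_rpow_le hb ha' haa haε hC hH0).trans ?_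
  exact Real.rpow_le_rpow (sum_nonneg fun j _ => mul_nonneg (pairProb_nonneg _ _ _)
    (Real.rpow_nonneg (hH0 j) _)) hlast ha0'.le

theorem hypercontractive_empty {X : Type*} (T : (X → ℝ) → X → ℝ) (p : ℝ) :
    Hypercontractive T p ∅ :=
  hypercontractive_of_sum_le fun h => absurd h (by simp)

/-- If more than half of the vertices are occupied, occupied and empty vertices exchange roles; the
swaps do not distinguish them. -/
theorem Hypercontractive.tensor_swapAvg_of_count_true {T : ((C → Bool) → ℝ) → (C → Bool) → ℝ}
    {a a' ε : ℝ} (ha1 : a ≤ 1) (ha' : 0 < a') (haa : a' < a) (haε : a' ≤ a * (1 - ε))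
    (hC : Contracts (Fintype.card C) a ε)
    (h : ∀ w, Hypercontractive T (2 / (1 + a)) {u | count true u = w})
    (hT : ∀ f : (C → Bool) → ℝ, (∀ x, 0 ≤ f x) → ∀ x, 0 ≤ T f x) (b : ℕ) :
    Hypercontractive (fun F => tensorOp T T (swapAvg F)) (2 / (1 + a'))
      {z | count true z.1 + count true z.2 = b} := by
  rcases le_or_gt b (Fintype.card C) with hb | hb
  · exact Hypercontractive.tensor_swapAvg ha1 ha' haa haε hC true h hT hb
  rcases le_or_gt b (2 * Fintype.card C) with hb2 | hb2
  · have h' : ∀ w, Hypercontractive T (2 / (1 + a)) {u | count false u = w} := by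
      intro w
      rcases le_or_gt w (Fintype.card C) with hw | hw
      · convert h (Fintype.card C - w) using 1
        ext u
        have := count_le true u
        simp only [mem_filter, mem_univ, true_and, count_false_eq]
        omega
      · convert hypercontractive_empty T _
        ext u
        have := count_le false u
        simp only [mem_filter, mem_univ, true_and, notMem_empty, iff_false]
        omega
    convert Hypercontractive.tensor_swapAvg ha1 ha' haa haε hC false h' hT (b := 2 * Fintype.card C - b) (by omega)
      using 1
    ext z
    have h1 := count_le true z.1
    have h2 := count_le true z.2
    simp only [mem_filter, mem_univ, true_and, count_false_eq]
    omega
  · convert hypercontractive_empty _ _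
    ext z
    have h1 := count_le true z.1
    have h2 := count_le true z.2
    simp only [mem_filter, mem_univ, true_and, notMem_empty, iff_false]
    omega

end SwapAvg
end ThorpShuffle

/-! ### The shuffle as an operator on functions of the set of occupied vertices. -/

namespace ThorpShuffle
open Finset

/-- A set of occupied vertices of the hypercube. -/
abbrev Conf (d : ℕ) : Type := Cube d → Bool

/-- The flip of the edges in direction `j` for which `c` is `true` at the lower endpoint. -/
def flipMove {d : ℕ} (j : Fin d) (c : Cube d → Bool) (y : Cube d) : Cube d :=
  if c (Function.update y j false) = true then Function.update y j (!y j) else y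

/-- The average over the coin assignments to the edges in direction `j`, as an operator on functions
of the set of occupied vertices. -/
noncomputable def ringOp {d : ℕ} (j : Fin d) : (Conf d → ℝ) →ₗ[ℝ] (Conf d → ℝ) where
  toFun F x := (∑ c : Cube d → Bool, F (x ∘ flipMove j c)) / 2 ^ 2 ^ d
  map_add' F G := by funext x; simp only [Pi.add_apply, sum_add_distrib, add_div]
  map_smul' r F := by
    funext x; simp only [Pi.smul_apply, smul_eq_mul, ← mul_sum, mul_div_assoc, RingHom.id_apply]

theorem ringOp_apply {d : ℕ} (j : Fin d) (F : Conf d → ℝ) (x : Conf d) :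
    ringOp j F x = (∑ c : Cube d → Bool, F (x ∘ flipMove j c)) / 2 ^ 2 ^ d := rfl

/-- Apply the operators `ringOp j` for `j` in the list `l`, the head of the list first. -/
noncomputable def shuffleOp {d : ℕ} : List (Fin d) → (Conf d → ℝ) →ₗ[ℝ] (Conf d → ℝ)
  | [] => LinearMap.id
  | j :: l => shuffleOp l ∘ₗ ringOp j

theorem ringOp_nonneg {d : ℕ} (j : Fin d) {F : Conf d → ℝ} (hF : ∀ x, 0 ≤ F x) (x : Conf d) :
    0 ≤ ringOp j F x :=
  div_nonneg (sum_nonneg fun _ _ => hF _) (by positivity)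

theorem shuffleOp_nonneg {d : ℕ} (l : List (Fin d)) {F : Conf d → ℝ} (hF : ∀ x, 0 ≤ F x)
    (x : Conf d) : 0 ≤ shuffleOp l F x := by
  induction l generalizing F with
  | nil => exact hF x
  | cons j l ih => exact ih (ringOp_nonneg j hF)

/-- The configurations on the two halves of the hypercube with given coordinate `i`. -/
def splitEquiv {d : ℕ} (i : Fin (d + 1)) : Conf (d + 1) ≃ Conf d × Conf d where
  toFun x := (fun y => x (i.insertNth false y), fun y => x (i.insertNth true y))
  invFun z y := if y i = true then z.2 (i.removeNth y) else z.1 (i.removeNth y)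
  left_inv x := by
    funext y
    dsimp only
    split_ifs with h
    · rw [← h, Fin.insertNth_self_removeNth]
    · rw [Bool.not_eq_true] at h
      rw [← h, Fin.insertNth_self_removeNth]
  right_inv z := by
    refine Prod.ext (funext fun y => ?_) (funext fun y => ?_) <;> simp

theorem update_insertNth_succAbove {d : ℕ} (i : Fin (d + 1)) (j : Fin d) (b s : Bool)
    (y : Cube d) : Function.update (i.insertNth b y : Cube (d + 1)) (i.succAbove j) s =
      i.insertNth b (Function.update y j s) := 
  (Fin.insertNth_update (α := fun _ => Bool) i b j s y).symm

theorem flipMove_succAbove {d : ℕ} (i : Fin (d + 1)) (j : Fin d) (c : Conf (d + 1)) (b : Bool)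
    (y : Cube d) : flipMove (i.succAbove j) c (i.insertNth b y) =
      i.insertNth b (flipMove j (fun y => c (i.insertNth b y)) y) := by
  simp only [flipMove, update_insertNth_succAbove, Fin.insertNth_apply_succAbove]
  split_ifs <;> rfl

theorem splitEquiv_comp_flipMove_succAbove {d : ℕ} (i : Fin (d + 1)) (j : Fin d)
    (c x : Conf (d + 1)) : splitEquiv i (x ∘ flipMove (i.succAbove j) c) =
      ((splitEquiv i x).1 ∘ flipMove j (splitEquiv i c).1,
        (splitEquiv i x).2 ∘ flipMove j (splitEquiv i c).2) := by
  refine Prod.ext (funext fun y => ?_) (funext fun y => ?_) <;>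
    simp [splitEquiv, flipMove_succAbove]

theorem splitEquiv_comp_flipMove_self {d : ℕ} (i : Fin (d + 1)) (c x : Conf (d + 1)) :
    splitEquiv i (x ∘ flipMove i c) = pairSwap (splitEquiv i c).1 (splitEquiv i x) := by
  refine Prod.ext (funext fun y => ?_) (funext fun y => ?_) <;>
    simp only [splitEquiv, pairSwap, flipMove, Equiv.coe_fn_mk, Function.comp,
      Fin.update_insertNth, Fin.insertNth_apply_same] <;>
    split_ifs <;> simp_all

/-- Only coins at lower endpoints act; those of the other half contribute a constant factor. -/
theorem ringOp_self {d : ℕ} (i : Fin (d + 1)) (F : Conf (d + 1) → ℝ) (x : Conf (d + 1)) :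
    ringOp i F x = swapAvg (F ∘ (splitEquiv i).symm) (splitEquiv i x) := by
  have h : ∑ c : Cube (d + 1) → Bool, F (x ∘ flipMove i c) =
      ∑ z : Conf d × Conf d, (F ∘ (splitEquiv i).symm) (pairSwap z.1 (splitEquiv i x)) := by
    refine Fintype.sum_equiv (splitEquiv i) _ _ fun c => ?_
    rw [← splitEquiv_comp_flipMove_self, Function.comp_apply, Equiv.symm_apply_apply]
  rw [ringOp_apply, h, swapAvg, Fintype.sum_prod_type]
  simp only [sum_const, card_univ, Fintype.card_fun, Fintype.card_bool, Fintype.card_fin,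
    nsmul_eq_mul]
  rw [← mul_sum, pow_succ 2 d, pow_mul, sq]
  push_cast
  field_simp

theorem ringOp_succAbove {d : ℕ} (i : Fin (d + 1)) (j : Fin d) (F : Conf (d + 1) → ℝ)
    (x : Conf (d + 1)) : ringOp (i.succAbove j) F x =
      tensorOp (ringOp j) (ringOp j) (F ∘ (splitEquiv i).symm) (splitEquiv i x) := by
  have h : ∑ c : Cube (d + 1) → Bool, F (x ∘ flipMove (i.succAbove j) c) =
      ∑ z : Conf d × Conf d, (F ∘ (splitEquiv i).symm)
        ((splitEquiv i x).1 ∘ flipMove j z.1, (splitEquiv i x).2 ∘ flipMove j z.2) := by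
    refine Fintype.sum_equiv (splitEquiv i) _ _ fun c => ?_
    rw [← splitEquiv_comp_flipMove_succAbove, Function.comp_apply, Equiv.symm_apply_apply]
  rw [ringOp_apply, h, Fintype.sum_prod_type_right]
  simp only [tensorOp, ringOp_apply]
  rw [← sum_div, div_div, pow_succ 2 d, pow_mul, sq]

/-- Linearity of `T` allows it to be interchanged with the finite average in the other variable. -/
theorem tensorOp_ringOp_comp {d : ℕ} (T : (Conf d → ℝ) →ₗ[ℝ] (Conf d → ℝ)) (j : Fin d)
    (G : Conf d × Conf d → ℝ) :
    tensorOp (T ∘ₗ ringOp j) (T ∘ₗ ringOp j) G =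
      tensorOp T T (tensorOp (ringOp j) (ringOp j) G) := by
  funext z
  simp only [tensorOp, LinearMap.comp_apply]
  refine congrFun (congrArg T (funext fun y => ?_)) z.2
  rw [ringOp_apply]
  have e : (fun x => ringOp j (fun y => ringOp j (fun x => G (x, y)) x) y) =
      (2 ^ 2 ^ d : ℝ)⁻¹ • ∑ c : Cube d → Bool, ringOp j (fun x => G (x, y ∘ flipMove j c)) := by
    funext x
    rw [ringOp_apply, Pi.smul_apply, Finset.sum_apply, smul_eq_mul, div_eq_inv_mul]
  rw [e, map_smul, map_sum, Pi.smul_apply, Finset.sum_apply, smul_eq_mul, div_eq_inv_mul]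

theorem shuffleOp_map_succAbove {d : ℕ} (i : Fin (d + 1)) (l : List (Fin d))
    (F : Conf (d + 1) → ℝ) (x : Conf (d + 1)) : shuffleOp (l.map i.succAbove) F x =
      tensorOp (shuffleOp l) (shuffleOp l) (F ∘ (splitEquiv i).symm) (splitEquiv i x) := by
  induction l generalizing F x with
  | nil => simp [shuffleOp, tensorOp]
  | cons j l ih =>
    have e : ringOp (i.succAbove j) F ∘ (splitEquiv i).symm =
        tensorOp (ringOp j) (ringOp j) (F ∘ (splitEquiv i).symm) := by
      funext z; rw [Function.comp_apply, ringOp_succAbove, Equiv.apply_symm_apply]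
    rw [List.map_cons, shuffleOp, LinearMap.comp_apply, ih, e, shuffleOp, tensorOp_ringOp_comp]

theorem count_splitEquiv {d : ℕ} (i : Fin (d + 1)) (s : Bool) (x : Conf (d + 1)) :
    count s x = count s (splitEquiv i x).1 + count s (splitEquiv i x).2 := by
  simp only [count_eq_sum]
  rw [← (Fin.insertNthEquiv (fun _ => Bool) i).sum_comp, Fintype.sum_prod_type, Fintype.sum_bool,
    add_comm]
  rfl

theorem hypercontractive_id {X : Type*} {p : ℝ} (hp : p ≠ 0) {S : Finset X} (hS : #S ≤ 1) :
    Hypercontractive (fun f => f) p S := by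
  refine hypercontractive_of_sum_le fun hne f hf => ?_
  obtain ⟨x, rfl⟩ := card_eq_one.1 (le_antisymm hS hne.card_pos)
  simp only [sum_singleton, card_singleton, Nat.cast_one, div_one, one_mul]
  rw [← Real.rpow_mul (hf x), mul_div_cancel₀ _ hp]
  exact le_of_eq (by exact_mod_cast (Real.rpow_natCast _ 2).symm)

/-- Direction 0 is averaged first and pairs the two halves; the other directions act independently
in each half as the shuffle of one dimension less. In dimension 0 each class has at most one
configuration. -/
theorem hypercontractive_shuffleOp_finRange {α : ℕ → ℝ} (hα0 : ∀ n, 0 < α n) (hα1 : ∀ n, α n ≤ 1)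
    (hα : ∀ n, α (n + 1) < α n ∧ ∃ ε, α (n + 1) ≤ α n * (1 - ε) ∧ Contracts (2 ^ n) (α n) ε)
    (n w : ℕ) :
    Hypercontractive (shuffleOp (List.finRange n)) (2 / (1 + α n)) {x | count true x = w} := by
  induction n generalizing w with
  | zero =>
    have h0 := hα0 0
    refine hypercontractive_id (by positivity) (card_le_one.2 fun x hx y hy => ?_)
    funext z
    simp only [mem_filter, mem_univ, true_and, count_eq_sum, Fintype.sum_subsingleton _ z] at hx hy
    rw [← hy] at hx
    rcases h1 : x z with _ | _ <;> rcases h2 : y z with _ | _ <;>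
      rw [h1, h2] at hx <;> first | rfl | simp at hx
  | succ n ih =>
    obtain ⟨h1, ε, h2, h3⟩ := hα n
    have hc : Fintype.card (Cube n) = 2 ^ n := by simp
    have := Hypercontractive.tensor_swapAvg_of_count_true (C := Cube n) (hα1 n) (hα0 (n + 1)) h1 h2
      (by rw [hc]; exact h3) ih (fun f hf => shuffleOp_nonneg _ hf) w
    refine this.of_equiv (splitEquiv 0) (fun F x => ?_) fun x => ?_
    · have e : ringOp 0 F ∘ (splitEquiv 0).symm = swapAvg (F ∘ (splitEquiv 0).symm) := by
        funext z; rw [Function.comp_apply, ringOp_self, Equiv.apply_symm_apply]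
      rw [List.finRange_succ, shuffleOp, LinearMap.comp_apply, ← Fin.succAbove_zero,
        shuffleOp_map_succAbove, e]
    · simp only [mem_filter, mem_univ, true_and]
      rw [← count_splitEquiv]

/-- The directions below `k`. -/
def directions (d k : ℕ) : List (Fin d) := (List.finRange d).filter fun j : Fin d => (j : ℕ) < k

/-- The number of occupied vertices that agree with `y` from the `k`-th coordinate on. -/
def cubeCount {d : ℕ} (k : ℕ) (x : Conf d) (y : Cube d) : ℕ :=
  #{y' | x y' = true ∧ ∀ i : Fin d, k ≤ (i : ℕ) → y' i = y i}

theorem directions_self (k : ℕ) : directions k k = List.finRange k := by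
  simp [directions]

theorem directions_succ {d k : ℕ} (hk : k ≤ d) :
    directions (d + 1) k = (directions d k).map (Fin.last d).succAbove := by
  rw [directions, List.finRange_succ_last, List.filter_append, List.filter_map, directions,
    Fin.succAbove_last]
  simp only [List.filter_singleton, Fin.val_last, not_lt.2 hk, decide_false]
  simp [Function.comp_def]

theorem cubeCount_self {k : ℕ} (x : Conf k) (y : Cube k) : cubeCount k x y = count true x := by
  rw [cubeCount, count]
  congr 1
  ext y'
  simp only [mem_filter, mem_univ, true_and, and_iff_left_iff_imp]
  exact fun _ i hi => absurd i.2 (not_lt.2 hi)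

theorem cubeCount_insertNth {d k : ℕ} (hk : k ≤ d) (x : Conf (d + 1)) (y : Cube d) (b : Bool) :
    cubeCount k x ((Fin.last d).insertNth b y) =
      cubeCount k (fun y => x ((Fin.last d).insertNth b y)) y := by
  rw [cubeCount, cubeCount]
  refine (card_nbij' (fun y => (Fin.last d).insertNth b y) (fun y => (Fin.last d).removeNth y)
    ?_ ?_ ?_ ?_).symm
  · intro y' hy'
    simp only [coe_filter, mem_univ, true_and, Set.mem_ofPred_eq] at hy' ⊢
    refine ⟨hy'.1, fun i => ?_⟩
    refine Fin.lastCases (fun _ => by simp) (fun i hi => ?_) i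
    have := hy'.2 i hi
    simpa using this
  · intro y' hy'
    simp only [coe_filter, mem_univ, true_and, Set.mem_ofPred_eq] at hy' ⊢
    have hb : y' (Fin.last d) = b := by simpa using hy'.2 (Fin.last d) hk
    refine ⟨by rw [← hb, Fin.insertNth_self_removeNth]; exact hy'.1, fun i hi => ?_⟩
    simpa [Fin.removeNth] using hy'.2 i.castSucc hi
  · intro y' _; simp
  · intro y' hy'
    simp only [coe_filter, mem_univ, true_and, Set.mem_ofPred_eq] at hy'
    have hb : y' (Fin.last d) = b := by simpa using hy'.2 (Fin.last d) hk
    dsimp only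
    rw [← hb, Fin.insertNth_self_removeNth]

/-- The configurations with the same number of occupied vertices as `x₀` in every subcube. -/
def confClass {d : ℕ} (k : ℕ) (x₀ : Conf d) : Finset (Conf d) :=
  {x | ∀ y, cubeCount k x y = cubeCount k x₀ y}

/-- An inactive last coordinate splits the operator into a tensor product, and tensorisation keeps
the exponent. Hence only the number `k` of active directions matters. -/
theorem hypercontractive_shuffleOp {α : ℕ → ℝ} (hα0 : ∀ n, 0 < α n) (hα1 : ∀ n, α n ≤ 1)
    (hα : ∀ n, α (n + 1) < α n ∧ ∃ ε, α (n + 1) ≤ α n * (1 - ε) ∧ Contracts (2 ^ n) (α n) ε)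
    {d k : ℕ} (hk : k ≤ d) (x₀ : Conf d) :
    Hypercontractive (shuffleOp (directions d k)) (2 / (1 + α k)) (confClass k x₀) := by
  induction d, hk using Nat.le_induction with
  | base =>
    rw [directions_self]
    convert hypercontractive_shuffleOp_finRange hα0 hα1 hα k (count true x₀) using 1
    ext x
    simp [confClass, cubeCount_self]
  | succ d hk ih =>
    have hp : 0 < 2 / (1 + α k) := by have := hα0 k; positivity
    have hp2 : 2 / (1 + α k) ≤ 2 := div_le_self (by norm_num) (by linarith [hα0 k])
    have := (ih (splitEquiv (Fin.last d) x₀).1).tensor hp hp2 (ih (splitEquiv (Fin.last d) x₀).2)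
      (fun f hf => shuffleOp_nonneg _ hf)
    refine this.of_equiv (splitEquiv (Fin.last d)) (fun F x => ?_) fun x => ?_
    · rw [directions_succ hk, shuffleOp_map_succAbove]
    · simp only [confClass, mem_filter, mem_univ, true_and, mem_product]
      constructor
      · intro h
        have h' : ∀ b y, _ := fun b y => h ((Fin.last d).insertNth b y)
        simp only [cubeCount_insertNth hk] at h'
        exact ⟨h' false, h' true⟩
      · rintro ⟨h1, h2⟩ y
        rw [← Fin.insertNth_self_removeNth (Fin.last d) y, cubeCount_insertNth hk,
          cubeCount_insertNth hk]
        cases y (Fin.last d)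
        · exact h1 _
        · exact h2 _

end ThorpShuffle

/-! ### Decay of the `L²` norm under the zigzag chain. -/

namespace ThorpShuffle
open Finset

theorem flipMove_flipMove {d : ℕ} (j : Fin d) (c : Cube d → Bool) (y : Cube d) :
    flipMove j c (flipMove j c y) = y := by
  unfold flipMove
  by_cases h : c (Function.update y j false) = true <;> simp [h]

/-- `flipMove` as a permutation of the vertices. -/
def flipEquiv {d : ℕ} (j : Fin d) (c : Cube d → Bool) : Cube d ≃ Cube d :=
  ⟨flipMove j c, flipMove j c, flipMove_flipMove j c, flipMove_flipMove j c⟩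

theorem sum_comp_flipMove {d : ℕ} (j : Fin d) (c : Cube d → Bool) (F : Conf d → ℝ) :
    ∑ x : Conf d, F (x ∘ flipMove j c) = ∑ x, F x :=
  ((flipEquiv j c).symm.arrowCongr (Equiv.refl Bool)).sum_comp F

theorem flipMove_apply_of_ne {d : ℕ} {i j : Fin d} (h : i ≠ j) (c : Cube d → Bool) (y : Cube d) :
    flipMove j c y i = y i := by
  unfold flipMove; split_ifs <;> simp [h]

theorem cubeCount_comp_flipMove {d k : ℕ} {j : Fin d} (hj : (j : ℕ) < k) (c : Cube d → Bool)
    (x : Conf d) (y : Cube d) : cubeCount k (x ∘ flipMove j c) y = cubeCount k x y := by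
  refine card_equiv (flipEquiv j c) fun y' => ?_
  simp only [mem_filter, mem_univ, true_and, flipEquiv, Equiv.coe_fn_mk, Function.comp]
  refine and_congr_right fun _ => forall_congr' fun i => imp_congr_right fun hi => ?_
  rw [flipMove_apply_of_ne (by rintro rfl; omega)]

theorem mem_confClass {d k : ℕ} {x x₀ : Conf d} :
    x ∈ confClass k x₀ ↔ ∀ y, cubeCount k x y = cubeCount k x₀ y := by
  simp [confClass]

theorem mem_confClass_comp_flipMove {d k : ℕ} {j : Fin d} (hj : (j : ℕ) < k) (c : Cube d → Bool)
    {x x₀ : Conf d} : x ∘ flipMove j c ∈ confClass k x₀ ↔ x ∈ confClass k x₀ := by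
  simp only [mem_confClass, cubeCount_comp_flipMove hj]

theorem sum_ringOp_mul {d : ℕ} (j : Fin d) (F G : Conf d → ℝ) :
    ∑ x, ringOp j F x * G x = ∑ x, F x * ringOp j G x := by
  simp only [ringOp_apply, div_mul_eq_mul_div, mul_div_assoc', ← sum_div, sum_mul, mul_sum]
  congr 1
  rw [sum_comm]
  refine Eq.trans (sum_congr rfl fun c _ => ?_) sum_comm
  rw [← sum_comp_flipMove j c]
  refine sum_congr rfl fun x _ => ?_
  congr 2
  funext y
  simp [flipMove_flipMove]

theorem sum_ringOp_sq_le {d : ℕ} (j : Fin d) (F : Conf d → ℝ) :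
    ∑ x, ringOp j F x ^ 2 ≤ ∑ x, F x ^ 2 := by
  have hM : (0 : ℝ) < 2 ^ 2 ^ d := by positivity
  have hcard : (#(univ : Finset (Cube d → Bool)) : ℝ) = 2 ^ 2 ^ d := by simp
  have h1 : ∀ x, ringOp j F x ^ 2 ≤ (∑ c : Cube d → Bool, F (x ∘ flipMove j c) ^ 2) / 2 ^ 2 ^ d := by
    intro x
    rw [ringOp_apply, div_pow, div_le_div_iff₀ (by positivity) hM]
    have := sq_sum_le_card_mul_sum_sq (s := univ) (f := fun c : Cube d → Bool => F (x ∘ flipMove j c))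
    rw [hcard] at this
    nlinarith
  refine (sum_le_sum fun x _ => h1 x).trans (le_of_eq ?_)
  rw [← sum_div, sum_comm]
  have h2 : ∀ c ∈ (univ : Finset (Cube d → Bool)), ∑ x : Conf d, F (x ∘ flipMove j c) ^ 2 =
      ∑ x, F x ^ 2 := fun c _ => sum_comp_flipMove j c (fun x => F x ^ 2)
  rw [sum_congr rfl h2, sum_const, nsmul_eq_mul, hcard, mul_div_cancel_left₀ _ hM.ne']

theorem ringOp_one {d : ℕ} (j : Fin d) : ringOp j (fun _ => 1) = fun _ => 1 := by
  funext x; simp [ringOp_apply]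

theorem ringOp_eq_zero {d k : ℕ} {j : Fin d} (hj : (j : ℕ) < k) {x₀ : Conf d} {F : Conf d → ℝ}
    (hF : ∀ x ∉ confClass k x₀, F x = 0) : ∀ x ∉ confClass k x₀, ringOp j F x = 0 := by
  intro x hx
  rw [ringOp_apply, sum_eq_zero, zero_div]
  exact fun c _ => hF _ fun h => hx ((mem_confClass_comp_flipMove hj c).1 h)

/-- The adjoint of `shuffleOp`: the head of the list is applied last. -/
noncomputable def unshuffleOp {d : ℕ} : List (Fin d) → (Conf d → ℝ) →ₗ[ℝ] (Conf d → ℝ)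
  | [] => LinearMap.id
  | j :: l => ringOp j ∘ₗ unshuffleOp l

theorem unshuffleOp_nonneg {d : ℕ} (l : List (Fin d)) {F : Conf d → ℝ} (hF : ∀ x, 0 ≤ F x)
    (x : Conf d) : 0 ≤ unshuffleOp l F x := by
  induction l generalizing x with
  | nil => exact hF x
  | cons j l ih => exact ringOp_nonneg j ih x

theorem sum_shuffleOp_mul {d : ℕ} (l : List (Fin d)) (F G : Conf d → ℝ) :
    ∑ x, shuffleOp l F x * G x = ∑ x, F x * unshuffleOp l G x := by
  induction l generalizing F with
  | nil => rfl
  | cons j l ih =>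
    rw [shuffleOp, unshuffleOp, LinearMap.comp_apply, LinearMap.comp_apply, ih, sum_ringOp_mul]

theorem sum_shuffleOp_sq_le {d : ℕ} (l : List (Fin d)) (F : Conf d → ℝ) :
    ∑ x, shuffleOp l F x ^ 2 ≤ ∑ x, F x ^ 2 := by
  induction l generalizing F with
  | nil => exact le_rfl
  | cons j l ih => exact (ih _).trans (sum_ringOp_sq_le j F)

theorem sum_unshuffleOp_sq_le {d : ℕ} (l : List (Fin d)) (F : Conf d → ℝ) :
    ∑ x, unshuffleOp l F x ^ 2 ≤ ∑ x, F x ^ 2 := by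
  induction l with
  | nil => exact le_rfl
  | cons j l ih => exact (sum_ringOp_sq_le j _).trans ih

theorem shuffleOp_one {d : ℕ} (l : List (Fin d)) : shuffleOp l (fun _ => 1) = fun _ => 1 := by
  induction l with
  | nil => rfl
  | cons j l ih => rw [shuffleOp, LinearMap.comp_apply, ringOp_one, ih]

theorem unshuffleOp_one {d : ℕ} (l : List (Fin d)) : unshuffleOp l (fun _ => 1) = fun _ => 1 := by
  induction l with
  | nil => rfl
  | cons j l ih => rw [unshuffleOp, LinearMap.comp_apply, ih, ringOp_one]

theorem shuffleOp_eq_zero {d k : ℕ} {l : List (Fin d)} (hl : ∀ j ∈ l, (j : ℕ) < k) {x₀ : Conf d}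
    {F : Conf d → ℝ} (hF : ∀ x ∉ confClass k x₀, F x = 0) :
    ∀ x ∉ confClass k x₀, shuffleOp l F x = 0 := by
  induction l generalizing F with
  | nil => exact hF
  | cons j l ih =>
    exact ih (fun i hi => hl i (List.mem_cons_of_mem _ hi)) (ringOp_eq_zero (hl j (by simp)) hF)

theorem unshuffleOp_eq_zero {d k : ℕ} {l : List (Fin d)} (hl : ∀ j ∈ l, (j : ℕ) < k) {x₀ : Conf d}
    {F : Conf d → ℝ} (hF : ∀ x ∉ confClass k x₀, F x = 0) :
    ∀ x ∉ confClass k x₀, unshuffleOp l F x = 0 := by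
  induction l with
  | nil => exact hF
  | cons j l ih =>
    exact ringOp_eq_zero (hl j (by simp)) (ih fun i hi => hl i (List.mem_cons_of_mem _ hi))

theorem lt_of_mem_directions {d k : ℕ} : ∀ j ∈ directions d k, (j : ℕ) < k := by
  simp [directions]

/-- The zigzag shuffle, as an operator on functions of the set of occupied vertices. -/
noncomputable def zigzagOp (d k : ℕ) : (Conf d → ℝ) →ₗ[ℝ] (Conf d → ℝ) :=
  unshuffleOp (directions d k) ∘ₗ shuffleOp (directions d k)

theorem zigzagOp_apply (d k : ℕ) (F : Conf d → ℝ) :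
    zigzagOp d k F = unshuffleOp (directions d k) (shuffleOp (directions d k) F) := rfl

theorem sum_zigzagOp_mul {d : ℕ} (k : ℕ) (F G : Conf d → ℝ) :
    ∑ x, zigzagOp d k F x * G x = ∑ x, F x * zigzagOp d k G x := by
  rw [zigzagOp_apply, zigzagOp_apply, ← sum_shuffleOp_mul]
  simp only [mul_comm _ (G _)]
  rw [← sum_shuffleOp_mul]
  exact sum_congr rfl fun x _ => mul_comm _ _

theorem sum_iterate_zigzagOp_mul {d : ℕ} (k n : ℕ) (F G : Conf d → ℝ) :
    ∑ x, (zigzagOp d k)^[n] F x * G x = ∑ x, F x * (zigzagOp d k)^[n] G x := by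
  induction n generalizing F with
  | zero => rfl
  | succ n ih => rw [Function.iterate_succ_apply, ih, Function.iterate_succ_apply', sum_zigzagOp_mul]

theorem sum_iterate_zigzagOp {d : ℕ} (k n : ℕ) (F : Conf d → ℝ) :
    ∑ x, (zigzagOp d k)^[n] F x = ∑ x, F x := by
  have h1 : (zigzagOp d k)^[n] (fun _ => 1) = fun _ => 1 := by
    refine Function.iterate_fixed ?_ n
    rw [zigzagOp_apply, shuffleOp_one, unshuffleOp_one]
  simpa [h1] using sum_iterate_zigzagOp_mul k n F (fun _ => 1)

theorem iterate_zigzagOp_nonneg {d : ℕ} (k n : ℕ) {F : Conf d → ℝ} (hF : ∀ x, 0 ≤ F x)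
    (x : Conf d) : 0 ≤ (zigzagOp d k)^[n] F x := by
  induction n generalizing x with
  | zero => exact hF x
  | succ n ih =>
    rw [Function.iterate_succ_apply', zigzagOp_apply]
    exact unshuffleOp_nonneg _ (shuffleOp_nonneg _ ih) x

theorem iterate_zigzagOp_eq_zero {d : ℕ} (k n : ℕ) {x₀ : Conf d} {F : Conf d → ℝ}
    (hF : ∀ x ∉ confClass k x₀, F x = 0) : ∀ x ∉ confClass k x₀, (zigzagOp d k)^[n] F x = 0 := by
  induction n with
  | zero => exact hF
  | succ n ih =>
    rw [Function.iterate_succ_apply', zigzagOp_apply]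
    exact unshuffleOp_eq_zero lt_of_mem_directions (shuffleOp_eq_zero lt_of_mem_directions ih)

/-- Jensen's inequality for the concave power `p - 1`, with the values of `f` themselves as weights.
-/
theorem sum_rpow_le_of_sum_eq_one {X : Type*} (S : Finset X) {f : X → ℝ} (hf : ∀ x, 0 ≤ f x)
    (h1 : ∑ x ∈ S, f x = 1) {p : ℝ} (hp1 : 1 ≤ p) (hp2 : p ≤ 2) :
    ∑ x ∈ S, f x ^ p ≤ (∑ x ∈ S, f x ^ 2) ^ (p - 1) := by
  have := (Real.concaveOn_rpow (show 0 ≤ p - 1 by linarith) (by linarith)).le_map_sum (t := S)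
    (w := f) (p := f) (fun x _ => hf x) h1 (fun x _ => hf x)
  simp only [smul_eq_mul] at this
  simp only [sq]
  refine le_trans (le_of_eq (sum_congr rfl fun x _ => ?_)) this
  conv_lhs => rw [show p = 1 + (p - 1) by ring]
  rw [Real.rpow_add_of_nonneg (hf x) zero_le_one (by linarith), Real.rpow_one]

/-- The reversed half of the step contracts `L²`, the forward half is hypercontractive, and
interpolation returns from `L^p` to `L²`. The exponents combine to `(p - 1) (1 + a) = 1 - a`. -/
theorem card_mul_sum_sq_le {d k : ℕ} {a : ℝ} (ha0 : 0 < a) (ha1 : a ≤ 1) {x₀ : Conf d}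
    (h : Hypercontractive (shuffleOp (directions d k)) (2 / (1 + a)) (confClass k x₀))
    {f : Conf d → ℝ} (hf : ∀ x, 0 ≤ f x) (hS : ∀ x ∉ confClass k x₀, f x = 0)
    (h1 : ∑ x, f x = 1) :
    #(confClass k x₀) * ∑ x, zigzagOp d k f x ^ 2 ≤
      (#(confClass k x₀) * ∑ x, f x ^ 2) ^ (1 - a) := by
  set S := confClass k x₀ with hSd
  have hsum : ∀ g : Conf d → ℝ, (∀ x ∉ S, g x = 0) → ∑ x, g x = ∑ x ∈ S, g x := fun g hg =>
    (sum_subset (subset_univ S) fun x _ hx => hg x hx).symm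
  have hne : S.Nonempty := ⟨x₀, mem_confClass.2 fun _ => rfl⟩
  have hN : (0 : ℝ) < #S := by exact_mod_cast hne.card_pos
  set p := 2 / (1 + a) with hp
  have ha : 0 < 1 + a := by linarith
  have hp1 : 1 ≤ p := by rw [hp, le_div_iff₀ ha]; linarith
  have hp2 : p ≤ 2 := div_le_self (by norm_num) (by linarith)
  have e1 : 2 / p = 1 + a := by rw [hp]; field_simp
  have e2 : (p - 1) * (1 + a) = 1 - a := by rw [hp]; field_simp; ring
  rw [hsum f hS] at h1
  have hTf : ∀ x ∉ S, shuffleOp (directions d k) f x ^ 2 = 0 := fun x hx => by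
    rw [shuffleOp_eq_zero lt_of_mem_directions hS x hx]; norm_num
  have h2 : ∑ x, zigzagOp d k f x ^ 2 ≤ #S * ((∑ x ∈ S, f x ^ p) / #S) ^ (1 + a) := by
    refine (sum_unshuffleOp_sq_le _ _).trans ?_
    rw [hsum _ hTf, ← e1]
    exact h.sum_le hf
  set A := ∑ x ∈ S, f x ^ 2 with hA
  have hA0 : 0 ≤ A := sum_nonneg fun x _ => sq_nonneg _
  have h3 : ((∑ x ∈ S, f x ^ p) / #S) ^ (1 + a) ≤ (A ^ (p - 1) / #S) ^ (1 + a) := by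
    refine Real.rpow_le_rpow (div_nonneg (sum_nonneg fun x _ => Real.rpow_nonneg (hf x) _) hN.le)
      (div_le_div_of_nonneg_right ?_ hN.le) ha.le
    exact sum_rpow_le_of_sum_eq_one S hf h1 hp1 hp2
  have h4 : (A ^ (p - 1) / #S) ^ (1 + a) = A ^ (1 - a) / (#S : ℝ) ^ (1 + a) := by
    rw [Real.div_rpow (Real.rpow_nonneg hA0 _) hN.le, ← Real.rpow_mul hA0, e2]
  rw [hsum (fun x => f x ^ 2) fun x hx => by simp only [hS x hx]; norm_num, Real.mul_rpow hN.le hA0,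
    show 1 - a = 2 - (1 + a) by ring, Real.rpow_sub hN, show 2 - (1 + a) = 1 - a by ring]
  calc _ ≤ (#S : ℝ) * (#S * (A ^ (1 - a) / (#S : ℝ) ^ (1 + a))) := by
        refine mul_le_mul_of_nonneg_left (h2.trans ?_) hN.le
        exact mul_le_mul_of_nonneg_left (h3.trans_eq h4) hN.le
    _ = _ := by
      have : (#S : ℝ) ^ (2 : ℝ) = #S * #S := by rw [Real.rpow_two, sq]
      rw [this]; ring

theorem card_mul_sum_iterate_sq_le {d k : ℕ} {a : ℝ} (ha0 : 0 < a) (ha1 : a ≤ 1) {x₀ : Conf d}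
    (h : Hypercontractive (shuffleOp (directions d k)) (2 / (1 + a)) (confClass k x₀))
    {y : Conf d} (hy : y ∈ confClass k x₀) (n : ℕ) :
    #(confClass k x₀) * ∑ x, (zigzagOp d k)^[n] (Pi.single y 1) x ^ 2 ≤
      (#(confClass k x₀) : ℝ) ^ ((1 - a) ^ n) := by
  have hf0 : ∀ x, (0 : ℝ) ≤ (Pi.single y 1 : Conf d → ℝ) x := fun x => by
    by_cases hx : x = y
    · subst hx; simp
    · simp [hx]
  have hS : ∀ x ∉ confClass k x₀, (Pi.single y 1 : Conf d → ℝ) x = 0 := fun x hx =>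
    Pi.single_eq_of_ne (by rintro rfl; exact hx hy) _
  induction n with
  | zero => simp [Pi.single_apply]
  | succ n ih =>
    rw [Function.iterate_succ_apply']
    refine (card_mul_sum_sq_le ha0 ha1 h (iterate_zigzagOp_nonneg k n hf0)
      (iterate_zigzagOp_eq_zero k n hS) ?_).trans ?_
    · rw [sum_iterate_zigzagOp]; simp
    · rw [pow_succ, Real.rpow_mul (Nat.cast_nonneg _)]
      exact Real.rpow_le_rpow (mul_nonneg (Nat.cast_nonneg _)
        (sum_nonneg fun _ _ => sq_nonneg _)) ih (by linarith)

/-- By self-adjointness the return value is an inner product of two evolved point masses, each run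
for about half the time. -/
theorem iterate_zigzagOp_single_le {d k : ℕ} {a : ℝ} (ha0 : 0 < a) (ha1 : a ≤ 1) {x₀ : Conf d}
    (h : Hypercontractive (shuffleOp (directions d k)) (2 / (1 + a)) (confClass k x₀))
    {y : Conf d} (hy : y ∈ confClass k x₀) (n : ℕ) :
    #(confClass k x₀) * (zigzagOp d k)^[n] (Pi.single y 1) x₀ ≤
      (#(confClass k x₀) : ℝ) ^ ((1 - a) ^ (n / 2)) := by
  set s := n / 2 with hs
  have hx₀ : x₀ ∈ confClass k x₀ := mem_confClass.2 fun _ => rfl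
  set f := (zigzagOp d k)^[s] (Pi.single x₀ 1) with hf
  set g := (zigzagOp d k)^[n - s] (Pi.single y 1) with hg
  have e : (zigzagOp d k)^[n] (Pi.single y 1) x₀ = ∑ x, f x * g x := by
    rw [hf, sum_iterate_zigzagOp_mul, hg, ← Function.iterate_add_apply,
      show s + (n - s) = n by omega, sum_eq_single x₀]
    · simp
    · intro x _ hx; simp [hx]
    · simp
  have hfs := card_mul_sum_iterate_sq_le ha0 ha1 h hx₀ s
  have hgs : #(confClass k x₀) * ∑ x, g x ^ 2 ≤ (#(confClass k x₀) : ℝ) ^ ((1 - a) ^ s) := by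
    refine le_trans ?_ (card_mul_sum_iterate_sq_le ha0 ha1 h hy s)
    refine mul_le_mul_of_nonneg_left ?_ (Nat.cast_nonneg _)
    -- For odd `n` one factor runs one step longer; the extra step does not increase the `L²` norm.
    rcases (by omega : n - s = s ∨ n - s = s + 1) with h' | h'
    · rw [hg, h']
    · rw [hg, h', Function.iterate_succ_apply', zigzagOp_apply]
      exact (sum_unshuffleOp_sq_le _ _).trans (sum_shuffleOp_sq_le _ _)
  have hfg : ∑ x, f x * g x ≤ (∑ x, f x ^ 2 + ∑ x, g x ^ 2) / 2 := by
    rw [← sum_add_distrib, sum_div]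
    exact sum_le_sum fun x _ => by nlinarith [sq_nonneg (f x - g x)]
  rw [e]
  have := mul_le_mul_of_nonneg_left hfg (Nat.cast_nonneg (α := ℝ) #(confClass k x₀))
  linarith

/-- If `y` were never reached, the whole mass would lie on the other `N - 1` configurations of the
class, each of mass at most `(1 + o(1)) / N` by the preceding bound. -/
theorem exists_iterate_zigzagOp_single_pos {d k : ℕ} {a : ℝ} (ha0 : 0 < a) (ha1 : a ≤ 1)
    {x₀ : Conf d}
    (h : Hypercontractive (shuffleOp (directions d k)) (2 / (1 + a)) (confClass k x₀))
    {y : Conf d} (hy : y ∈ confClass k x₀) :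
    ∃ n, 0 < (zigzagOp d k)^[n] (Pi.single y 1) x₀ := by
  by_contra! hneg
  set S := confClass k x₀ with hSd
  have hx₀ : x₀ ∈ S := mem_confClass.2 fun _ => rfl
  have hN : (0 : ℝ) < #S := by exact_mod_cast card_pos.2 ⟨x₀, hx₀⟩
  have hf0 : ∀ z x, (0 : ℝ) ≤ (Pi.single z 1 : Conf d → ℝ) x := fun z x => by
    by_cases hx : x = z
    · subst hx; simp
    · simp [hx]
  have hmass : ∀ n, ∑ z ∈ S, (zigzagOp d k)^[n] (Pi.single z 1) x₀ = 1 := by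
    intro n
    have e : ∀ z, (zigzagOp d k)^[n] (Pi.single z 1) x₀ =
        (zigzagOp d k)^[n] (Pi.single x₀ 1) z := by
      intro z
      have := sum_iterate_zigzagOp_mul k n (Pi.single z 1) (Pi.single x₀ 1)
      rw [sum_eq_single x₀, sum_eq_single z] at this
      · simpa using this
      · intro x _ hx; simp [hx]
      · simp
      · intro x _ hx; simp [hx]
      · simp
    rw [sum_congr rfl fun z _ => e z, sum_subset (subset_univ S), sum_iterate_zigzagOp]
    · simp
    · intro z _ hz
      exact iterate_zigzagOp_eq_zero k n (fun x hx =>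
        Pi.single_eq_of_ne (by rintro rfl; exact hx hx₀) _) z hz
  have hbound : ∀ s : ℕ, (#S : ℝ) ≤ (#S - 1) * (#S : ℝ) ^ ((1 - a) ^ s) := by
    intro s
    have h1 := hmass (2 * s)
    rw [← sum_erase_add S _ hy] at h1
    have h2 : ∑ z ∈ S.erase y, #S * (zigzagOp d k)^[2 * s] (Pi.single z 1) x₀ ≤
        #(S.erase y) • (#S : ℝ) ^ ((1 - a) ^ s) := by
      refine sum_le_card_nsmul _ _ _ fun z hz => ?_
      have := iterate_zigzagOp_single_le ha0 ha1 h (mem_of_mem_erase hz) (2 * s)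
      rwa [show 2 * s / 2 = s by omega] at this
    rw [← mul_sum, card_erase_of_mem hy, nsmul_eq_mul,
      Nat.cast_sub (card_pos.2 ⟨x₀, hx₀⟩), Nat.cast_one] at h2
    have h3 := hneg (2 * s)
    nlinarith
  have hlim : Filter.Tendsto (fun s : ℕ => ((#S : ℝ) - 1) * (#S : ℝ) ^ ((1 - a) ^ s)) Filter.atTop
      (nhds ((#S - 1) * (#S : ℝ) ^ (0 : ℝ))) :=
    ((Real.continuousAt_const_rpow hN.ne').tendsto.comp
      (tendsto_pow_atTop_nhds_zero_of_lt_one (by linarith) (by linarith))).const_mul _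
  have := ge_of_tendsto' hlim hbound
  rw [Real.rpow_zero] at this
  linarith

end ThorpShuffle

/-! ### From operators on configurations back to the kernels on arrangements. -/

namespace ThorpShuffle
open Finset
open scoped Matrix

theorem move_move {d : ℕ} (j : Fin d) (coin : Edge j → Bool) (x : Cube d) :
    move j coin (move j coin x) = x := by
  have h : ∀ b, edgeAt j (Function.update x j b) = edgeAt j x := fun b =>
    Subtype.ext (Function.update_idem _ _ _)
  unfold move
  by_cases hc : coin (edgeAt j x) = true <;> simp [hc, h]

/-- `move` as a permutation of the vertices. -/
def moveEquiv {d : ℕ} (j : Fin d) (coin : Edge j → Bool) : Cube d ≃ Cube d :=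
  ⟨move j coin, move j coin, move_move j coin, move_move j coin⟩

/-- `flipMove` carries a coin for every vertex but consults only those at lower endpoints, so the
superfluous coins cancel. -/
theorem sum_flipMove_div_eq {d : ℕ} (j : Fin d) (H : (Cube d → Cube d) → ℝ) :
    (∑ c : Cube d → Bool, H (flipMove j c)) / 2 ^ 2 ^ d =
      (∑ coin : Edge j → Bool, H (move j coin)) / Fintype.card (Edge j → Bool) := by
  set e := Equiv.piEquivPiSubtypeProd (fun x : Cube d => x j = false) (fun _ => Bool) with he
  have h1 : ∑ c : Cube d → Bool, H (flipMove j c) =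
      Fintype.card ({x : Cube d // ¬x j = false} → Bool) *
        ∑ coin : Edge j → Bool, H (move j coin) := by
    calc _ = ∑ z : (Edge j → Bool) × ({x : Cube d // ¬x j = false} → Bool), H (move j z.1) :=
          Fintype.sum_equiv e _ _ fun c => rfl
      _ = _ := by
        rw [Fintype.sum_prod_type_right]
        simp only [sum_const, card_univ, nsmul_eq_mul]
  have h2 : (2 : ℝ) ^ 2 ^ d = Fintype.card (Edge j → Bool) *
      Fintype.card ({x : Cube d // ¬x j = false} → Bool) := by
    have := Fintype.card_congr e
    rw [Fintype.card_prod] at this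
    have hcube : Fintype.card (Cube d → Bool) = 2 ^ 2 ^ d := by simp
    rw [hcube] at this
    exact_mod_cast this
  have h3 : (Fintype.card (Edge j → Bool) : ℝ) ≠ 0 := Nat.cast_ne_zero.2 Fintype.card_ne_zero
  have h4 : (Fintype.card ({x : Cube d // ¬x j = false} → Bool) : ℝ) ≠ 0 :=
    Nat.cast_ne_zero.2 Fintype.card_ne_zero
  rw [h1, h2]
  field_simp

theorem ringKernel_apply {d : ℕ} (j : Fin d) (X Y : Arrangement d) :
    ringKernel j X Y = (∑ coin : Edge j → Bool, if Y = X.trans (moveEquiv j coin) then 1 else 0) /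
      Fintype.card (Edge j → Bool) := by
  have h : ∀ coin : Edge j → Bool, (∀ i, Y i = move j coin (X i)) ↔
      Y = X.trans (moveEquiv j coin) := fun coin => by
    rw [Equiv.ext_iff]; rfl
  rw [ringKernel, Matrix.of_apply, Nat.card_eq_fintype_card, Nat.card_eq_fintype_card,
    Fintype.card_subtype, card_filter]
  push_cast
  simp only [h]

theorem ringKernel_transpose {d : ℕ} (j : Fin d) : (ringKernel j)ᵀ = ringKernel j := by
  ext X Y
  rw [Matrix.transpose_apply, ringKernel_apply, ringKernel_apply]
  congr 1
  refine sum_congr rfl fun coin _ => if_congr ?_ rfl rfl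
  simp only [Equiv.ext_iff, Equiv.trans_apply]
  refine forall_congr' fun i => ?_
  change X i = move j coin (Y i) ↔ Y i = move j coin (X i)
  constructor <;> (intro h; rw [h, move_move])

theorem ringKernel_mulVec {d : ℕ} (j : Fin d) (G : Arrangement d → ℝ) (X : Arrangement d) :
    (ringKernel j *ᵥ G) X = (∑ coin : Edge j → Bool, G (X.trans (moveEquiv j coin))) /
      Fintype.card (Edge j → Bool) := by
  simp only [Matrix.mulVec, dotProduct, ringKernel_apply, div_mul_eq_mul_div, ← sum_div, sum_mul]
  rw [sum_comm]
  congr 1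
  refine sum_congr rfl fun coin _ => ?_
  simp

/-- The vertices occupied by the cards of `B`. -/
def occupied {d : ℕ} (B : Finset (Fin (2 ^ d))) (X : Arrangement d) : Conf d :=
  fun y => decide (y ∈ positions X B)

theorem occupied_trans_moveEquiv {d : ℕ} (B : Finset (Fin (2 ^ d))) (X : Arrangement d) (j : Fin d)
    (coin : Edge j → Bool) :
    occupied B (X.trans (moveEquiv j coin)) = occupied B X ∘ move j coin := by
  funext y
  simp only [occupied, positions, Function.comp, mem_map, Equiv.coe_toEmbedding, Equiv.trans_apply]
  refine decide_eq_decide.2 (exists_congr fun i => and_congr_right fun _ => ?_)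
  change move j coin (X i) = y ↔ X i = move j coin y
  constructor
  · rintro rfl; rw [move_move]
  · intro h; rw [h, move_move]

theorem ringKernel_mulVec_comp_occupied {d : ℕ} (j : Fin d) (B : Finset (Fin (2 ^ d)))
    (F : Conf d → ℝ) : ringKernel j *ᵥ (F ∘ occupied B) = ringOp j F ∘ occupied B := by
  funext X
  rw [ringKernel_mulVec, Function.comp_apply, ringOp_apply,
    sum_flipMove_div_eq j (fun m => F (occupied B X ∘ m))]
  simp only [Function.comp_apply, occupied_trans_moveEquiv]

/-- A product of kernels acts on functions with its last factor first. So the Thorp kernel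
corresponds to `unshuffleOp`, and its transpose to `shuffleOp`. -/
theorem prod_ringKernel_mulVec {d : ℕ} (l : List (Fin d)) (B : Finset (Fin (2 ^ d)))
    (F : Conf d → ℝ) :
    (l.map ringKernel).prod *ᵥ (F ∘ occupied B) = unshuffleOp l F ∘ occupied B := by
  induction l with
  | nil => simp [unshuffleOp]
  | cons j l ih =>
    rw [List.map_cons, List.prod_cons, ← Matrix.mulVec_mulVec, ih,
      ringKernel_mulVec_comp_occupied]
    rfl

theorem prod_ringKernel_transpose_mulVec {d : ℕ} (l : List (Fin d)) (B : Finset (Fin (2 ^ d)))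
    (F : Conf d → ℝ) :
    (l.map ringKernel).prodᵀ *ᵥ (F ∘ occupied B) = shuffleOp l F ∘ occupied B := by
  induction l generalizing F with
  | nil => simp [shuffleOp]
  | cons j l ih =>
    rw [List.map_cons, List.prod_cons, Matrix.transpose_mul, ← Matrix.mulVec_mulVec,
      ringKernel_transpose, ringKernel_mulVec_comp_occupied, ih]
    rfl

theorem truncatedZigzagKernel_pow_mulVec (d k n : ℕ) (B : Finset (Fin (2 ^ d))) (F : Conf d → ℝ) :
    truncatedZigzagKernel d k ^ n *ᵥ (F ∘ occupied B) =
      (zigzagOp d k)^[n] F ∘ occupied B := by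
  induction n with
  | zero => simp
  | succ n ih =>
    rw [pow_succ', ← Matrix.mulVec_mulVec, ih, truncatedZigzagKernel, truncatedThorpKernel,
      ← Matrix.mulVec_mulVec, prod_ringKernel_transpose_mulVec, prod_ringKernel_mulVec,
      Function.iterate_succ_apply']
    rfl

/-- The indicator function of a set of vertices. -/
def confOf {d : ℕ} (B' : Finset (Cube d)) : Conf d := fun y => decide (y ∈ B')

theorem confOf_injective {d : ℕ} : Function.Injective (confOf (d := d)) := by
  intro A A' h
  ext y
  exact decide_eq_decide.1 (congrFun h y)

theorem confOf_positions {d : ℕ} (B : Finset (Fin (2 ^ d))) (X : Arrangement d) :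
    confOf (positions X B) = occupied B X := rfl

theorem hitProb_eq {d : ℕ} (k n : ℕ) (X₀ : Arrangement d) (B : Finset (Fin (2 ^ d)))
    (B' : Finset (Cube d)) : hitProb k X₀ n B B' =
      (zigzagOp d k)^[n] (Pi.single (confOf B') 1) (occupied B X₀) := by
  have h := congrFun (truncatedZigzagKernel_pow_mulVec d k n B (Pi.single (confOf B') 1)) X₀
  rw [Function.comp_apply] at h
  rw [← h, hitProb, Matrix.mulVec, dotProduct, sum_filter]
  refine sum_congr rfl fun X _ => ?_
  rw [Function.comp_apply, Pi.single_apply, ← confOf_positions]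
  by_cases hX : positions X B = B'
  · simp [hX]
  · rw [if_neg hX, if_neg fun h' => hX (confOf_injective h'), mul_zero]

theorem mul_apply_nonneg {ι : Type*} [Fintype ι] {M N : Matrix ι ι ℝ} (hM : ∀ i j, 0 ≤ M i j)
    (hN : ∀ i j, 0 ≤ N i j) (i j : ι) : 0 ≤ (M * N) i j := by
  rw [Matrix.mul_apply]; exact sum_nonneg fun l _ => mul_nonneg (hM i l) (hN l j)

theorem one_apply_nonneg {ι : Type*} [DecidableEq ι] (i j : ι) : 0 ≤ (1 : Matrix ι ι ℝ) i j := by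
  rw [Matrix.one_apply]; split_ifs <;> norm_num

theorem truncatedThorpKernel_nonneg (d k : ℕ) (X Y : Arrangement d) :
    0 ≤ truncatedThorpKernel d k X Y := by
  rw [truncatedThorpKernel]
  generalize (List.finRange d).filter (fun j : Fin d => (j : ℕ) < k) = l
  induction l generalizing X Y with
  | nil => exact one_apply_nonneg X Y
  | cons j l ih =>
    rw [List.map_cons, List.prod_cons]
    refine mul_apply_nonneg (fun X Y => ?_) ih X Y
    rw [ringKernel, Matrix.of_apply]; positivity

theorem truncatedZigzagKernel_pow_nonneg (d k n : ℕ) (X Y : Arrangement d) :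
    0 ≤ (truncatedZigzagKernel d k ^ n) X Y := by
  induction n generalizing X Y with
  | zero => rw [pow_zero]; exact one_apply_nonneg X Y
  | succ n ih =>
    rw [pow_succ]
    exact mul_apply_nonneg ih (mul_apply_nonneg (truncatedThorpKernel_nonneg d k)
      fun X Y => truncatedThorpKernel_nonneg d k Y X) X Y

theorem mem_reachablePositions {d k : ℕ} {X₀ : Arrangement d} {B : Finset (Fin (2 ^ d))}
    {B' : Finset (Cube d)} : B' ∈ reachablePositions k X₀ B ↔ ∃ n, 0 < hitProb k X₀ n B B' := by
  constructor
  · rintro ⟨X, ⟨n, hn⟩, hX⟩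
    refine ⟨n, hn.trans_le ?_⟩
    exact single_le_sum (f := fun X => (truncatedZigzagKernel d k ^ n) X₀ X)
      (fun X _ => truncatedZigzagKernel_pow_nonneg d k n X₀ X) (by simpa using hX)
  · rintro ⟨n, hn⟩
    obtain ⟨X, hX, hX'⟩ := exists_lt_of_sum_lt (s := {X : Arrangement d | positions X B = B'})
      (f := fun _ => (0 : ℝ)) (g := fun X => (truncatedZigzagKernel d k ^ n) X₀ X)
      (by simpa [hitProb] using hn)
    exact ⟨X, ⟨n, hX'⟩, by simpa using hX⟩

theorem hitProb_eq_zero {d k : ℕ} {X₀ : Arrangement d} {B : Finset (Fin (2 ^ d))}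
    {B' : Finset (Cube d)} (h : confOf B' ∉ confClass k (occupied B X₀)) (n : ℕ) :
    hitProb k X₀ n B B' = 0 := by
  rw [hitProb_eq]
  refine iterate_zigzagOp_eq_zero k n (x₀ := confOf B') (fun x hx => ?_) _ fun h' => h ?_
  · exact Pi.single_eq_of_ne (by rintro rfl; exact hx (mem_confClass.2 fun _ => rfl)) _
  · rw [mem_confClass] at h' ⊢
    exact fun y => (h' y).symm

theorem mem_reachablePositions_iff {d k : ℕ} {a : ℝ} (ha0 : 0 < a) (ha1 : a ≤ 1)
    {X₀ : Arrangement d} {B : Finset (Fin (2 ^ d))} (h : Hypercontractive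
      (shuffleOp (directions d k)) (2 / (1 + a)) (confClass k (occupied B X₀)))
    {B' : Finset (Cube d)} :
    B' ∈ reachablePositions k X₀ B ↔ confOf B' ∈ confClass k (occupied B X₀) := by
  rw [mem_reachablePositions]
  constructor
  · rintro ⟨n, hn⟩
    by_contra hB
    exact hn.ne' (hitProb_eq_zero hB n)
  · intro hB
    obtain ⟨n, hn⟩ := exists_iterate_zigzagOp_single_pos ha0 ha1 h hB
    exact ⟨n, by rwa [hitProb_eq]⟩

theorem ncard_reachablePositions {d k : ℕ} {a : ℝ} (ha0 : 0 < a) (ha1 : a ≤ 1)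
    {X₀ : Arrangement d} {B : Finset (Fin (2 ^ d))} (h : Hypercontractive
      (shuffleOp (directions d k)) (2 / (1 + a)) (confClass k (occupied B X₀))) :
    (reachablePositions k X₀ B).ncard = #(confClass k (occupied B X₀)) := by
  have himg : confOf '' reachablePositions k X₀ B = confClass k (occupied B X₀) := by
    ext x
    constructor
    · rintro ⟨B', hB', rfl⟩
      exact (mem_reachablePositions_iff ha0 ha1 h).1 hB'
    · intro hx
      have e : confOf {y | x y = true} = x := by funext y; simp [confOf]
      exact ⟨_, (mem_reachablePositions_iff ha0 ha1 h).2 (by rw [e]; exact hx), e⟩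
  rw [← Set.ncard_image_of_injective _ confOf_injective, himg, Set.ncard_coe_finset]

/-- Split the coordinates of a vertex into those from the `k`-th on, and the others. -/
def coordEquiv (d k : ℕ) : Cube d ≃
    ({j : Fin d // k ≤ (j : ℕ)} → Bool) × ({j : Fin d // ¬k ≤ (j : ℕ)} → Bool) :=
  Equiv.piEquivPiSubtypeProd (fun j : Fin d => k ≤ (j : ℕ)) fun _ => Bool

theorem cubeCount_eq_count {d k : ℕ} (x : Conf d) (y : Cube d) : cubeCount k x y =
    count true fun r => x ((coordEquiv d k).symm ((coordEquiv d k y).1, r)) := by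
  have hiff : ∀ y' : Cube d, (∀ i : Fin d, k ≤ (i : ℕ) → y' i = y i) ↔
      (coordEquiv d k y').1 = (coordEquiv d k y).1 := fun y' =>
    ⟨fun h => funext fun i => h i i.2, fun h i hi => congrFun h ⟨i, hi⟩⟩
  rw [cubeCount, count]
  refine card_nbij' (fun y' => (coordEquiv d k y').2)
    (fun r => (coordEquiv d k).symm ((coordEquiv d k y).1, r)) ?_ ?_ ?_ ?_
  · intro y' hy'
    simp only [coe_filter, mem_univ, true_and, Set.mem_ofPred_eq, hiff] at hy' ⊢
    rw [← hy'.2, Prod.mk.eta, Equiv.symm_apply_apply]; exact hy'.1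
  · intro r hr
    simp only [coe_filter, mem_univ, true_and, Set.mem_ofPred_eq, hiff] at hr ⊢
    exact ⟨hr, by rw [Equiv.apply_symm_apply]⟩
  · intro y' hy'
    simp only [coe_filter, mem_univ, true_and, Set.mem_ofPred_eq, hiff] at hy'
    dsimp only
    rw [← hy'.2, Prod.mk.eta, Equiv.symm_apply_apply]
  · intro r _
    dsimp only
    rw [Equiv.apply_symm_apply]

theorem cubeCount_occupied {d k : ℕ} (B : Finset (Fin (2 ^ d))) (X : Arrangement d) (y : Cube d) :
    cubeCount k (occupied B X) y = cardsIn k X B (coordEquiv d k y).1 := by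
  rw [cubeCount, cardsIn]
  congr 1
  ext y'
  simp only [mem_filter, mem_univ, true_and, occupied, decide_eq_true_eq, Subtype.forall]
  rfl

theorem card_confClass_occupied {d k : ℕ} (hk : k ≤ d) (B : Finset (Fin (2 ^ d)))
    (X : Arrangement d) : #(confClass k (occupied B X)) =
      ∏ Q : {j : Fin d // k ≤ (j : ℕ)} → Bool, (2 ^ k).choose (cardsIn k X B Q) := by
  have hR : Fintype.card ({j : Fin d // ¬k ≤ (j : ℕ)} → Bool) = 2 ^ k := by
    rw [Fintype.card_fun, Fintype.card_bool]
    simp only [not_le]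
    rw [Fintype.card_fin_lt_of_le hk]
  have h1 : #(confClass k (occupied B X)) =
      #(Fintype.piFinset fun Q : {j : Fin d // k ≤ (j : ℕ)} → Bool =>
        ({u | count true u = cardsIn k X B Q} :
          Finset (({j : Fin d // ¬k ≤ (j : ℕ)} → Bool) → Bool))) := by
    refine card_equiv (((coordEquiv d k).arrowCongr (Equiv.refl Bool)).trans
      (Equiv.curry _ _ _)) fun x => ?_
    simp only [mem_confClass, Fintype.mem_piFinset, mem_filter, mem_univ, true_and,
      cubeCount_occupied, cubeCount_eq_count x]
    constructor
    · intro h Q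
      have := h ((coordEquiv d k).symm (Q, fun _ => false))
      rw [Equiv.apply_symm_apply] at this
      exact this
    · intro h y
      exact h _
  rw [h1, Fintype.card_piFinset]
  exact prod_congr rfl fun Q _ => by rw [card_count_eq, hR]

/-- The logarithm of the class size is at most `2 ^ d log 2 ≤ exp d`, and `(1 - a) ^ s ≤ exp (-a
s)`. -/
theorem card_rpow_pow_le_exp {d k s : ℕ} {a r : ℝ} (ha1 : a ≤ 1) (x₀ : Conf d)
    (hs : (d : ℝ) + r ≤ a * s) :
    (#(confClass k x₀) : ℝ) ^ ((1 - a) ^ s) ≤ Real.exp (Real.exp (-r)) := by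
  have hN : (1 : ℝ) ≤ #(confClass k x₀) := by
    exact_mod_cast card_pos.2 ⟨x₀, mem_confClass.2 fun _ => rfl⟩
  have hN2 : (#(confClass k x₀) : ℝ) ≤ 2 ^ 2 ^ d := by
    have : #(confClass k x₀) ≤ 2 ^ 2 ^ d := (card_le_univ _).trans_eq (by simp)
    exact_mod_cast this
  have hlog : Real.log #(confClass k x₀) ≤ Real.exp d := by
    calc Real.log #(confClass k x₀) ≤ Real.log (2 ^ 2 ^ d) := Real.log_le_log (by linarith) hN2
      _ = 2 ^ d * Real.log 2 := by rw [Real.log_pow]; push_cast; rfl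
      _ ≤ 2 ^ d * 1 := by
        refine mul_le_mul_of_nonneg_left ?_ (by positivity)
        have := Real.log_two_lt_d9; linarith
      _ ≤ Real.exp 1 ^ d := by
        rw [mul_one]
        refine pow_le_pow_left₀ (by norm_num) ?_ d
        have := Real.add_one_le_exp (1 : ℝ); linarith
      _ = Real.exp d := by rw [← Real.exp_nat_mul, mul_one]
  have hpow : (1 - a) ^ s ≤ Real.exp (-(a * s)) := by
    calc (1 - a) ^ s ≤ Real.exp (-a) ^ s :=
          pow_le_pow_left₀ (by linarith) (Real.one_sub_le_exp_neg a) s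
      _ = _ := by rw [← Real.exp_nat_mul]; congr 1; ring
  rw [Real.rpow_def_of_pos (by linarith)]
  refine Real.exp_le_exp.2 ?_
  calc Real.log #(confClass k x₀) * (1 - a) ^ s ≤ Real.exp d * Real.exp (-(a * s)) :=
        mul_le_mul hlog hpow (pow_nonneg (by linarith) s) (Real.exp_pos _).le
    _ = Real.exp (d - a * s) := by rw [← Real.exp_add]; rfl
    _ ≤ _ := Real.exp_le_exp.2 (by linarith)

end ThorpShuffle

/-! ### Choice of the constant and conclusion. -/

theorem mainTheorem6 :
    ∃ c : ℕ, 0 < c ∧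
      ∀ (d dstar : ℕ), 2 ≤ dstar → dstar ≤ d →
      ∀ (X₀ : ThorpShuffle.Arrangement d) (B : Finset (Fin (2 ^ d))),
        (ThorpShuffle.reachablePositions dstar X₀ B).ncard =
          ∏ Q : {j : Fin d // dstar ≤ (j : ℕ)} → Bool,
            Nat.choose (2 ^ dstar) (ThorpShuffle.cardsIn dstar X₀ B Q) ∧
        ∀ (k : ℝ) (l : ℕ), 1 ≤ k → (l : ℝ) = k * c * d * ((dstar : ℝ) - 1) ^ 4 →
        ∀ B' : Finset (ThorpShuffle.Cube d),
          ((ThorpShuffle.reachablePositions dstar X₀ B).ncard : ℝ) *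
              ThorpShuffle.hitProb dstar X₀ l B B' ≤
            Real.exp (Real.exp (-k)) := by
  obtain ⟨α, c₀, hc₀, hα0, hα1, hαc, hα⟩ := ThorpShuffle.exists_exponents
  -- The factor 128 is `2 * 16 * 4`, from `d + k ≤ 2 k d`, from `m ^ 4 ≤ 16 (m - 1) ^ 4`, and from
  -- bounding `l / 2`, rounded down, below by a quarter of `l`. The last needs `l ≥ 2`, which the
  -- summand 2 guarantees.
  refine ⟨⌈128 / c₀⌉₊ + 2, by omega, fun d m hm hmd X₀ B => ?_⟩
  have hH := ThorpShuffle.hypercontractive_shuffleOp hα0 hα1 hα hmd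
    (ThorpShuffle.occupied B X₀)
  have hcard := ThorpShuffle.ncard_reachablePositions (hα0 m) (hα1 m) hH
  refine ⟨by rw [hcard, ThorpShuffle.card_confClass_occupied hmd], fun k l hk hl B' => ?_⟩
  rw [hcard]
  by_cases hB : ThorpShuffle.confOf B' ∈ ThorpShuffle.confClass m (ThorpShuffle.occupied B X₀)
  swap
  · rw [ThorpShuffle.hitProb_eq_zero hB, mul_zero]; exact (Real.exp_pos _).le
  rw [ThorpShuffle.hitProb_eq]
  refine (ThorpShuffle.iterate_zigzagOp_single_le (hα0 m) (hα1 m) hH hB l).trans ?_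
  refine ThorpShuffle.card_rpow_pow_le_exp (hα1 m) _ ?_
  have hm' : (2 : ℝ) ≤ m := by exact_mod_cast hm
  have hd' : (2 : ℝ) ≤ d := by exact_mod_cast hm.trans hmd
  have hc : 128 / c₀ + 2 ≤ ((⌈128 / c₀⌉₊ + 2 : ℕ) : ℝ) := by
    push_cast; linarith [Nat.le_ceil (128 / c₀)]
  set c : ℝ := ((⌈128 / c₀⌉₊ + 2 : ℕ) : ℝ) with hcd
  have h128 : 0 < 128 / c₀ := by positivity
  set M : ℝ := ((m : ℝ) - 1) ^ 4 with hM
  have hM1 : 1 ≤ M := one_le_pow₀ (by linarith)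
  have hα' : c₀ / (16 * M) ≤ α m := by
    refine le_trans ?_ (hαc m (by omega))
    refine div_le_div_of_nonneg_left hc₀.le (by positivity) ?_
    calc (m : ℝ) ^ 4 ≤ (2 * ((m : ℝ) - 1)) ^ 4 :=
          pow_le_pow_left₀ (by positivity) (by linarith) 4
      _ = 16 * M := by rw [hM]; ring
  have hkc : 2 ≤ k * c := by nlinarith
  have hkd : 1 * 1 ≤ d * M := mul_le_mul (by linarith) hM1 zero_le_one (by linarith)
  have hl2 : 2 ≤ (l : ℝ) := by
    rw [hl, mul_assoc]; nlinarith
  have hs : (l : ℝ) / 4 ≤ ((l / 2 : ℕ) : ℝ) := by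
    have h1 : 2 ≤ l := by exact_mod_cast hl2
    have h2 : l ≤ 4 * (l / 2) := by omega
    have h3 : (l : ℝ) ≤ 4 * ((l / 2 : ℕ) : ℝ) := by exact_mod_cast h2
    linarith
  calc (d : ℝ) + k ≤ 2 * (k * d) := by nlinarith
    _ = 128 / c₀ * (k * d) * c₀ / 64 := by field_simp; norm_num
    _ ≤ c * (k * d) * c₀ / 64 := by gcongr; linarith
    _ = c₀ / (16 * M) * (l / 4) := by rw [hl]; field_simp; ring
    _ ≤ α m * ((l / 2 : ℕ) : ℝ) := by
      refine mul_le_mul hα' hs (by positivity) (hα0 m).le
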